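/- **Notation and definitions.** $\mathbb D$ is the open unit disc in $\mathbb C$ and $G=\{(z+w,zw): z,w\in\mathbb D\}\subset\mathbb C^2$ is the symmetrized bidisc. For a complex manifold $\Omega$, $\operatorname{Aut}\Omega$ is the group of biholomorphic self-maps of $\Omega$. $\operatorname{Aut}\mathbb D$ carries its usual structure of a real $3$-dimensional Lie group, with local coordinates $(r,\alpha)\in\mathbb R\times\mathbb D$ given by $(r,\alpha)\mapsto e^{ir}B_\alpha$, where $B_\alpha(z)=\dfrac{z-\alpha}{1-\bar\alpha z}$. A *properly embedded analytic disc* in $\Omega$ is the image of a *proper analytic embedding* $f:\mathbb D\to\Omega$, that is, of a proper injective holomorphic immersion. A properly embedded analytic disc $D\subset\Omega$ is a *royal disc* (and $(\Omega,D)$ is a *royal manifold*) if every automorphism of $\Omega$ maps $D$ onto itself, every automorphism of $\Omega$ is uniquely determined by its values on $D$, and every automorphism of the complex manifold $D$ extends to an automorphism of $\Omega$. A *concomitant pair* for a royal manifold $(\Omega,D)$ is a pair $(d,\Theta)$ where $d:\mathbb D\to\Omega$ is a proper analytic embedding with $d(\mathbb D)=D$ and $\Theta:\operatorname{Aut}\mathbb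 D\to\operatorname{Aut}\Omega$ is an isomorphism of groups such that $\Theta(m)\circ d=d\circ m$ for all $m\in\operatorname{Aut}\mathbb D$. Every royal manifold has a concomitant pair, and if $(d,\Theta)$ is one then all of them are the pairs $(d\circ b,\ m\mapsto\Theta(b\circ m\circ b^{-1}))$, $b\in\operatorname{Aut}\mathbb D$. $(\Omega,D)$ is *regular* if, for a concomitant pair $(d,\Theta)$ (the choice is immaterial), (1) $\Theta$ is differentiable, in the sense that the action $(m,\lambda)\mapsto\Theta(m)(\lambda)$, $\operatorname{Aut}\mathbb D\times\Omega\to\Omega$, is a differentiable map of real manifolds; (2) the stabilizer in $\operatorname{Aut}\Omega$ of each $\lambda\in\Omega\setminus D$ is finite; (3) for each $\lambda\in\Omega\setminus D$ the real-linear map $e_\lambda'(\mathrm{id}_{\mathbb D}):\operatorname{Lie}(\operatorname{Aut}\mathbb D)\to T_\lambda\Omega$, where $e_\lambda(m)=\Theta(m)(\lambda)$, is injective (has real rank $3$). A *flat fibration* of $\Omega$ over $D$ is a family $\mathcal E=\{E_\lambda\}_{\lambda\in D}$ of properly embedded analytic discs in $\Omega$ that is a partition of $\Omega$ and satisfies $E_\lambda\cap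 D=\{\lambda\}$ and $\theta(E_\lambda)=E_{\theta(\lambda)}$ for all $\lambda\in D$ and $\theta\in\operatorname{Aut}\Omega$. Then $(\Omega,D,\mathcal E)$ is called a *flatly fibered royal manifold*. $(\Omega,D,\mathcal E)$ is *synchronous* if, for a concomitant pair $(d,\Theta)$ (the choice is immaterial) and for every $z_0\in\mathbb D$, there is a proper analytic embedding $f:\mathbb D\to\Omega$ with $f(z_0)=d(z_0)$, $f(\mathbb D)=E_{d(z_0)}$ and $\Theta(m)\circ f=f\circ m\circ m$ for all $m\in\operatorname{Aut}\mathbb D$ with $m(z_0)=z_0$. The *Poincaré parameter* of $\mu\in E_\lambda$ is $P(\mu)=\operatorname{arctanh}\left|\dfrac{z-z_0}{1-\bar z_0z}\right|$, where $f:\mathbb D\to\Omega$ is a proper analytic embedding with $f(\mathbb D)=E_\lambda$, $f(z_0)=\lambda$ and $f(z)=\mu$. For $\mu\in\Omega\setminus D$, $\operatorname{Aut}\Omega$ *acts sharply at $\mu$ with respect to $(d,\Theta)$* if, for a chart $\psi$ of $\Omega$ at $\mu$, $$e^{2P(\mu)}\bigl(\psi(\Theta(B_{it})(\mu))-\psi(\mu)\bigr)=i\bigl(\psi(\Theta(B_t)(\mu))-\psi(\mu)\bigr)+o(t)\qquad\text{as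 } t\to0 \text{ in }\mathbb R .$$ $\operatorname{Aut}\Omega$ *acts sharply on $\Omega$* if for every $\mu\in\Omega\setminus D$ there is a concomitant pair $(d,\Theta)$ with respect to which $\operatorname{Aut}\Omega$ acts sharply at $\mu$. **Theorem.** A complex manifold $\Omega$ is biholomorphic to $G$ if and only if there exist a royal disc $D$ in $\Omega$ and a flat fibration $\mathcal E$ of $\Omega$ over $D$ such that $(\Omega,D,\mathcal E)$ is a synchronous, regular, flatly fibered royal manifold and $\operatorname{Aut}\Omega$ acts sharply on $\Omega$. -/

import Mathlib

open Set Filter Topology Complex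
open scoped Manifold ContDiff ComplexConjugate

noncomputable section

/-! ### The unit disc and the symmetrized bidisc as complex manifolds -/

/-- The open unit disc, as an open complex submanifold of `ℂ`. -/
def unitDisc : TopologicalSpace.Opens ℂ := ⟨Metric.ball 0 1, Metric.isOpen_ball⟩

theorem mem_unitDisc {z : ℂ} : z ∈ unitDisc ↔ ‖z‖ < 1 := mem_ball_zero_iff

/-- The symmetrized bidisc `{(z + w, zw) : |z| < 1, |w| < 1}` as a subset of `ℂ²`. -/
def symBidiscSet : Set (ℂ × ℂ) :=
  {s | ∃ z w : ℂ, ‖z‖ < 1 ∧ ‖w‖ < 1 ∧ s = (z + w, z * w)}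

theorem normSq_key (z w : ℂ) :
    (z + w) - conj (z + w) * (z * w)
      = z * ((1 - ‖w‖ ^ 2 : ℝ) : ℂ) + w * ((1 - ‖z‖ ^ 2 : ℝ) : ℂ) := by
  push_cast
  rw [← Complex.conj_mul' z, ← Complex.conj_mul' w, map_add]
  ring

theorem exists_roots (s p : ℂ) : ∃ z w : ℂ, s = z + w ∧ p = z * w := by
  obtain ⟨r, hr⟩ := IsSquare.exists_sq (s ^ 2 - 4 * p)
    (by
      obtain ⟨r, hr⟩ := IsAlgClosed.exists_pow_nat_eq (s ^ 2 - 4 * p) (n := 2) (by norm_num)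
      exact ⟨r, by rw [← hr]; ring⟩)
  refine ⟨(s + r) / 2, (s - r) / 2, by ring, ?_⟩
  linear_combination (-1 / 4) * hr

theorem symBidiscSet_eq :
    symBidiscSet = {s : ℂ × ℂ | ‖s.1 - conj s.1 * s.2‖ < 1 - ‖s.2‖ ^ 2} := by
  ext ⟨s, p⟩
  simp only [symBidiscSet, mem_ofPred_eq, Prod.mk.injEq]
  constructor
  · rintro ⟨z, w, hz, hw, rfl, rfl⟩
    rw [normSq_key]
    have hz0 := norm_nonneg z
    have hw0 := norm_nonneg w
    have h1 : 0 < 1 - ‖w‖ ^ 2 := by nlinarith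
    have h2 : 0 < 1 - ‖z‖ ^ 2 := by nlinarith
    refine (norm_add_le _ _).trans_lt ?_
    rw [norm_mul, norm_mul, norm_mul, Complex.norm_real, Complex.norm_real, Real.norm_of_nonneg h1.le,
      Real.norm_of_nonneg h2.le]
    have h3 : ‖z‖ * ‖w‖ < 1 := by nlinarith
    nlinarith [mul_pos (mul_pos (sub_pos.2 hz) (sub_pos.2 hw)) (sub_pos.2 h3)]
  · intro h
    obtain ⟨z, w, rfl, rfl⟩ := exists_roots s p
    refine ⟨z, w, ?_, ?_, rfl, rfl⟩
    all_goals
      rw [normSq_key, norm_mul] at h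
      have hz0 := norm_nonneg z
      have hw0 := norm_nonneg w
      have h3 : ‖z‖ * ‖w‖ < 1 := by
        have := norm_nonneg (z * ((1 - ‖w‖ ^ 2 : ℝ) : ℂ) + w * ((1 - ‖z‖ ^ 2 : ℝ) : ℂ))
        nlinarith [mul_nonneg hz0 hw0]
      by_contra hc
      rw [not_lt] at hc
    · have hw1 : ‖w‖ ≤ 1 := by nlinarith
      have h1 : 0 ≤ 1 - ‖w‖ ^ 2 := by nlinarith
      have h2 : 1 - ‖z‖ ^ 2 ≤ 0 := by nlinarith
      have h4 := norm_sub_le_norm_add (z * ((1 - ‖w‖ ^ 2 : ℝ) : ℂ)) (w * ((1 - ‖z‖ ^ 2 : ℝ) : ℂ))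
      rw [norm_mul, norm_mul, Complex.norm_real, Complex.norm_real, Real.norm_of_nonneg h1,
        Real.norm_of_nonpos h2] at h4
      nlinarith [mul_nonneg (mul_nonneg (sub_nonneg.2 hc) (sub_nonneg.2 hw1)) (sub_nonneg.2 h3.le)]
    · have hz1 : ‖z‖ ≤ 1 := by nlinarith
      have h1 : 1 - ‖w‖ ^ 2 ≤ 0 := by nlinarith
      have h2 : 0 ≤ 1 - ‖z‖ ^ 2 := by nlinarith
      have h4 := norm_sub_le_norm_add (w * ((1 - ‖z‖ ^ 2 : ℝ) : ℂ)) (z * ((1 - ‖w‖ ^ 2 : ℝ) : ℂ))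
      rw [add_comm (w * _) (z * _), norm_mul, norm_mul, Complex.norm_real, Complex.norm_real,
        Real.norm_of_nonneg h2, Real.norm_of_nonpos h1] at h4
      nlinarith [mul_nonneg (mul_nonneg (sub_nonneg.2 hc) (sub_nonneg.2 hz1)) (sub_nonneg.2 h3.le)]

theorem isOpen_symBidiscSet : IsOpen symBidiscSet := by
  rw [symBidiscSet_eq]
  exact isOpen_lt (by fun_prop) (by fun_prop)

/-- The symmetrized bidisc `G`, as an open complex submanifold of `ℂ²`. -/
def symBidisc : TopologicalSpace.Opens (ℂ × ℂ) := ⟨symBidiscSet, isOpen_symBidiscSet⟩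

/-! ### Automorphism groups -/

section Aut

variable (E : Type*) [NormedAddCommGroup E] [NormedSpace ℂ E]
  (Ω : Type*) [TopologicalSpace Ω] [ChartedSpace E Ω]

/-- `Aut Ω`: the group, under composition, of all biholomorphic self-maps of `Ω`. -/
def biholAut : Subgroup (Equiv.Perm Ω) where
  carrier := {θ | MDifferentiable 𝓘(ℂ, E) 𝓘(ℂ, E) θ ∧ MDifferentiable 𝓘(ℂ, E) 𝓘(ℂ, E) θ.symm}
  one_mem' := ⟨mdifferentiable_id, mdifferentiable_id⟩
  mul_mem' := fun ha hb => ⟨ha.1.comp hb.1, hb.2.comp ha.2⟩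
  inv_mem' := fun ha => ⟨ha.2, ha.1⟩

end Aut

/-- The formula `z ↦ e^{ir} (z - α) / (1 - ᾱ z)`. -/
def moebiusFun (r : ℝ) (α z : ℂ) : ℂ := cexp (r * I) * ((z - α) / (1 - conj α * z))

theorem moebius_denom_ne {α z : ℂ} (hα : ‖α‖ < 1) (hz : ‖z‖ < 1) : 1 - conj α * z ≠ 0 := by
  intro h
  have h1 : ‖conj α * z‖ = 1 := by rw [← sub_eq_zero.1 h, norm_one]
  rw [norm_mul, RCLike.norm_conj] at h1
  nlinarith [norm_nonneg α, norm_nonneg z]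

theorem norm_moebiusFun_lt (r : ℝ) {α z : ℂ} (hα : ‖α‖ < 1) (hz : ‖z‖ < 1) :
    ‖moebiusFun r α z‖ < 1 := by
  rw [moebiusFun, norm_mul, Complex.norm_exp_ofReal_mul_I, one_mul, norm_div,
    div_lt_one (norm_pos_iff.2 (moebius_denom_ne hα hz))]
  refine lt_of_pow_lt_pow_left₀ 2 (norm_nonneg _) ?_
  rw [← Complex.normSq_eq_norm_sq, ← Complex.normSq_eq_norm_sq]
  have h1 : normSq α < 1 := by rw [Complex.normSq_eq_norm_sq]; nlinarith [norm_nonneg α]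
  have h2 : normSq z < 1 := by rw [Complex.normSq_eq_norm_sq]; nlinarith [norm_nonneg z]
  simp only [normSq_apply, sub_re, sub_im, mul_re, mul_im, conj_re, conj_im, one_re, one_im] at *
  nlinarith [mul_pos (sub_pos.2 h1) (sub_pos.2 h2)]

theorem moebiusFun_inv (r : ℝ) {α z : ℂ} (hα : ‖α‖ < 1) (hz : ‖z‖ < 1) :
    moebiusFun (-r) (-(cexp (r * I) * α)) (moebiusFun r α z) = z := by
  have h1 := moebius_denom_ne hα hz
  have hs : conj (cexp (r * I)) = cexp (-(r * I)) := by
    rw [← Complex.exp_conj, map_mul, conj_ofReal, conj_I, mul_neg]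
  have he : cexp (-(r * I)) * cexp (r * I) = 1 := by rw [← Complex.exp_add]; simp
  have hz0 : cexp (r * I) ≠ 0 := Complex.exp_ne_zero _
  have hαα : 1 - conj α * α ≠ 0 := moebius_denom_ne hα hα
  have h1' : 1 - z * conj α ≠ 0 := by rwa [mul_comm]
  have hαα' : 1 - α * conj α ≠ 0 := by rwa [mul_comm]
  have key : cexp (-(r * I)) * (cexp (r * I) * ((z - α) / (1 - conj α * z)) + cexp (r * I) * α)
      = z * (1 - conj α * α) / (1 - conj α * z) := by
    rw [← mul_add, ← mul_assoc, he]
    field_simp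
    ring
  have key2 : 1 + cexp (-(r * I)) * conj α * (cexp (r * I) * ((z - α) / (1 - conj α * z)))
      = (1 - conj α * α) / (1 - conj α * z) := by
    have : cexp (-(r * I)) * conj α * (cexp (r * I) * ((z - α) / (1 - conj α * z)))
      = (cexp (-(r * I)) * cexp (r * I)) * (conj α * ((z - α) / (1 - conj α * z))) := by ring
    rw [this, he]
    field_simp
    ring
  simp only [moebiusFun, ofReal_neg, neg_mul, map_neg, map_mul, sub_neg_eq_add, hs]
  rw [← mul_div_assoc, key, key2, div_div_div_cancel_right₀ h1, mul_div_assoc, div_self hαα,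
    mul_one]

theorem norm_moebius_param (r : ℝ) {α : ℂ} (hα : ‖α‖ < 1) : ‖-(cexp (r * I) * α)‖ < 1 := by
  rwa [norm_neg, norm_mul, Complex.norm_exp_ofReal_mul_I, one_mul]

theorem mdifferentiable_disc_map (f : unitDisc → unitDisc) (g : ℂ → ℂ)
    (hg : ∀ z : unitDisc, DifferentiableAt ℂ g z) (hfg : ∀ z : unitDisc, (f z : ℂ) = g z) :
    MDifferentiable 𝓘(ℂ, ℂ) 𝓘(ℂ, ℂ) f := by
  intro z
  have h1 : MDifferentiableAt 𝓘(ℂ, ℂ) 𝓘(ℂ, ℂ) (fun z : unitDisc => g z) z := by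
    exact ((differentiableWithinAt_localInvariantProp (I := 𝓘(ℂ, ℂ))
      (I' := 𝓘(ℂ, ℂ))).liftPropAt_iff_comp_subtype_val g z).1
      (hg z).mdifferentiableAt
  have h2 : (fun z : unitDisc => g z) = Subtype.val ∘ f := funext fun z => (hfg z).symm
  rw [h2] at h1
  rw [← mdifferentiableWithinAt_univ] at h1 ⊢
  exact (ChartedSpace.liftPropWithinAt_subtypeVal_comp_iff ..).1 h1

theorem differentiableAt_moebiusFun (r : ℝ) {α z : ℂ} (hα : ‖α‖ < 1) (hz : ‖z‖ < 1) :
    DifferentiableAt ℂ (moebiusFun r α) z := by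
  unfold moebiusFun
  have := moebius_denom_ne hα hz
  fun_prop (disch := assumption)

/-- The automorphism `z ↦ e^{ir} (z - α) / (1 - ᾱ z)` of the unit disc, where `|α| < 1`. -/
def moebiusAut (r : ℝ) (α : ℂ) (hα : ‖α‖ < 1) : biholAut ℂ unitDisc where
  val :=
    { toFun := fun z => ⟨moebiusFun r α z, mem_unitDisc.2
        (norm_moebiusFun_lt r hα (mem_unitDisc.1 z.2))⟩
      invFun := fun z => ⟨moebiusFun (-r) (-(cexp (r * I) * α)) z, mem_unitDisc.2
        (norm_moebiusFun_lt (-r) (norm_moebius_param r hα) (mem_unitDisc.1 z.2))⟩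
      left_inv := fun z => Subtype.ext (moebiusFun_inv r hα (mem_unitDisc.1 z.2))
      right_inv := fun z => Subtype.ext (by
        have h := moebiusFun_inv (-r) (norm_moebius_param r hα) (mem_unitDisc.1 z.2)
        have he : cexp (-(r * I)) * cexp (r * I) = 1 := by rw [← Complex.exp_add]; simp
        have h2 : -(cexp (((-r : ℝ) : ℂ) * I) * -(cexp (r * I) * α)) = α := by
          rw [ofReal_neg, neg_mul, mul_neg, neg_neg, ← mul_assoc, he, one_mul]
        rwa [h2, neg_neg] at h) }
  property :=
    ⟨mdifferentiable_disc_map _ (moebiusFun r α)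
        (fun z => differentiableAt_moebiusFun r hα (mem_unitDisc.1 z.2)) fun _ => rfl,
      mdifferentiable_disc_map _ (moebiusFun (-r) (-(cexp (r * I) * α)))
        (fun z => differentiableAt_moebiusFun (-r) (norm_moebius_param r hα)
          (mem_unitDisc.1 z.2)) fun _ => rfl⟩

open Classical in
/-- The standard coordinates on the three-dimensional real Lie group `Aut 𝔻`: for `r ∈ ℝ` and
`|α| < 1`, `discAut r α` is the automorphism `z ↦ e^{ir} (z - α) / (1 - ᾱ z)`. The map
`(r, α) ↦ discAut r α` from `ℝ × 𝔻` to `Aut 𝔻` is a surjective local diffeomorphism and takes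
`(0, 0)` to the identity. (The value for `|α| ≥ 1` is irrelevant.) -/
def discAut (r : ℝ) (α : ℂ) : biholAut ℂ unitDisc :=
  if hα : ‖α‖ < 1 then moebiusAut r α hα else 1

/-! ### Royal manifolds -/

section Royal

variable (E : Type*) [NormedAddCommGroup E] [NormedSpace ℂ E]
  {Ω : Type*} [TopologicalSpace Ω] [ChartedSpace E Ω]

/-- `f : 𝔻 → Ω` is a proper analytic embedding. -/
structure IsProperEmbedding (f : unitDisc → Ω) : Prop where
  holomorphic : MDifferentiable 𝓘(ℂ, ℂ) 𝓘(ℂ, E) f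
  injective : Function.Injective f
  immersion : ∀ z, Function.Injective (mfderiv 𝓘(ℂ, ℂ) 𝓘(ℂ, E) f z)
  proper : IsProperMap f

/-- The set `D` is a properly embedded analytic disc in `Ω`, parametrized by `d`. -/
def IsDiscParam (d : unitDisc → Ω) (D : Set Ω) : Prop :=
  IsProperEmbedding E d ∧ range d = D

/-- `σ` is an automorphism of the properly embedded analytic disc `D`, regarded as a complex
manifold: in a parametrization of `D` it is an automorphism of the unit disc. -/
def IsAutOfDisc (D : Set Ω) (σ : D → D) : Prop :=
  ∃ d : unitDisc → Ω, IsDiscParam E d D ∧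
    ∃ m : biholAut ℂ unitDisc, ∀ (z : unitDisc) (x : D), (x : Ω) = d z → (σ x : Ω) = d (m.1 z)

/-- `D` is a royal disc in `Ω`, that is, `(Ω, D)` is a royal manifold. -/
structure IsRoyalDisc (D : Set Ω) : Prop where
  isDisc : ∃ d : unitDisc → Ω, IsDiscParam E d D
  invariant : ∀ θ : biholAut E Ω, θ.1 '' D = D
  determined : ∀ θ₁ θ₂ : biholAut E Ω, EqOn θ₁.1 θ₂.1 D → θ₁ = θ₂
  extends_aut : ∀ σ : D → D, IsAutOfDisc E D σ →
    ∃ θ : biholAut E Ω, ∀ x : D, θ.1 (x : Ω) = σ x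

/-- `(d, Θ)` is a concomitant pair for `(Ω, D)`. -/
def IsConcomitantPair (D : Set Ω) (d : unitDisc → Ω)
    (Θ : biholAut ℂ unitDisc ≃* biholAut E Ω) : Prop :=
  IsDiscParam E d D ∧ ∀ (m : biholAut ℂ unitDisc) (z : unitDisc), (Θ m).1 (d z) = d (m.1 z)

/-- The royal manifold `(Ω, D)` is regular. Condition (1) says that the action
`(m, x) ↦ Θ(m)(x)` of `Aut 𝔻` on `Ω` is differentiable, as a map of real manifolds; condition (3)
says that the derivative `e_x'(id)` of the orbit map `e_x(m) = Θ(m)(x)` at the identity, a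
real-linear map from the three-dimensional Lie algebra of `Aut 𝔻` to the tangent space `T_x Ω`, is
nonsingular, i.e. has real rank 3. Both are expressed in the coordinates `(r, α)` of `Aut 𝔻`. -/
def IsRegularRoyal (D : Set Ω) : Prop :=
  ∃ (d : unitDisc → Ω) (Θ : biholAut ℂ unitDisc ≃* biholAut E Ω), IsConcomitantPair E D d Θ ∧
    MDifferentiableOn (𝓘(ℝ, ℝ × ℂ).prod 𝓘(ℝ, E)) 𝓘(ℝ, E)
      (fun q : (ℝ × ℂ) × Ω => (Θ (discAut q.1.1 q.1.2)).1 q.2) {q | ‖q.1.2‖ < 1} ∧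
    (∀ x ∉ D, {θ : biholAut E Ω | θ.1 x = x}.Finite) ∧
    ∀ x ∉ D, Function.Injective (mfderiv 𝓘(ℝ, ℝ × ℂ) 𝓘(ℝ, E)
      (fun q : ℝ × ℂ => (Θ (discAut q.1 q.2)).1 x) (0, 0))

/-- The family `ℰ`, indexed by `D`, is a flat fibration of `Ω` over `D`. -/
structure IsFlatFibration (D : Set Ω) (ℰ : D → Set Ω) : Prop where
  isDisc : ∀ x : D, ∃ f : unitDisc → Ω, IsDiscParam E f (ℰ x)
  inter_eq : ∀ x : D, ℰ x ∩ D = {(x : Ω)}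
  disjoint : ∀ x y : D, x ≠ y → Disjoint (ℰ x) (ℰ y)
  cover : ⋃ x : D, ℰ x = univ
  equivariant : ∀ (θ : biholAut E Ω) (x y : D), θ.1 (x : Ω) = y → θ.1 '' ℰ x = ℰ y

/-- `(Ω, D, ℰ)` is synchronous: for a concomitant pair `(d, Θ)` and each point `d z₀` of `D`, some
parametrization `f` of the leaf over `d z₀` satisfies `f z₀ = d z₀` and `Θ(m) ∘ f = f ∘ m ∘ m` for
every automorphism `m` of the disc that fixes `z₀`. -/
def IsSynchronous (D : Set Ω) (ℰ : D → Set Ω) : Prop :=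
  ∃ (d : unitDisc → Ω) (Θ : biholAut ℂ unitDisc ≃* biholAut E Ω), IsConcomitantPair E D d Θ ∧
    ∀ (x : D) (z₀ : unitDisc), (x : Ω) = d z₀ →
      ∃ f : unitDisc → Ω, IsDiscParam E f (ℰ x) ∧ f z₀ = x ∧
        ∀ m : biholAut ℂ unitDisc, m.1 z₀ = z₀ →
          ∀ z : unitDisc, (Θ m).1 (f z) = f (m.1 (m.1 z))

/-- `p` is the Poincaré parameter `P(x)` of `x ∈ Ω`: the Poincaré distance from `x` to the point
where the leaf through `x` meets `D`, measured in that leaf. -/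
def IsPoincareParam (D : Set Ω) (ℰ : D → Set Ω) (x : Ω) (p : ℝ) : Prop :=
  ∃ (y : D) (f : unitDisc → Ω) (z₀ z : unitDisc), IsDiscParam E f (ℰ y) ∧ f z₀ = y ∧ f z = x ∧
    p = Real.artanh ‖((z : ℂ) - z₀) / (1 - conj (z₀ : ℂ) * z)‖

/-- Sharpness at `x` with respect to (the second member `Θ` of) a concomitant pair: in a chart `ψ`
at `x`, as `t → 0` in `ℝ`,
`e^{2P(x)} (ψ(Θ(B_{it})(x)) - ψ(x)) = i (ψ(Θ(B_t)(x)) - ψ(x)) + o(t)`,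
where `B_α(z) = (z - α) / (1 - ᾱ z)`. -/
def ActsSharplyAt (D : Set Ω) (ℰ : D → Set Ω) (Θ : biholAut ℂ unitDisc ≃* biholAut E Ω)
    (x : Ω) : Prop :=
  ∃ p : ℝ, IsPoincareParam E D ℰ x p ∧
    (fun t : ℝ =>
      ((Real.exp (2 * p) : ℝ) : ℂ) •
          (chartAt E x ((Θ (discAut 0 (I * t))).1 x) - chartAt E x x)
        - I • (chartAt E x ((Θ (discAut 0 t)).1 x) - chartAt E x x))
      =o[𝓝 0] (fun t : ℝ => t)

/-- `Aut Ω` acts sharply on `Ω`: at every point of `Ω \ D` it acts sharply with respect to some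
concomitant pair. (The pair has to be adapted to the point: for the symmetrized bidisc no single
pair serves all the points.) -/
def ActsSharply (D : Set Ω) (ℰ : D → Set Ω) : Prop :=
  ∀ x ∉ D, ∃ (d : unitDisc → Ω) (Θ : biholAut ℂ unitDisc ≃* biholAut E Ω),
    IsConcomitantPair E D d Θ ∧ ActsSharplyAt E D ℰ Θ x

end Royal

end

/-!
Write `B_α(z) = (z - α) / (1 - ᾱ z)`.

**From the symmetrized bidisc.** Every automorphism of `G` has the form
`(z + w, zw) ↦ (m z + m w, m z * m w)` for an automorphism `m` of the disc (`symAut`). The proof lifts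
an automorphism to the bidisc and lets one variable tend to the circle: the limits map the disc to the
boundary of `G`, hence satisfy a fixed equation `ξ² - ξ s + p = 0` with `|ξ| = 1`. Two polynomial
expressions in the coordinates therefore vanish on the boundary, and so everywhere by the maximum
principle, which splits the lift as `(ξ(z) + ξ(w), ξ(z) ξ(w))`. Hence `D = {(2z, z²)}` is a royal disc,
and the leaf `{(0, z)}` and its translates, indexed by the hyperbolic midpoints of `z` and `w`, form a
flat fibration. Differentiability, regularity and sharpness are computed from the explicit formula
`symFormula`.

**To the symmetrized bidisc.** Take the concomitant pair `(d, Θ)` of the regularity condition and a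
synchronous parametrization `f` of the leaf through `d 0` (`IsLeafModel`). The essential point is to
control the velocity `v_a(z)` of `f z` under the hyperbolic automorphisms `B_{ta}`.

* The maps `Θ(B_{ta})` displace the points near a given one by at most a constant times `t`
  (`IsLeafModel.displacement_le`): a holomorphic map close to the identity is so in the Lipschitz
  sense, and the powers of `B_{ta}` stay near the identity for about `1/t` steps. Hence `v_a(z)` is a
  limit of bounded holomorphic functions of `z`, and depends holomorphically on `z`
  (`IsLeafModel.differentiableAt_orbitDeriv`).
* A concomitant pair for which the action is sharp at `f z` is a conjugate of `(d, Θ)` by an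
  automorphism `e^{ir} B_β`. Comparing the sharpness relation with its image under the involution
  `Θ(z ↦ -z)`, which fixes `f z`, shows that `β = 0` and that `v_a(z) = (a + c(z) z ā) A(z)` with
  `|c(z)| = 1` and `A(z) ≠ 0` (`IsLeafModel.exists_velocity_of_actsSharply`).
* The function `c` is holomorphic of modulus one, hence constant, and a rotation of `f` makes it `1`
  (`IsLeafModel.exists_normalized`).

The map `Λ` that takes the translates of `{(0, z)}` in `G` to the corresponding translates of `f` is a
well-defined equivariant bijection (`equivariantMap`). Differentiability of the action makes it
real-differentiable on the leaf, and there the formula for `v_a(z)` says precisely that its derivative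
is complex-linear; the derivative is injective because `Θ(z ↦ -z)` acts on `A(z)` by `-1` and on
`f'(z)` by `1` (`IsLeafModel.exists_hasFDerivAt`). By equivariance `Λ` is holomorphic. It is onto, so
its derivatives are isomorphisms, since otherwise a nonempty open set would be the image of a null set
under a differentiable map (`surjective_of_isOpen_subset_image`); the inverse function theorem then
gives a holomorphic inverse.
-/

noncomputable section

/-! ### Differentiability on open submanifolds and in charts -/

section Opens

variable {𝕜 : Type*} [NontriviallyNormedField 𝕜]
  {V : Type*} [NormedAddCommGroup V] [NormedSpace 𝕜 V]
  {F : Type*} [NormedAddCommGroup F] [NormedSpace 𝕜 F]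
  {M : Type*} [TopologicalSpace M] [ChartedSpace F M]

theorem mdifferentiable_opens_val (U : TopologicalSpace.Opens V) :
    MDifferentiable 𝓘(𝕜, V) 𝓘(𝕜, V) (Subtype.val : U → V) :=
  (contMDiff_subtype_val (n := 1)).mdifferentiable one_ne_zero

theorem mdifferentiableAt_opens_iff {H : Type*} [TopologicalSpace H] {I : ModelWithCorners 𝕜 F H}
    {N : Type*} [TopologicalSpace N] [ChartedSpace H N] (U : TopologicalSpace.Opens V) (f : N → U)
    (x : N) :
    MDifferentiableAt I 𝓘(𝕜, V) (fun y => (f y : V)) x ↔ MDifferentiableAt I 𝓘(𝕜, V) f x := by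
  rw [← mdifferentiableWithinAt_univ, ← mdifferentiableWithinAt_univ]
  exact ChartedSpace.liftPropWithinAt_subtypeVal_comp_iff ..

open Classical in
/-- The retraction of a normed space onto an open subset that is the identity on the subset and
constant, with value `x₀`, off it. It extends maps on the open subset to the whole space. -/
def toOpens (U : TopologicalSpace.Opens V) (x₀ : U) (v : V) : U :=
  if h : v ∈ U then ⟨v, h⟩ else x₀

theorem toOpens_of_mem {U : TopologicalSpace.Opens V} {x₀ : U} {v : V} (h : v ∈ U) :
    toOpens U x₀ v = ⟨v, h⟩ := dif_pos h

@[simp] theorem toOpens_coe {U : TopologicalSpace.Opens V} {x₀ : U} (v : U) :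
    toOpens U x₀ v = v := dif_pos v.2

theorem coe_toOpens {U : TopologicalSpace.Opens V} {x₀ : U} {v : V} (h : v ∈ U) :
    (toOpens U x₀ v : V) = v := by rw [toOpens_of_mem h]

theorem mdifferentiableAt_toOpens {U : TopologicalSpace.Opens V} {x₀ : U} {v : V} (h : v ∈ U) :
    MDifferentiableAt 𝓘(𝕜, V) 𝓘(𝕜, V) (toOpens U x₀) v := by
  rw [← mdifferentiableAt_opens_iff]
  refine mdifferentiableAt_id.congr_of_eventuallyEq ?_
  filter_upwards [U.isOpen.mem_nhds h] with w hw using coe_toOpens hw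

/-- A map on an open submanifold is differentiable where its extension is. -/
theorem mdifferentiableAt_of_comp_toOpens {U : TopologicalSpace.Opens V} {x₀ : U} {f : U → M}
    {v : U} (h : MDifferentiableAt 𝓘(𝕜, V) 𝓘(𝕜, F) (fun w => f (toOpens U x₀ w)) (v : V)) :
    MDifferentiableAt 𝓘(𝕜, V) 𝓘(𝕜, F) f v := by
  have h2 := MDifferentiableAt.comp (g := fun w => f (toOpens U x₀ w)) (f := (Subtype.val : U → V))
    v h (mdifferentiable_opens_val U v)
  have h3 : (fun w => f (toOpens U x₀ w)) ∘ (Subtype.val : U → V) = f := by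
    ext w; simp
  rwa [h3] at h2

theorem MDifferentiableAt.comp_toOpens {U : TopologicalSpace.Opens V} {x₀ : U} {f : U → M}
    {v : V} (hv : v ∈ U) (h : MDifferentiableAt 𝓘(𝕜, V) 𝓘(𝕜, F) f ⟨v, hv⟩) :
    MDifferentiableAt 𝓘(𝕜, V) 𝓘(𝕜, F) (fun w => f (toOpens U x₀ w)) v := by
  refine MDifferentiableAt.comp (g := f) v ?_ (mdifferentiableAt_toOpens hv)
  rwa [toOpens_of_mem hv]

theorem mfderiv_eq_fderiv_chart {f : V → M} {v : V}
    (h : MDifferentiableAt 𝓘(𝕜, V) 𝓘(𝕜, F) f v) :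
    mfderiv 𝓘(𝕜, V) 𝓘(𝕜, F) f v = fderiv 𝕜 (fun w => chartAt F (f v) (f w)) v := by
  refine h.mfderiv.trans ?_
  simp only [mfld_simps, fderivWithin_univ]
  rfl

/-- In the charts of an open submanifold and of the target, the derivative of a map is the
derivative of its extension. -/
theorem mfderiv_opens_eq_fderiv {U : TopologicalSpace.Opens V} {x₀ : U} {f : U → M} {v : U}
    (h : MDifferentiableAt 𝓘(𝕜, V) 𝓘(𝕜, F) f v) :
    mfderiv 𝓘(𝕜, V) 𝓘(𝕜, F) f v
      = fderiv 𝕜 (fun w => chartAt F (f v) (f (toOpens U x₀ w))) (v : V) := by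
  refine h.mfderiv.trans ?_
  simp only [mfld_simps, fderivWithin_univ]
  refine Filter.EventuallyEq.fderiv_eq ?_
  have h1 := U.chartAt_subtype_val_symm_eventuallyEq (H := V) (x := v)
  filter_upwards [h1] with w hw
  have h2 : toOpens U x₀ w = (chartAt V v).symm w := by
    have : (w : V) = ((chartAt V v).symm w : U) := hw
    conv_lhs => rw [this]
    exact toOpens_coe _
  simp only [mfld_simps, h2]

theorem MDifferentiableAt.differentiableAt_chart [IsManifold 𝓘(𝕜, F) 1 M] {f : V → M} {v : V} {x : M}
    (h : MDifferentiableAt 𝓘(𝕜, V) 𝓘(𝕜, F) f v) (hx : f v ∈ (chartAt F x).source) :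
    DifferentiableAt 𝕜 (fun w => chartAt F x (f w)) v := by
  rw [← mdifferentiableAt_iff_differentiableAt]
  exact MDifferentiableAt.comp (g := chartAt F x) v (mdifferentiableAt_atlas (chart_mem_atlas F x) hx) h

theorem mdifferentiableAt_of_chart [IsManifold 𝓘(𝕜, F) 1 M] {f : V → M} {v : V} {x : M}
    (hc : ContinuousAt f v) (hx : f v ∈ (chartAt F x).source)
    (h : DifferentiableAt 𝕜 (fun w => chartAt F x (f w)) v) :
    MDifferentiableAt 𝓘(𝕜, V) 𝓘(𝕜, F) f v := by
  rw [← mdifferentiableAt_iff_differentiableAt] at h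
  have h1 := MDifferentiableAt.comp (g := (chartAt F x).symm) v
    (mdifferentiableAt_atlas_symm (chart_mem_atlas F x) ((chartAt F x).map_source hx)) h
  refine h1.congr_of_eventuallyEq ?_
  filter_upwards [hc.preimage_mem_nhds ((chartAt F x).open_source.mem_nhds hx)] with w hw
  exact ((chartAt F x).left_inv hw).symm

end Opens

section Real

variable {E : Type*} [NormedAddCommGroup E] [NormedSpace ℂ E]
  {M : Type*} [TopologicalSpace M] [ChartedSpace E M]
  {F : Type*} [NormedAddCommGroup F] [NormedSpace ℂ F]
  {N : Type*} [TopologicalSpace N] [ChartedSpace F N]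

theorem MDifferentiableAt.real_of_complex {f : M → N} {x : M}
    (h : MDifferentiableAt 𝓘(ℂ, E) 𝓘(ℂ, F) f x) : MDifferentiableAt 𝓘(ℝ, E) 𝓘(ℝ, F) f x := by
  rw [mdifferentiableAt_iff] at h ⊢
  refine ⟨h.1, ?_⟩
  have := h.2
  simp only [mfld_simps] at this ⊢
  exact this.restrictScalars ℝ

theorem isManifold_real_of_complex [IsManifold 𝓘(ℂ, E) ω M] : IsManifold 𝓘(ℝ, E) 1 M := by
  refine isManifold_of_contDiffOn _ _ _ fun e e' he he' => ?_
  have h :=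
    (HasGroupoid.compatible (G := contDiffGroupoid ω 𝓘(ℂ, E)) he he')
  rw [contDiffGroupoid, mem_groupoid_of_pregroupoid] at h
  replace h := h.1
  simp only [contDiffPregroupoid] at h
  simp only [mfld_simps] at h ⊢
  exact (h.of_le le_top).restrict_scalars ℝ

end Real

/-! ### Bounded holomorphic functions -/

section Holomorphic

variable {E : Type*} [NormedAddCommGroup E] [NormedSpace ℂ E]
  {F : Type*} [NormedAddCommGroup F] [NormedSpace ℂ F]

/-- A holomorphic function that is bounded by `C` on a ball is Lipschitz on the concentric ball of
half the radius. -/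
theorem lipschitzOnWith_half_ball {f : E → F} {c : E} {R C : ℝ} (hR : 0 < R)
    (hf : DifferentiableOn ℂ f (Metric.ball c R)) (hC : ∀ x ∈ Metric.ball c R, ‖f x‖ ≤ C)
    {x y : E} (hx : x ∈ Metric.ball c (R / 2)) (hy : y ∈ Metric.ball c (R / 2)) :
    ‖f y - f x‖ ≤ 8 * C / R * ‖y - x‖ := by
  have hC0 : 0 ≤ C := (norm_nonneg _).trans (hC c (Metric.mem_ball_self hR))
  have hsub : Metric.ball x (R / 2) ⊆ Metric.ball c R := by
    intro w hw
    rw [Metric.mem_ball] at *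
    linarith [dist_triangle w x c]
  have hxR : x ∈ Metric.ball c R := hsub (Metric.mem_ball_self (by positivity))
  have hyR : y ∈ Metric.ball c R := Metric.ball_subset_ball (by linarith) hy
  have hb : ∀ w ∈ Metric.ball c R, ‖f w - f x‖ ≤ 2 * C := fun w hw => by
    linarith [norm_sub_le (f w) (f x), hC w hw, hC x hxR]
  by_cases hxy : ‖y - x‖ < R / 2
  · have := Complex.dist_le_div_mul_dist_of_mapsTo_ball (hf.mono hsub) (R₂ := 2 * C)
      (fun w hw => by
        rw [Metric.mem_closedBall, dist_eq_norm]; exact hb w (hsub hw))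
      (show y ∈ Metric.ball x (R / 2) by rwa [Metric.mem_ball, dist_eq_norm])
    rw [dist_eq_norm, dist_eq_norm] at this
    refine this.trans (mul_le_mul_of_nonneg_right ?_ (norm_nonneg _))
    rw [div_div_eq_mul_div]
    exact div_le_div_of_nonneg_right (by linarith) hR.le
  · rw [not_lt] at hxy
    refine (hb y hyR).trans ?_
    rw [div_mul_eq_mul_div, le_div_iff₀ hR]
    nlinarith

/-- A holomorphic function is strictly differentiable. -/
theorem hasStrictFDerivAt_of_eventually_differentiableAt {f : E → F} {x : E}
    (hf : ∀ᶠ y in 𝓝 x, DifferentiableAt ℂ f y) : HasStrictFDerivAt f (fderiv ℂ f x) x := by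
  set L := fderiv ℂ f x
  have hL : HasFDerivAt f L x := hf.self_of_nhds.hasFDerivAt
  rw [hasStrictFDerivAt_iff_isLittleO, Asymptotics.isLittleO_iff]
  intro ε hε
  obtain ⟨δ, hδ, hδf⟩ := Metric.eventually_nhds_iff_ball.1 hf
  obtain ⟨δ', hδ', hb⟩ := Metric.eventually_nhds_iff_ball.1
    ((hasFDerivAt_iff_isLittleO.1 hL).def (show 0 < ε / 8 by positivity))
  set R := min δ δ' with hRdef
  have hR : 0 < R := lt_min hδ hδ'
  have hdiff : DifferentiableOn ℂ (fun y => f y - f x - L (y - x)) (Metric.ball x R) := by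
    intro y hy
    have := hδf y (Metric.ball_subset_ball (min_le_left _ _) hy)
    exact DifferentiableAt.differentiableWithinAt (by fun_prop)
  have hbd : ∀ y ∈ Metric.ball x R, ‖f y - f x - L (y - x)‖ ≤ ε / 8 * R := by
    intro y hy
    refine (hb y (Metric.ball_subset_ball (min_le_right _ _) hy)).trans ?_
    rw [Metric.mem_ball, dist_eq_norm] at hy
    gcongr
  have h2 : Metric.ball x (R / 2) ×ˢ Metric.ball x (R / 2) ∈ 𝓝 (x, x) :=
    prod_mem_nhds (Metric.ball_mem_nhds _ (by positivity)) (Metric.ball_mem_nhds _ (by positivity))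
  filter_upwards [h2] with p hp
  have := lipschitzOnWith_half_ball hR hdiff hbd hp.2 hp.1
  have e : f p.1 - f x - L (p.1 - x) - (f p.2 - f x - L (p.2 - x)) = f p.1 - f p.2 - L (p.1 - p.2) := by
    simp only [map_sub]; abel
  rw [e] at this
  refine this.trans (le_of_eq ?_)
  field_simp

/-- A pointwise limit of uniformly bounded holomorphic functions is holomorphic. -/
theorem differentiableOn_of_tendsto_of_norm_le [CompleteSpace F] {ι : Type*} {l : Filter ι} [l.NeBot]
    {u : ι → ℂ → F} {v : ℂ → F} {U : Set ℂ} (hU : IsOpen U) {C : ℝ}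
    (hd : ∀ᶠ i in l, DifferentiableOn ℂ (u i) U) (hC : ∀ᶠ i in l, ∀ z ∈ U, ‖u i z‖ ≤ C)
    (hlim : ∀ z ∈ U, Tendsto (fun i => u i z) l (𝓝 (v z))) : DifferentiableOn ℂ v U := by
  refine TendstoLocallyUniformlyOn.differentiableOn (F := u) (φ := l) ?_ hd hU
  rw [Metric.tendstoLocallyUniformlyOn_iff]
  intro ε hε z hz
  obtain ⟨R, hR, hRU⟩ := Metric.isOpen_iff.1 hU z hz
  have hC0 : 0 ≤ C := by
    obtain ⟨i, hi⟩ := hC.exists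
    exact (norm_nonneg _).trans (hi z hz)
  set r := min (R / 2) (ε / (4 * (8 * C / R + 1))) with hr
  have hr0 : 0 < r := lt_min (by positivity) (by positivity)
  have hsm : 8 * C / R * r ≤ ε / 4 := by
    have h0 : (0:ℝ) ≤ 8 * C / R := by positivity
    calc 8 * C / R * r ≤ (8 * C / R + 1) * (ε / (4 * (8 * C / R + 1))) :=
          mul_le_mul (by linarith) (min_le_right _ _) hr0.le (by linarith)
      _ = ε / 4 := by field_simp
  have hz2 : z ∈ Metric.ball z (R / 2) := Metric.mem_ball_self (by positivity)
  have hlip : ∀ w ∈ Metric.ball z r, ∀ᶠ i in l, ‖u i w - u i z‖ ≤ ε / 4 := by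
    intro w hw
    filter_upwards [hd, hC] with i hi hi2
    have hw2 : w ∈ Metric.ball z (R / 2) := Metric.ball_subset_ball (min_le_left _ _) hw
    refine (lipschitzOnWith_half_ball hR (hi.mono hRU) (fun x hx => hi2 x (hRU hx)) hz2 hw2).trans ?_
    rw [Metric.mem_ball, dist_eq_norm] at hw
    exact (mul_le_mul_of_nonneg_left hw.le (by positivity)).trans hsm
  have hlim2 : ∀ w ∈ Metric.ball z r, ‖v w - v z‖ ≤ ε / 4 := by
    intro w hw
    have hwU : w ∈ U := hRU (Metric.ball_subset_ball ((min_le_left _ _).trans (by linarith)) hw)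
    exact le_of_tendsto ((hlim w hwU).sub (hlim z hz)).norm (hlip w hw)
  refine ⟨Metric.ball z r, mem_nhdsWithin_of_mem_nhds (Metric.ball_mem_nhds _ hr0), ?_⟩
  have h1 : ∀ᶠ i in l, ‖v z - u i z‖ < ε / 4 := by
    have := (tendsto_const_nhds.sub (hlim z hz) : Tendsto (fun i => v z - u i z) l _).norm
    rw [sub_self, norm_zero] at this
    exact this.eventually_lt_const (by positivity)
  filter_upwards [hd, hC, h1] with i hi hi2 hi3 w hw
  have hw2 : w ∈ Metric.ball z (R / 2) := Metric.ball_subset_ball (min_le_left _ _) hw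
  have h4 := lipschitzOnWith_half_ball hR (hi.mono hRU) (fun x hx => hi2 x (hRU hx)) hz2 hw2
  have h5 : 8 * C / R * ‖w - z‖ ≤ ε / 4 := by
    rw [Metric.mem_ball, dist_eq_norm] at hw
    exact (mul_le_mul_of_nonneg_left hw.le (by positivity)).trans hsm
  rw [dist_eq_norm]
  have e : v w - u i w = (v w - v z) + (v z - u i z) - (u i w - u i z) := by abel
  rw [e]
  calc _ ≤ ‖v w - v z‖ + ‖v z - u i z‖ + ‖u i w - u i z‖ :=
        (norm_sub_le _ _).trans (add_le_add_left (norm_add_le _ _) _)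
    _ < ε := by linarith [hlim2 w hw]

/-- A holomorphic function on the disc that tends to `0` at the boundary vanishes. -/
theorem eq_zero_of_tendsto_zero_boundary {u : ℂ → ℂ} (hu : DifferentiableOn ℂ u (Metric.ball 0 1))
    (hb : ∀ ε > 0, ∃ r < 1, ∀ z : ℂ, r < ‖z‖ → ‖z‖ < 1 → ‖u z‖ ≤ ε) {z : ℂ} (hz : ‖z‖ < 1) :
    u z = 0 := by
  rw [← norm_le_zero_iff]
  refine le_of_forall_pos_le_add fun ε hε => ?_
  rw [zero_add]
  obtain ⟨r, hr, h⟩ := hb ε hε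
  obtain ⟨ρ, hρ1, hρ2⟩ := exists_between (max_lt hr (max_lt hz zero_lt_one))
  have hρ0 : 0 < ρ := (le_max_right _ _).trans_lt ((le_max_right _ _).trans_lt hρ1)
  have hzρ : ‖z‖ < ρ := (le_max_left _ _).trans_lt ((le_max_right _ _).trans_lt hρ1)
  have hrρ : r < ρ := (le_max_left _ _).trans_lt hρ1
  refine Complex.norm_le_of_forall_mem_frontier_norm_le (U := Metric.ball (0:ℂ) ρ)
    Metric.isBounded_ball ?_ ?_ (subset_closure (mem_ball_zero_iff.2 hzρ))
  · refine (hu.mono ?_).diffContOnCl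
    rw [closure_ball _ hρ0.ne']
    exact Metric.closedBall_subset_ball hρ2
  · intro w hw
    rw [frontier_ball _ hρ0.ne', mem_sphere_zero_iff_norm] at hw
    exact h w (by rw [hw]; exact hrρ) (by rw [hw]; exact hρ2)

end Holomorphic

/-! ### Automorphisms of the disc -/

/-- The centre of the disc. -/
def discZero : unitDisc := ⟨0, mem_unitDisc.2 (by simp)⟩

@[simp] theorem coe_discZero : (discZero : ℂ) = 0 := rfl

theorem norm_coe_lt_one (z : unitDisc) : ‖(z : ℂ)‖ < 1 := mem_unitDisc.1 z.2

theorem eq_discZero_iff {z : unitDisc} : z = discZero ↔ (z : ℂ) = 0 := by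
  rw [Subtype.ext_iff]; rfl

/-- The extension to `ℂ` of a map defined on the disc. -/
abbrev discExt {X : Type*} (f : unitDisc → X) (z : ℂ) : X := f (toOpens unitDisc discZero z)

theorem discExt_of_lt {X : Type*} (f : unitDisc → X) {z : ℂ} (hz : ‖z‖ < 1) :
    discExt f z = f ⟨z, mem_unitDisc.2 hz⟩ := by
  rw [discExt, toOpens_of_mem (mem_unitDisc.2 hz)]

theorem discExt_coe {X : Type*} (f : unitDisc → X) (z : unitDisc) : discExt f z = f z := by
  rw [discExt, toOpens_coe]

theorem isOpen_norm_lt_one : IsOpen {z : ℂ | ‖z‖ < 1} := isOpen_lt continuous_norm continuous_const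

theorem discAut_ext {m n : biholAut ℂ unitDisc} (h : ∀ z : unitDisc, (m.1 z : ℂ) = n.1 z) : m = n :=
  Subtype.ext (Equiv.ext fun z => Subtype.ext (h z))

theorem coe_discAut {r : ℝ} {α : ℂ} (hα : ‖α‖ < 1) (z : unitDisc) :
    ((discAut r α).1 z : ℂ) = cexp (r * I) * ((z - α) / (1 - conj α * z)) := by
  rw [discAut, dif_pos hα]; rfl

theorem coe_discAut_zero_right (r : ℝ) (z : unitDisc) :
    ((discAut r 0).1 z : ℂ) = cexp (r * I) * z := by
  rw [coe_discAut (by simp)]; simp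

@[simp] theorem discAut_zero_zero : discAut 0 0 = 1 :=
  discAut_ext fun z => by rw [coe_discAut_zero_right]; simp

theorem discAut_eq_mul (r : ℝ) {α : ℂ} (hα : ‖α‖ < 1) :
    discAut r α = discAut r 0 * discAut 0 α := by
  refine discAut_ext fun z => ?_
  change _ = ((discAut r 0).1 ((discAut 0 α).1 z) : ℂ)
  rw [coe_discAut_zero_right, coe_discAut hα, coe_discAut hα]
  simp

theorem inv_discAut_zero {α : ℂ} (hα : ‖α‖ < 1) : (discAut 0 α)⁻¹ = discAut 0 (-α) := by
  rw [inv_eq_iff_mul_eq_one]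
  refine discAut_ext fun z => ?_
  change ((discAut 0 α).1 ((discAut 0 (-α)).1 z) : ℂ) = z
  have hz := norm_coe_lt_one z
  have h1 := moebius_denom_ne hα hα
  have h2 := moebius_denom_ne (α := -α) (by simpa) hz
  rw [coe_discAut hα, coe_discAut (by simpa)]
  simp only [map_neg, neg_mul, sub_neg_eq_add, ofReal_zero, zero_mul, Complex.exp_zero, one_mul] at *
  have h3 : 1 - conj α * ((z + α) / (1 + conj α * z)) = (1 - conj α * α) / (1 + conj α * z) := by
    rw [eq_div_iff h2, sub_mul, mul_assoc, div_mul_cancel₀ _ h2]; ring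
  have h4 : (z + α) / (1 + conj α * z) - α = z * (1 - conj α * α) / (1 + conj α * z) := by
    rw [eq_div_iff h2, sub_mul, div_mul_cancel₀ _ h2]; ring
  rw [h3, h4, div_div_div_cancel_right₀ h2, mul_div_assoc, div_self h1, mul_one]

@[simp] theorem discAut_zero_self (z : unitDisc) : (discAut 0 z).1 z = discZero := by
  rw [eq_discZero_iff, coe_discAut (norm_coe_lt_one z)]; simp

theorem discAut_neg_apply_discZero (z : unitDisc) : (discAut 0 (-z)).1 discZero = z := by
  refine Subtype.ext ?_
  rw [coe_discAut (by simpa using norm_coe_lt_one z)]; simp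

theorem differentiableAt_disc_map {f : unitDisc → unitDisc}
    (hf : MDifferentiable 𝓘(ℂ, ℂ) 𝓘(ℂ, ℂ) f) {z : ℂ} (hz : ‖z‖ < 1) :
    DifferentiableAt ℂ (fun z => ((discExt f z : unitDisc) : ℂ)) z := by
  rw [← mdifferentiableAt_iff_differentiableAt]
  exact (mdifferentiableAt_opens_iff unitDisc _ _).2
    (MDifferentiableAt.comp_toOpens (mem_unitDisc.2 hz) (hf _))

/-- An automorphism of the disc that fixes the centre is a rotation. -/
theorem exists_eq_discAut_zero_right {m : biholAut ℂ unitDisc} (hm : m.1 discZero = discZero) :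
    ∃ r : ℝ, m = discAut r 0 := by
  have key : ∀ n : biholAut ℂ unitDisc, n.1 discZero = discZero → ∀ z : unitDisc,
      ‖(n.1 z : ℂ)‖ ≤ ‖(z : ℂ)‖ := by
    intro n hn z
    have := Complex.norm_le_norm_of_mapsTo_ball (R := 1) (f := fun z => ((discExt n.1 z : unitDisc) : ℂ))
      (fun w hw => (differentiableAt_disc_map n.2.1 (mem_ball_zero_iff.1 hw)).differentiableWithinAt)
      (fun w _ => mem_closedBall_zero_iff.2 (norm_coe_lt_one _).le)
      (by rw [← coe_discZero, discExt_coe, hn]) (norm_coe_lt_one z)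
    simpa only [discExt, toOpens_coe] using this
  have hinv : m⁻¹.1 discZero = discZero := by
    change m.1.symm discZero = discZero
    rw [Equiv.symm_apply_eq, hm]
  have heq : ∀ z : unitDisc, ‖(m.1 z : ℂ)‖ = ‖(z : ℂ)‖ := fun z =>
    le_antisymm (key m hm z) (by
      have := key m⁻¹ hinv (m.1 z)
      rwa [show m⁻¹.1 (m.1 z) = z from m.1.symm_apply_apply z] at this)
  set h : ℂ → ℂ := fun z => ((discExt m.1 z : unitDisc) : ℂ) with hdef
  have h0 : h 0 = 0 := by simp only [hdef]; rw [← coe_discZero, discExt_coe, hm]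
  have hhalf : ‖(1 / 2 : ℂ)‖ < 1 := by norm_num
  have hs : ‖dslope h 0 (1 / 2)‖ = 1 := by
    rw [dslope_of_ne _ (by norm_num), slope_def_field, h0, sub_zero, sub_zero, norm_div]
    have := heq ⟨1 / 2, mem_unitDisc.2 hhalf⟩
    simp only [hdef, discExt_of_lt m.1 hhalf, this]
    norm_num
  have haff := Complex.affine_of_mapsTo_ball_of_norm_dslope_eq_div (f := h) (c := 0) (R₁ := 1)
    (R₂ := 1) (z₀ := 1 / 2)
    (fun w hw => (differentiableAt_disc_map m.2.1 (mem_ball_zero_iff.1 hw)).differentiableWithinAt)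
    (fun w _ => by rw [h0]; exact mem_closedBall_zero_iff.2 (norm_coe_lt_one _).le)
    (mem_ball_zero_iff.2 hhalf) (by rw [hs, div_one])
  refine ⟨arg (dslope h 0 (1 / 2)), discAut_ext fun z => ?_⟩
  have h1 := haff (mem_ball_zero_iff.2 (norm_coe_lt_one z))
  change ((discExt m.1 z : unitDisc) : ℂ) = h 0 + ((z : ℂ) - 0) • _ at h1
  rw [h0, discExt_coe, zero_add, sub_zero] at h1
  rw [coe_discAut_zero_right, h1]
  have h2 := Complex.norm_mul_exp_arg_mul_I (dslope h 0 (1 / 2))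
  rw [hs, ofReal_one, one_mul] at h2
  rw [h2, smul_eq_mul, mul_comm]

theorem exists_eq_discAut (m : biholAut ℂ unitDisc) : ∃ (r : ℝ) (α : ℂ), ‖α‖ < 1 ∧ m = discAut r α := by
  set α := m⁻¹.1 discZero
  have hα := norm_coe_lt_one α
  obtain ⟨r, hr⟩ := exists_eq_discAut_zero_right (m := m * (discAut 0 α)⁻¹) (by
    rw [inv_discAut_zero hα]
    change m.1 ((discAut 0 (-α)).1 discZero) = discZero
    rw [discAut_neg_apply_discZero]
    exact m.1.apply_symm_apply _)
  exact ⟨r, α, hα, by rw [discAut_eq_mul r hα, ← hr, inv_mul_cancel_right]⟩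

theorem norm_add_div_one_add_lt {s t : ℝ} (hs : |s| < 1) (ht : |t| < 1) :
    |(s + t) / (1 + s * t)| < 1 := by
  rw [abs_lt] at *
  have h0 : 0 < 1 + s * t := by nlinarith [hs.1, hs.2, ht.1, ht.2]
  constructor
  · rw [lt_div_iff₀ h0]; nlinarith [hs.1, hs.2, ht.1, ht.2]
  · rw [div_lt_one h0]; nlinarith [hs.1, hs.2, ht.1, ht.2]

/-- The addition theorem in the one-parameter group of hyperbolic automorphisms with axis in the
direction `a`. -/
theorem discAut_mul_discAut_same_direction {a : ℂ} (ha : ‖a‖ = 1) {s t : ℝ} (hs : |s| < 1)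
    (ht : |t| < 1) :
    discAut 0 (s * a) * discAut 0 (t * a) = discAut 0 (((s + t) / (1 + s * t) : ℝ) * a) := by
  have hn : ∀ {x : ℝ}, |x| < 1 → ‖(x * a : ℂ)‖ < 1 := fun hx => by
    rwa [norm_mul, ha, mul_one, norm_real, Real.norm_eq_abs]
  have haa : conj a * a = 1 := by rw [conj_mul', ha]; simp
  have h0 : (1 + s * t : ℂ) ≠ 0 := by
    have : 1 + s * t ≠ 0 := by rw [abs_lt] at *; nlinarith [hs.1, hs.2, ht.1, ht.2]
    exact_mod_cast this
  refine discAut_ext fun z => ?_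
  change ((discAut 0 (s * a)).1 ((discAut 0 (t * a)).1 z) : ℂ) = _
  have hz := norm_coe_lt_one z
  have h1 := moebius_denom_ne (hn ht) hz
  have h2 := moebius_denom_ne (hn hs) (norm_coe_lt_one ((discAut 0 (t * a)).1 z))
  have h3 := moebius_denom_ne (hn (norm_add_div_one_add_lt hs ht)) hz
  rw [coe_discAut (hn ht)] at h2
  rw [coe_discAut (hn hs), coe_discAut (hn ht), coe_discAut (hn (norm_add_div_one_add_lt hs ht))]
  simp only [ofReal_zero, zero_mul, Complex.exp_zero, one_mul, map_mul, conj_ofReal] at *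
  push_cast at *
  rw [div_eq_div_iff h2 h3]
  have hq := div_mul_cancel₀ ((z : ℂ) - t * a) h1
  have hc := div_mul_cancel₀ (s + t : ℂ) h0
  generalize (((z : ℂ) - t * a) / (1 - t * conj a * z) : ℂ) = q at *
  generalize ((s + t) / (1 + s * t) : ℂ) = c at *
  refine mul_right_cancel₀ (mul_ne_zero h0 h1) ?_
  linear_combination ((1 + s * t - (s + t) * conj a * z) + (z * (1 + s * t) - (s + t) * a) * s * conj a) * hq
    + (-(q - s * a) * conj a * z + a * (1 - s * conj a * q)) * (1 - t * conj a * z) * hc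
    + (s * t * z * (1 + s * t - (s + t) * conj a * z) - s * t * (z * (1 + s * t) - (s + t) * a)) * haa

/-! ### The action of the automorphisms of the disc on the symmetrized bidisc -/

/-- The point `(z + w, zw)` of the symmetrized bidisc. -/
def symPt (z w : unitDisc) : symBidisc :=
  ⟨(z + w, z * w), z, w, norm_coe_lt_one z, norm_coe_lt_one w, rfl⟩

theorem coe_symPt (z w : unitDisc) : (symPt z w : ℂ × ℂ) = ((z : ℂ) + w, (z : ℂ) * w) := rfl

theorem exists_symPt (x : symBidisc) : ∃ z w, x = symPt z w := by
  obtain ⟨z, w, hz, hw, h⟩ := x.2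
  exact ⟨⟨z, mem_unitDisc.2 hz⟩, ⟨w, mem_unitDisc.2 hw⟩, Subtype.ext h⟩

theorem symPt_eq_symPt {z w z' w' : unitDisc} :
    symPt z w = symPt z' w' ↔ z = z' ∧ w = w' ∨ z = w' ∧ w = z' := by
  constructor
  · intro h
    rw [Subtype.ext_iff, coe_symPt, coe_symPt, Prod.mk.injEq] at h
    obtain ⟨h1, h2⟩ := h
    have h3 : ((z : ℂ) - z') * (z - w') = 0 := by linear_combination z * h1 - h2
    simp only [Subtype.ext_iff]
    rcases mul_eq_zero.1 h3 with h | h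
    · left
      rw [sub_eq_zero] at h
      exact ⟨h, by rw [h] at h1; exact add_left_cancel h1⟩
    · right
      rw [sub_eq_zero] at h
      exact ⟨h, by rw [h, add_comm (z' : ℂ)] at h1; exact add_left_cancel h1⟩
  · rintro (⟨rfl, rfl⟩ | ⟨rfl, rfl⟩)
    · rfl
    · exact Subtype.ext (by rw [coe_symPt, coe_symPt, add_comm, mul_comm])

theorem symPt_comm (z w : unitDisc) : symPt z w = symPt w z := symPt_eq_symPt.2 (Or.inr ⟨rfl, rfl⟩)

/-- The royal parametrization `z ↦ (2z, z²)`. -/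
def royalMap (z : unitDisc) : symBidisc := symPt z z

/-- The flat leaf `z ↦ (0, z)` through the origin. -/
def leafMap (z : unitDisc) : symBidisc :=
  ⟨(0, z), by
    obtain ⟨w, hw⟩ := IsAlgClosed.exists_pow_nat_eq (-(z : ℂ)) (n := 2) (by norm_num)
    have h : ‖w‖ < 1 := by
      have := norm_coe_lt_one z
      rw [← norm_neg, ← hw, norm_pow] at this
      exact (sq_lt_one_iff₀ (norm_nonneg _)).1 this
    refine ⟨w, -w, h, by rwa [norm_neg], ?_⟩
    rw [add_neg_cancel, Prod.mk.injEq]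
    exact ⟨rfl, by linear_combination hw⟩⟩

theorem coe_leafMap (z : unitDisc) : (leafMap z : ℂ × ℂ) = (0, (z : ℂ)) := rfl

/-- The self-map of the symmetrized bidisc induced by a self-map `m` of the disc:
`(z + w, zw) ↦ (m z + m w, m z * m w)`. -/
def symMap (m : unitDisc → unitDisc) (x : symBidisc) : symBidisc :=
  symPt (m (exists_symPt x).choose) (m (exists_symPt x).choose_spec.choose)

@[simp] theorem symMap_symPt (m : unitDisc → unitDisc) (z w : unitDisc) :
    symMap m (symPt z w) = symPt (m z) (m w) := by
  have h := (exists_symPt (symPt z w)).choose_spec.choose_spec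
  rw [symMap]
  rcases symPt_eq_symPt.1 h with ⟨h1, h2⟩ | ⟨h1, h2⟩
  · exact congrArg₂ (fun a b => symPt (m a) (m b)) h1.symm h2.symm
  · rw [symPt_comm]
    exact congrArg₂ (fun a b => symPt (m a) (m b)) h1.symm h2.symm

/-- The coordinate expression of the map of the symmetrized bidisc induced by the automorphism
`z ↦ e^{ir} (z - α) / (1 - ᾱ z)` of the disc. -/
def symFormula (r : ℝ) (α : ℂ) (x : ℂ × ℂ) : ℂ × ℂ :=
  (cexp (r * I) * (((1 + conj α * α) * x.1 - 2 * conj α * x.2 - 2 * α)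
      / (1 - conj α * x.1 + conj α ^ 2 * x.2)),
    cexp (r * I) ^ 2 * ((x.2 - α * x.1 + α ^ 2) / (1 - conj α * x.1 + conj α ^ 2 * x.2)))

theorem symFormula_denom_ne {α : ℂ} (hα : ‖α‖ < 1) {x : ℂ × ℂ} (hx : x ∈ symBidisc) :
    1 - conj α * x.1 + conj α ^ 2 * x.2 ≠ 0 := by
  obtain ⟨z, w, hz, hw, rfl⟩ := hx
  have : 1 - conj α * (z + w) + conj α ^ 2 * (z * w) = (1 - conj α * z) * (1 - conj α * w) := by ring
  rw [this]
  exact mul_ne_zero (moebius_denom_ne hα hz) (moebius_denom_ne hα hw)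

theorem coe_symMap_discAut (r : ℝ) {α : ℂ} (hα : ‖α‖ < 1) (x : symBidisc) :
    (symMap (discAut r α).1 x : ℂ × ℂ) = symFormula r α x := by
  obtain ⟨z, w, rfl⟩ := exists_symPt x
  have h1 := moebius_denom_ne hα (norm_coe_lt_one z)
  have h2 := moebius_denom_ne hα (norm_coe_lt_one w)
  have h3 : 1 - conj α * ((z : ℂ) + w) + conj α ^ 2 * (z * w)
    = (1 - conj α * z) * (1 - conj α * w) := by ring
  rw [symMap_symPt, coe_symPt, coe_symPt, coe_discAut hα, coe_discAut hα, symFormula]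
  simp only
  rw [h3, Prod.mk.injEq]
  constructor
  · rw [← mul_add, div_add_div _ _ h1 h2]
    congr 2
    ring
  · rw [mul_mul_mul_comm, div_mul_div_comm, ← sq]
    congr 2
    ring

theorem mdifferentiable_symMap (m : biholAut ℂ unitDisc) :
    MDifferentiable 𝓘(ℂ, ℂ × ℂ) 𝓘(ℂ, ℂ × ℂ) (symMap m.1) := by
  obtain ⟨r, α, hα, rfl⟩ := exists_eq_discAut m
  intro x
  refine mdifferentiableAt_of_comp_toOpens (x₀ := x) ?_
  rw [← mdifferentiableAt_opens_iff]
  simp only [coe_symMap_discAut r hα]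
  rw [mdifferentiableAt_iff_differentiableAt]
  have hx := symFormula_denom_ne hα x.2
  have : DifferentiableAt ℂ (symFormula r α) x := by
    unfold symFormula
    fun_prop (disch := assumption)
  refine this.congr_of_eventuallyEq ?_
  filter_upwards [symBidisc.isOpen.mem_nhds x.2] with y hy using by rw [coe_toOpens hy]

/-- The automorphism of the symmetrized bidisc induced by an automorphism of the disc. -/
def symAutHom : biholAut ℂ unitDisc →* biholAut (ℂ × ℂ) symBidisc where
  toFun m :=
    ⟨{ toFun := symMap m.1
       invFun := symMap m⁻¹.1
       left_inv := fun x => by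
        obtain ⟨z, w, rfl⟩ := exists_symPt x
        rw [symMap_symPt, symMap_symPt]
        congr 1 <;> exact m.1.symm_apply_apply _
       right_inv := fun x => by
        obtain ⟨z, w, rfl⟩ := exists_symPt x
        rw [symMap_symPt, symMap_symPt]
        congr 1 <;> exact m.1.apply_symm_apply _ },
      mdifferentiable_symMap m, mdifferentiable_symMap m⁻¹⟩
  map_one' := Subtype.ext (Equiv.ext fun x => by
    obtain ⟨z, w, rfl⟩ := exists_symPt x
    exact symMap_symPt _ _ _)
  map_mul' m n := Subtype.ext (Equiv.ext fun x => by
    obtain ⟨z, w, rfl⟩ := exists_symPt x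
    change symMap _ _ = symMap _ (symMap _ _)
    rw [symMap_symPt, symMap_symPt, symMap_symPt]
    rfl)

theorem symAutHom_symPt (m : biholAut ℂ unitDisc) (z w : unitDisc) :
    (symAutHom m).1 (symPt z w) = symPt (m.1 z) (m.1 w) := symMap_symPt _ _ _

theorem symAutHom_royalMap (m : biholAut ℂ unitDisc) (z : unitDisc) :
    (symAutHom m).1 (royalMap z) = royalMap (m.1 z) := symMap_symPt _ _ _

theorem coe_symAutHom_discAut (r : ℝ) {α : ℂ} (hα : ‖α‖ < 1) (x : symBidisc) :
    ((symAutHom (discAut r α)).1 x : ℂ × ℂ) = symFormula r α x := coe_symMap_discAut r hα x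

theorem royalMap_injective : Function.Injective royalMap := fun z w h => by
  rcases symPt_eq_symPt.1 h with h | h <;> exact h.1

theorem symAutHom_injective : Function.Injective symAutHom := fun m n h => by
  refine Subtype.ext (Equiv.ext fun z => royalMap_injective ?_)
  rw [← symAutHom_royalMap, ← symAutHom_royalMap, h]

/-- An automorphism induced from the disc that moves a point of the leaf `{(0, z)}` within the leaf
fixes the centre of the disc: distinct leaves of the flat fibration are disjoint. -/
theorem fixes_discZero_of_leafMap {m : biholAut ℂ unitDisc} {z z' : unitDisc}
    (h : (symAutHom m).1 (leafMap z) = leafMap z') : m.1 discZero = discZero := by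
  obtain ⟨r, α, hα, rfl⟩ := exists_eq_discAut m
  have h1 := congrArg (fun x : symBidisc => (x : ℂ × ℂ).1) h
  simp only [coe_symAutHom_discAut r hα, symFormula, coe_leafMap] at h1
  have h2 := symFormula_denom_ne hα (leafMap z).2
  rw [coe_leafMap] at h2
  rw [mul_eq_zero, div_eq_zero_iff] at h1
  rcases h1 with h1 | h1 | h1
  · exact absurd h1 (Complex.exp_ne_zero _)
  · have h3 : α = -(conj α * z) := by linear_combination (-1 / 2) * h1
    have h4 : ‖α‖ = ‖α‖ * ‖(z : ℂ)‖ := by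
      conv_lhs => rw [h3]
      rw [norm_neg, norm_mul, RCLike.norm_conj]
    have h5 : α = 0 := by
      rw [← norm_eq_zero]
      nlinarith [norm_coe_lt_one z, norm_nonneg α]
    rw [h5, eq_discZero_iff, coe_discAut_zero_right, coe_discZero, mul_zero]
  · exact absurd h1 h2

theorem symAutHom_rotation_leafMap (r : ℝ) (z : unitDisc) :
    (symAutHom (discAut r 0)).1 (leafMap z) = leafMap ((discAut r 0).1 ((discAut r 0).1 z)) := by
  refine Subtype.ext ?_
  rw [coe_symAutHom_discAut r (by simp), coe_leafMap, coe_leafMap, coe_discAut_zero_right,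
    coe_discAut_zero_right, symFormula]
  simp [sq, mul_assoc]

/-! ### Midpoints -/

/-- For `(s, p)` in the symmetrized bidisc, the point `β` for which `(s, p)` lies on the leaf
`{(β + β̄ q, q)}`. -/
def leafParam (x : ℂ × ℂ) : ℂ := (x.1 - conj x.1 * x.2) / ((1 - ‖x.2‖ ^ 2 : ℝ) : ℂ)

/-- The hyperbolic midpoint of `z` and `w`, as a function of `(z + w, zw)`. -/
def midpt (x : ℂ × ℂ) : ℂ := leafParam x / ((1 + √(1 - ‖leafParam x‖ ^ 2) : ℝ) : ℂ)

theorem norm_snd_lt_one {x : ℂ × ℂ} (hx : x ∈ symBidisc) : ‖x.2‖ < 1 := by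
  obtain ⟨z, w, hz, hw, rfl⟩ := hx
  rw [norm_mul]
  nlinarith [norm_nonneg z, norm_nonneg w]

theorem norm_leafParam_lt_one {x : ℂ × ℂ} (hx : x ∈ symBidisc) : ‖leafParam x‖ < 1 := by
  have h1 := norm_snd_lt_one hx
  have h2 : 0 < 1 - ‖x.2‖ ^ 2 := by nlinarith [norm_nonneg x.2]
  have h3 : x ∈ symBidiscSet := hx
  rw [symBidiscSet_eq] at h3
  rw [leafParam, norm_div, norm_real, Real.norm_of_nonneg h2.le, div_lt_one h2]
  exact h3

theorem leafParam_add {x : ℂ × ℂ} (h1 : ‖x.2‖ < 1) :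
    leafParam x + conj (leafParam x) * x.2 = x.1 := by
  have h2 : ((1 - ‖x.2‖ ^ 2 : ℝ) : ℂ) ≠ 0 := by
    have : 0 < 1 - ‖x.2‖ ^ 2 := by nlinarith [norm_nonneg x.2]
    exact_mod_cast this.ne'
  rw [leafParam, map_div₀, conj_ofReal, div_mul_eq_mul_div, ← add_div, div_eq_iff h2]
  push_cast
  rw [← conj_mul']
  simp only [map_sub, map_mul, conj_conj]
  ring

theorem norm_midpt_lt_one {x : ℂ × ℂ} (hx : x ∈ symBidisc) : ‖midpt x‖ < 1 := by
  have h1 := norm_leafParam_lt_one hx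
  have h2 : 0 < √(1 - ‖leafParam x‖ ^ 2) := Real.sqrt_pos.2 (by nlinarith [norm_nonneg (leafParam x)])
  rw [midpt, norm_div, norm_real, Real.norm_of_nonneg (by positivity), div_lt_one (by positivity)]
  linarith

theorem leafParam_eq_midpt {x : ℂ × ℂ} (hx : x ∈ symBidisc) :
    leafParam x * (1 + conj (midpt x) * midpt x) = 2 * midpt x := by
  have h1 := norm_leafParam_lt_one hx
  set c := √(1 - ‖leafParam x‖ ^ 2) with hc
  have h2 : 0 < c := Real.sqrt_pos.2 (by nlinarith [norm_nonneg (leafParam x)])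
  have h3 : (c : ℂ) ^ 2 = 1 - (‖leafParam x‖ : ℂ) ^ 2 := by
    have : c ^ 2 = 1 - ‖leafParam x‖ ^ 2 := Real.sq_sqrt (by nlinarith [norm_nonneg (leafParam x)])
    exact_mod_cast this
  have h4 : (1 + c : ℂ) ≠ 0 := by
    have : 1 + c ≠ 0 := by positivity
    exact_mod_cast this
  rw [conj_mul', midpt, ← hc, norm_div, norm_real, Real.norm_of_nonneg (by positivity)]
  push_cast
  field_simp
  linear_combination leafParam x * h3

/-- The coordinate of a point of the symmetrized bidisc in its leaf. -/
def leafCoord (x : ℂ × ℂ) : ℂ := (symFormula 0 (midpt x) x).2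

/-- The automorphism that takes the midpoint to the centre takes the leaf through a point of the
symmetrized bidisc to the leaf `{(0, z)}`. -/
theorem symFormula_midpt {x : ℂ × ℂ} (hx : x ∈ symBidisc) :
    symFormula 0 (midpt x) x = (0, leafCoord x) := by
  refine Prod.ext ?_ rfl
  have h1 : (1 + conj (midpt x) * midpt x) * x.1 - 2 * conj (midpt x) * x.2 - 2 * midpt x = 0 := by
    have h2 := leafParam_eq_midpt hx
    have h3 := congrArg conj h2
    simp only [map_mul, map_add, map_one, conj_conj, map_ofNat] at h3
    linear_combination h2 + x.2 * h3 - (1 + conj (midpt x) * midpt x) * leafParam_add (norm_snd_lt_one hx)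
  simp only [symFormula]
  rw [h1]
  simp

theorem norm_leafCoord_lt_one {x : ℂ × ℂ} (hx : x ∈ symBidisc) : ‖leafCoord x‖ < 1 := by
  have h := coe_symAutHom_discAut 0 (norm_midpt_lt_one hx) ⟨x, hx⟩
  have := norm_snd_lt_one ((symAutHom (discAut 0 (midpt x))).1 ⟨x, hx⟩).2
  rw [h] at this
  exact this

theorem symAutHom_midpt (x : symBidisc) :
    (symAutHom (discAut 0 (midpt x))).1 x
      = leafMap ⟨leafCoord x, mem_unitDisc.2 (norm_leafCoord_lt_one x.2)⟩ :=
  Subtype.ext (by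
    rw [coe_symAutHom_discAut 0 (norm_midpt_lt_one x.2), symFormula_midpt x.2]; rfl)

/-- Every point of the symmetrized bidisc lies on the image of the leaf `{(0, z)}` under an
automorphism induced from the disc. -/
theorem eq_symAutHom_leafMap (x : symBidisc) :
    x = (symAutHom (discAut 0 (-midpt x))).1
      (leafMap ⟨leafCoord x, mem_unitDisc.2 (norm_leafCoord_lt_one x.2)⟩) := by
  rw [← symAutHom_midpt, ← inv_discAut_zero (norm_midpt_lt_one x.2), map_inv]
  exact (Equiv.symm_apply_apply _ x).symm

/-! ### The automorphism group of the symmetrized bidisc -/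

theorem norm_root_lt_one {x : ℂ × ℂ} (hx : x ∈ symBidisc) {ξ : ℂ} (h : ξ ^ 2 - ξ * x.1 + x.2 = 0) :
    ‖ξ‖ < 1 := by
  obtain ⟨z, w, hz, hw, rfl⟩ := hx
  have : (ξ - z) * (ξ - w) = 0 := by linear_combination h
  rcases mul_eq_zero.1 this with h | h
  · rwa [sub_eq_zero.1 h]
  · rwa [sub_eq_zero.1 h]

theorem norm_fst_lt_two {x : ℂ × ℂ} (hx : x ∈ symBidisc) : ‖x.1‖ < 2 := by
  obtain ⟨z, w, hz, hw, rfl⟩ := hx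
  exact (norm_add_le _ _).trans_lt (by linarith)

theorem sq_norm_sub_sq_norm_magic {η : ℂ} (hη : ‖η‖ = 1) (s p : ℂ) :
    ‖2 - η * s‖ ^ 2 - ‖2 * η * p - s‖ ^ 2
      = 4 * ((1 - ‖p‖ ^ 2) - (η * (s - conj s * p)).re) := by
  have h : η.re * η.re + η.im * η.im = 1 := by
    rw [← normSq_apply, normSq_eq_norm_sq, hη]; norm_num
  simp only [← normSq_eq_norm_sq, normSq_apply, sub_re, sub_im, mul_re, mul_im, conj_re, conj_im,
    re_ofNat, im_ofNat]
  linear_combination (s.re ^ 2 + s.im ^ 2 - 4 * (p.re ^ 2 + p.im ^ 2)) * h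

/-- A holomorphic function on the disc whose values lie on a line through the origin is constant. -/
theorem eq_of_conj_eq_mul {f : ℂ → ℂ} {κ : ℂ} (hκ : ‖κ‖ = 1)
    (hf : DifferentiableOn ℂ f (Metric.ball 0 1)) (h : ∀ z ∈ Metric.ball (0 : ℂ) 1, f z = conj (f z) * κ)
    {z w : ℂ} (hz : z ∈ Metric.ball (0 : ℂ) 1) (hw : w ∈ Metric.ball (0 : ℂ) 1) : f z = f w := by
  obtain ⟨τ, hτ⟩ := IsAlgClosed.exists_pow_nat_eq κ (n := 2) (by norm_num)
  have hτ1 : ‖τ‖ = 1 := by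
    have : ‖τ‖ ^ 2 = 1 := by rw [← norm_pow, hτ, hκ]
    exact (pow_eq_one_iff_of_nonneg (norm_nonneg _) two_ne_zero).1 this
  have hττ : conj τ * τ = 1 := by rw [conj_mul', hτ1]; simp
  have hreal : ∀ z ∈ Metric.ball (0 : ℂ) 1, conj (conj τ * f z) = conj τ * f z := fun z hz => by
    rw [map_mul, conj_conj]
    linear_combination (-conj τ) * h z hz + conj τ * conj (f z) * hτ - τ * conj (f z) * hττ
  have him : ∀ z ∈ Metric.ball (0 : ℂ) 1, (conj τ * f z).im = 0 := fun z hz =>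
    conj_eq_iff_im.1 (hreal z hz)
  have hne : ∀ z ∈ Metric.ball (0 : ℂ) 1, conj τ * f z + I ≠ 0 := fun z hz h0 => by
    have := congrArg im h0
    rw [add_im, him z hz, I_im, zero_im] at this
    norm_num at this
  -- the Cayley transform maps the real line into the unit circle
  have hn : ∀ z ∈ Metric.ball (0 : ℂ) 1, ‖(conj τ * f z - I) / (conj τ * f z + I)‖ = 1 := fun z hz => by
    have : conj (conj τ * f z - I) = conj τ * f z + I := by
      rw [map_sub, hreal z hz, conj_I, sub_neg_eq_add]
    rw [norm_div, ← this, RCLike.norm_conj, div_self]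
    rw [← RCLike.norm_conj, this]
    exact norm_ne_zero_iff.2 (hne z hz)
  have hd : DifferentiableOn ℂ (fun z => (conj τ * f z - I) / (conj τ * f z + I)) (Metric.ball 0 1) :=
    ((hf.const_mul _).sub_const _).div ((hf.const_mul _).add_const _) hne
  have := Complex.eqOn_of_isPreconnected_of_isMaxOn_norm (c := w)
    (convex_ball (0 : ℂ) 1).isPreconnected Metric.isOpen_ball hd hw
    (fun y hy => by simp only [mem_ofPred_eq, Function.comp_apply]; rw [hn y hy, hn w hw]) hz
  simp only [Function.const_apply] at this
  rw [div_eq_div_iff (hne z hz) (hne w hw)] at this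
  linear_combination (-I / 2 * τ) * this + (f w - f z) * hττ + (f z - f w) * conj τ * τ * I_sq

/-- An analytic disc in the boundary of the symmetrized bidisc lies on a complex line
`{(s, p) : ξ² - ξ s + p = 0}`. -/
theorem exists_root_of_boundary_disc {S P : ℂ → ℂ} (hS : DifferentiableOn ℂ S (Metric.ball 0 1))
    (hP : DifferentiableOn ℂ P (Metric.ball 0 1)) (hP1 : ∀ w ∈ Metric.ball (0 : ℂ) 1, ‖P w‖ ≤ 1)
    (hb : ∀ w ∈ Metric.ball (0 : ℂ) 1, ‖S w - conj (S w) * P w‖ = 1 - ‖P w‖ ^ 2) :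
    ∃ ξ : ℂ, ∀ w ∈ Metric.ball (0 : ℂ) 1, ξ ^ 2 - ξ * S w + P w = 0 := by
  have hpre : IsPreconnected (Metric.ball (0 : ℂ) 1) := (convex_ball (0 : ℂ) 1).isPreconnected
  by_cases hex : ∃ w ∈ Metric.ball (0 : ℂ) 1, ‖P w‖ = 1
  · obtain ⟨w₁, hw₁, h1⟩ := hex
    have hc : ∀ w ∈ Metric.ball (0 : ℂ) 1, P w = P w₁ :=
      Complex.eqOn_of_isPreconnected_of_isMaxOn_norm hpre Metric.isOpen_ball hP hw₁
        (fun y hy => by simp only [mem_ofPred_eq, Function.comp_apply]; rw [h1]; exact hP1 y hy)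
    have hS' : ∀ w ∈ Metric.ball (0 : ℂ) 1, S w = conj (S w) * P w₁ := fun w hw => by
      have := hb w hw
      rw [hc w hw, h1, one_pow, sub_self, norm_eq_zero, sub_eq_zero] at this
      exact this
    obtain ⟨ξ, η, h2, h3⟩ := exists_roots (S w₁) (P w₁)
    refine ⟨ξ, fun w hw => ?_⟩
    rw [hc w hw, eq_of_conj_eq_mul h1 hS hS' hw hw₁, h2, h3]
    ring
  · push Not at hex
    have hlt : ∀ w ∈ Metric.ball (0 : ℂ) 1, ‖P w‖ < 1 := fun w hw => (hP1 w hw).lt_of_ne (hex w hw)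
    have h0 : (0 : ℂ) ∈ Metric.ball (0 : ℂ) 1 := Metric.mem_ball_self one_pos
    have hβ : ∀ w ∈ Metric.ball (0 : ℂ) 1, ‖leafParam (S w, P w)‖ = 1 := fun w hw => by
      have h2 : 0 < 1 - ‖P w‖ ^ 2 := by nlinarith [norm_nonneg (P w), hlt w hw]
      rw [leafParam, norm_div, norm_real, Real.norm_of_nonneg h2.le, hb w hw, div_self h2.ne']
    have hS2 : ∀ w ∈ Metric.ball (0 : ℂ) 1, ‖S w‖ < 2 := fun w hw => by
      have h2 := leafParam_add (x := (S w, P w)) (hlt w hw)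
      simp only at h2
      rw [← h2]
      refine (norm_add_le _ _).trans_lt ?_
      rw [norm_mul, RCLike.norm_conj, hβ w hw]
      linarith [hlt w hw]
    set ξ := leafParam (S 0, P 0) with hξdef
    have hξ : ‖ξ‖ = 1 := hβ 0 h0
    have hξ' : ‖conj ξ‖ = 1 := by rw [RCLike.norm_conj, hξ]
    have hξξ : conj ξ * ξ = 1 := by rw [conj_mul', hξ]; simp
    have hroot : ξ ^ 2 - ξ * S 0 + P 0 = 0 := by
      have h2 := leafParam_add (x := (S 0, P 0)) (hlt 0 h0)
      rw [← hξdef] at h2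
      linear_combination ξ * h2 - P 0 * hξξ
    have hden : ∀ w ∈ Metric.ball (0 : ℂ) 1, 2 - conj ξ * S w ≠ 0 := fun w hw h => by
      have : ‖conj ξ * S w‖ = 2 := by rw [← sub_eq_zero.1 h]; simp
      rw [norm_mul, hξ', one_mul] at this
      linarith [hS2 w hw]
    have hΦ : ∀ w ∈ Metric.ball (0 : ℂ) 1, ‖(2 * conj ξ * P w - S w) / (2 - conj ξ * S w)‖ ≤ 1 := by
      intro w hw
      rw [norm_div, div_le_one (norm_pos_iff.2 (hden w hw))]
      refine le_of_sq_le_sq ?_ (norm_nonneg _)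
      have h3 := sq_norm_sub_sq_norm_magic hξ' (S w) (P w)
      have h4 := re_le_norm (conj ξ * (S w - conj (S w) * P w))
      rw [norm_mul, hξ', one_mul, hb w hw] at h4
      linarith
    have hΦ0 : (2 * conj ξ * P 0 - S 0) / (2 - conj ξ * S 0) = -ξ := by
      rw [div_eq_iff (hden 0 h0)]
      linear_combination 2 * conj ξ * hroot + (S 0 - 2 * ξ) * hξξ
    have hd : DifferentiableOn ℂ (fun w => (2 * conj ξ * P w - S w) / (2 - conj ξ * S w))
        (Metric.ball 0 1) :=
      ((hP.const_mul _).sub hS).div ((hS.const_mul _).const_sub _) hden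
    refine ⟨ξ, fun w hw => ?_⟩
    have := Complex.eqOn_of_isPreconnected_of_isMaxOn_norm (c := 0) hpre Metric.isOpen_ball hd h0
      (fun y hy => by
        simp only [mem_ofPred_eq, Function.comp_apply]
        rw [hΦ0, norm_neg, hξ]
        exact hΦ y hy) hw
    simp only [Function.const_apply] at this
    rw [hΦ0, div_eq_iff (hden w hw)] at this
    linear_combination (ξ / 2) * this + (ξ * S w / 2 - P w) * hξξ

theorem biholAut_continuous {E : Type*} [NormedAddCommGroup E] [NormedSpace ℂ E]
    {M : Type*} [TopologicalSpace M] [ChartedSpace E M] (θ : biholAut E M) : Continuous θ.1 :=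
  MDifferentiable.continuous θ.2.1

/-- An automorphism of the symmetrized bidisc, as a function of one of the two roots. -/
def autSlice (F : biholAut (ℂ × ℂ) symBidisc) (w : unitDisc) (z : ℂ) : ℂ × ℂ :=
  F.1 (symPt (toOpens unitDisc discZero z) w)

theorem autSlice_comm (F : biholAut (ℂ × ℂ) symBidisc) (z w : unitDisc) :
    autSlice F w z = autSlice F z w := by
  rw [autSlice, autSlice, toOpens_coe, toOpens_coe, symPt_comm]

theorem autSlice_mem (F : biholAut (ℂ × ℂ) symBidisc) (w : unitDisc) (z : ℂ) :
    autSlice F w z ∈ symBidisc := (F.1 _).2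

theorem differentiableOn_autSlice (F : biholAut (ℂ × ℂ) symBidisc) (w : unitDisc) :
    DifferentiableOn ℂ (autSlice F w) (Metric.ball 0 1) := by
  intro z hz
  refine DifferentiableAt.differentiableWithinAt ?_
  rw [← mdifferentiableAt_iff_differentiableAt]
  refine (mdifferentiableAt_opens_iff symBidisc _ _).2 ?_
  refine MDifferentiableAt.comp (g := F.1) z (F.2.1 _) ?_
  rw [← mdifferentiableAt_opens_iff, mdifferentiableAt_iff_differentiableAt]
  have hd : DifferentiableAt ℂ (fun z : ℂ => ((z + w : ℂ), z * w)) z := by fun_prop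
  refine hd.congr_of_eventuallyEq ?_
  filter_upwards [Metric.isOpen_ball.mem_nhds hz] with y hy
  rw [coe_symPt, coe_toOpens hy]

/-- Automorphisms of the symmetrized bidisc are proper: limits of their values along sequences of
points that tend to the boundary lie in the boundary. -/
theorem notMem_symBidisc_of_tendsto {ι : Type*} {l : Filter ι} [l.NeBot]
    (F : biholAut (ℂ × ℂ) symBidisc) (w : unitDisc) {z : ι → ℂ} (hz : ∀ i, ‖z i‖ < 1) {ζ : ℂ}
    (hζ : ‖ζ‖ = 1) (hlim : Tendsto z l (𝓝 ζ)) {y : ℂ × ℂ}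
    (hy : Tendsto (fun i => autSlice F w (z i)) l (𝓝 y)) : y ∉ symBidisc := by
  intro hmem
  have h1 : Tendsto (fun i => F.1 (symPt (toOpens unitDisc discZero (z i)) w)) l
      (𝓝 (⟨y, hmem⟩ : symBidisc)) := tendsto_subtype_rng.2 hy
  have h2 := (((biholAut_continuous F⁻¹).tendsto _).comp h1)
  have h3 := (continuous_subtype_val.tendsto _).comp h2
  have h4 : Tendsto (fun i => ((z i + w : ℂ), z i * w)) l (𝓝 ((ζ + w : ℂ), ζ * w)) :=
    (hlim.add_const _).prodMk_nhds (hlim.mul_const _)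
  have h5 := tendsto_nhds_unique (h3.congr fun i => by
    change ((F.1.symm (F.1 _) : symBidisc) : ℂ × ℂ) = ((z i + w : ℂ), z i * w)
    rw [Equiv.symm_apply_apply, coe_symPt, coe_toOpens (mem_unitDisc.2 (hz i))]) h4
  have h6 : ((ζ + w : ℂ), ζ * w) ∈ symBidisc := by rw [← h5]; exact Subtype.coe_prop _
  exact (norm_root_lt_one h6 (ξ := ζ) (by ring)).ne hζ

theorem closure_symBidisc_subset {y : ℂ × ℂ} (hy : y ∈ closure (symBidisc : Set (ℂ × ℂ))) :
    ‖y.1 - conj y.1 * y.2‖ ≤ 1 - ‖y.2‖ ^ 2 ∧ ‖y.2‖ ≤ 1 := by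
  have h1 : IsClosed {y : ℂ × ℂ | ‖y.1 - conj y.1 * y.2‖ ≤ 1 - ‖y.2‖ ^ 2} :=
    isClosed_le (by fun_prop) (by fun_prop)
  have h2 : IsClosed {y : ℂ × ℂ | ‖y.2‖ ≤ 1} := isClosed_le (by fun_prop) (by fun_prop)
  refine closure_minimal (s := symBidisc) (t := {y : ℂ × ℂ | ‖y.1 - conj y.1 * y.2‖ ≤ 1 - ‖y.2‖ ^ 2} ∩
    {y : ℂ × ℂ | ‖y.2‖ ≤ 1}) (fun x hx => ⟨?_, (norm_snd_lt_one hx).le⟩) (h1.inter h2) hy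
  have h3 : x ∈ symBidiscSet := hx
  rw [symBidiscSet_eq] at h3
  have h4 : ‖x.1 - conj x.1 * x.2‖ < 1 - ‖x.2‖ ^ 2 := h3
  exact h4.le

/-- Let `Q` be a continuous function of three points that vanishes when the points lie on a common
line `{ξ² - ξ s + p = 0}`. Evaluated on three slices of an automorphism, it tends to `0` at the
boundary of the disc, because there the automorphism tends to analytic discs in the boundary. -/
theorem autSlice_boundary (F : biholAut (ℂ × ℂ) symBidisc) (w₁ w₂ w₃ : unitDisc)
    {Q : ℂ × ℂ → ℂ × ℂ → ℂ × ℂ → ℂ}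
    (hQ : Continuous fun y : (ℂ × ℂ) × (ℂ × ℂ) × (ℂ × ℂ) => Q y.1 y.2.1 y.2.2)
    (hQ0 : ∀ (ξ : ℂ) (y₁ y₂ y₃ : ℂ × ℂ), ξ ^ 2 - ξ * y₁.1 + y₁.2 = 0 → ξ ^ 2 - ξ * y₂.1 + y₂.2 = 0 →
      ξ ^ 2 - ξ * y₃.1 + y₃.2 = 0 → Q y₁ y₂ y₃ = 0) :
    ∀ ε > 0, ∃ r < 1, ∀ z : ℂ, r < ‖z‖ → ‖z‖ < 1 →
      ‖Q (autSlice F w₁ z) (autSlice F w₂ z) (autSlice F w₃ z)‖ ≤ ε := by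
  intro ε hε
  by_contra! hcon
  choose z hz1 hz2 hz3 using fun n : ℕ => hcon (1 - 1 / (n + 1)) (by
    have : (0 : ℝ) < 1 / (n + 1) := by positivity
    linarith)
  set l := hyperfilter ℕ
  have hcpt : ∀ (u : ℕ → ℂ × ℂ), (∀ n, u n ∈ symBidisc) →
      ∃ y, Tendsto u l (𝓝 y) := by
    intro u hu
    obtain ⟨y, -, hy⟩ := (isCompact_closedBall (0 : ℂ × ℂ) 2).ultrafilter_le_nhds (l.map u) (by
      rw [Ultrafilter.coe_map, le_principal_iff, mem_map]
      refine Filter.univ_mem' fun n => ?_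
      rw [mem_preimage, mem_closedBall_zero_iff, Prod.norm_def]
      exact max_le (norm_fst_lt_two (hu n)).le ((norm_snd_lt_one (hu n)).le.trans one_le_two))
    exact ⟨y, hy⟩
  obtain ⟨ζ, -, hζ⟩ := (isCompact_closedBall (0 : ℂ) 1).ultrafilter_le_nhds (l.map z) (by
      rw [Ultrafilter.coe_map, le_principal_iff, mem_map]
      exact Filter.univ_mem' fun n => mem_closedBall_zero_iff.2 (hz2 n).le)
  have hζ : Tendsto z l (𝓝 ζ) := hζ
  have hl : (l : Filter ℕ) ≤ atTop := by
    rw [← Nat.cofinite_eq_atTop]; exact hyperfilter_le_cofinite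
  have hζ1 : ‖ζ‖ = 1 := by
    refine tendsto_nhds_unique hζ.norm ?_
    refine Tendsto.mono_left ?_ hl
    refine tendsto_of_tendsto_of_tendsto_of_le_of_le ?_ tendsto_const_nhds (fun n => (hz1 n).le)
      fun n => (hz2 n).le
    simpa using (tendsto_const_nhds (x := (1 : ℝ))).sub tendsto_one_div_add_atTop_nhds_zero_nat
  choose y hy using fun w : unitDisc => hcpt (fun n => autSlice F w (z n))
    (fun n => autSlice_mem F w _)
  have hcl : ∀ w, y w ∈ closure (symBidisc : Set (ℂ × ℂ)) := fun w =>
    mem_closure_of_tendsto (hy w) (Eventually.of_forall fun n => autSlice_mem F w _)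
  have hdiff : DifferentiableOn ℂ (fun w => y (toOpens unitDisc discZero w)) (Metric.ball 0 1) := by
    refine differentiableOn_of_tendsto_of_norm_le (l := (l : Filter ℕ)) (C := 2)
      (u := fun n w => autSlice F ⟨z n, mem_unitDisc.2 (hz2 n)⟩ w) Metric.isOpen_ball
      (Eventually.of_forall fun n => differentiableOn_autSlice F _)
      (Eventually.of_forall fun n w _ => ?_) fun w hw => ?_
    · rw [Prod.norm_def]
      exact max_le (norm_fst_lt_two (autSlice_mem F _ _)).le
        ((norm_snd_lt_one (autSlice_mem F _ _)).le.trans one_le_two)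
    · refine (hy (toOpens unitDisc discZero w)).congr fun n => ?_
      have := autSlice_comm F ⟨z n, mem_unitDisc.2 (hz2 n)⟩ (toOpens unitDisc discZero w)
      rw [coe_toOpens hw] at this
      exact this
  obtain ⟨ξ, hξ⟩ := exists_root_of_boundary_disc (S := fun w => (y (toOpens unitDisc discZero w)).1)
    (P := fun w => (y (toOpens unitDisc discZero w)).2) hdiff.fst hdiff.snd
    (fun w _ => (closure_symBidisc_subset (hcl _)).2) (fun w _ => by
      refine (closure_symBidisc_subset (hcl _)).1.antisymm (not_lt.1 fun h => ?_)
      refine notMem_symBidisc_of_tendsto F _ hz2 hζ1 hζ (hy (toOpens unitDisc discZero w)) ?_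
      change _ ∈ symBidiscSet
      rw [symBidiscSet_eq]
      exact h)
  have hroot : ∀ w : unitDisc, ξ ^ 2 - ξ * (y w).1 + (y w).2 = 0 := fun w => by
    have := hξ w w.2
    simpa only [toOpens_coe] using this
  have hlimQ := (hQ.tendsto (y w₁, y w₂, y w₃)).comp
    ((hy w₁).prodMk_nhds ((hy w₂).prodMk_nhds (hy w₃)))
  have h0 := hQ0 ξ _ _ _ (hroot w₁) (hroot w₂) (hroot w₃)
  have := le_of_tendsto_of_tendsto tendsto_const_nhds hlimQ.norm
    (Eventually.of_forall fun n => (hz3 n).le)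
  simp only [h0, norm_zero] at this
  linarith

/-- Every automorphism of the symmetrized bidisc has the form `(z + w, zw) ↦ (ξ z + ξ w, ξ z * ξ w)`
with a holomorphic self-map `ξ` of the disc. -/
theorem exists_symPt_of_biholAut (F : biholAut (ℂ × ℂ) symBidisc) :
    ∃ ξ : unitDisc → unitDisc, MDifferentiable 𝓘(ℂ, ℂ) 𝓘(ℂ, ℂ) ξ ∧
      ∀ z w, F.1 (symPt z w) = symPt (ξ z) (ξ w) := by
  have hdS : ∀ w, DifferentiableOn ℂ (fun z => (autSlice F w z).1) (Metric.ball 0 1) :=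
    fun w => (differentiableOn_autSlice F w).fst
  have hdP : ∀ w, DifferentiableOn ℂ (fun z => (autSlice F w z).2) (Metric.ball 0 1) :=
    fun w => (differentiableOn_autSlice F w).snd
  -- the three points lie on a line
  have hα : ∀ (w₁ w₂ w₃ : unitDisc) (z : ℂ), ‖z‖ < 1 →
      ((autSlice F w₁ z).1 - (autSlice F w₂ z).1) * ((autSlice F w₁ z).2 - (autSlice F w₃ z).2)
        = ((autSlice F w₁ z).2 - (autSlice F w₂ z).2)
          * ((autSlice F w₁ z).1 - (autSlice F w₃ z).1) := by
    intro w₁ w₂ w₃ z hz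
    rw [← sub_eq_zero]
    refine eq_zero_of_tendsto_zero_boundary (u := fun z =>
      ((autSlice F w₁ z).1 - (autSlice F w₂ z).1) * ((autSlice F w₁ z).2 - (autSlice F w₃ z).2)
        - ((autSlice F w₁ z).2 - (autSlice F w₂ z).2)
          * ((autSlice F w₁ z).1 - (autSlice F w₃ z).1)) ?_ ?_ hz
    · exact (((hdS w₁).sub (hdS w₂)).mul ((hdP w₁).sub (hdP w₃))).sub
        (((hdP w₁).sub (hdP w₂)).mul ((hdS w₁).sub (hdS w₃)))
    · refine autSlice_boundary F w₁ w₂ w₃ (Q := fun y₁ y₂ y₃ =>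
        (y₁.1 - y₂.1) * (y₁.2 - y₃.2) - (y₁.2 - y₂.2) * (y₁.1 - y₃.1)) (by fun_prop) ?_
      intro ξ y₁ y₂ y₃ h1 h2 h3
      linear_combination (-(y₁.1 - y₃.1)) * (h1 - h2) + (y₁.1 - y₂.1) * (h1 - h3)
  -- the slope of that line is a root
  have hβ : ∀ (w₁ w₂ : unitDisc) (z : ℂ), ‖z‖ < 1 →
      (autSlice F w₁ z).2 * ((autSlice F w₁ z).1 - (autSlice F w₂ z).1) ^ 2
        - (autSlice F w₁ z).1 * ((autSlice F w₁ z).1 - (autSlice F w₂ z).1)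
          * ((autSlice F w₁ z).2 - (autSlice F w₂ z).2)
        + ((autSlice F w₁ z).2 - (autSlice F w₂ z).2) ^ 2 = 0 := by
    intro w₁ w₂ z hz
    refine eq_zero_of_tendsto_zero_boundary (u := fun z =>
      (autSlice F w₁ z).2 * ((autSlice F w₁ z).1 - (autSlice F w₂ z).1) ^ 2
        - (autSlice F w₁ z).1 * ((autSlice F w₁ z).1 - (autSlice F w₂ z).1)
          * ((autSlice F w₁ z).2 - (autSlice F w₂ z).2)
        + ((autSlice F w₁ z).2 - (autSlice F w₂ z).2) ^ 2) ?_ ?_ hz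
    · exact (((hdP w₁).mul (((hdS w₁).sub (hdS w₂)).pow 2)).sub
        (((hdS w₁).mul ((hdS w₁).sub (hdS w₂))).mul ((hdP w₁).sub (hdP w₂)))).add
        (((hdP w₁).sub (hdP w₂)).pow 2)
    · refine autSlice_boundary F w₁ w₂ w₂ (Q := fun y₁ y₂ _ =>
        y₁.2 * (y₁.1 - y₂.1) ^ 2 - y₁.1 * (y₁.1 - y₂.1) * (y₁.2 - y₂.2) + (y₁.2 - y₂.2) ^ 2)
        (by fun_prop) ?_
      intro ξ y₁ y₂ y₃ h1 h2 _
      have h3 : y₁.2 - y₂.2 = ξ * (y₁.1 - y₂.1) := by linear_combination h1 - h2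
      rw [h3]
      linear_combination (y₁.1 - y₂.1) ^ 2 * h1
  -- a pair of slices with a nonzero difference of first coordinates
  obtain ⟨w₁, w₂, z₀, hz₀, hne⟩ : ∃ (w₁ w₂ : unitDisc) (z₀ : ℂ), ‖z₀‖ < 1 ∧
      (autSlice F w₁ z₀).1 - (autSlice F w₂ z₀).1 ≠ 0 := by
    by_contra! h
    have hhalf : ‖(1 / 2 : ℂ)‖ < 1 := by norm_num
    have h1 := h discZero ⟨1 / 2, mem_unitDisc.2 hhalf⟩ 0 (by simp)
    have h2 := hβ discZero ⟨1 / 2, mem_unitDisc.2 hhalf⟩ 0 (by simp)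
    rw [h1] at h2
    have h3 : (autSlice F discZero 0).2 - (autSlice F ⟨1 / 2, mem_unitDisc.2 hhalf⟩ 0).2 = 0 := by
      simpa using h2
    have h4 := F.1.injective (Subtype.ext (Prod.ext (sub_eq_zero.1 h1) (sub_eq_zero.1 h3)))
    have h5 := congrArg (fun x : symBidisc => (x : ℂ × ℂ).1) h4
    simp [coe_symPt] at h5
  set h : ℂ → ℂ := fun z => (autSlice F w₁ z).1 - (autSlice F w₂ z).1 with hh
  set k : ℂ → ℂ := fun z => (autSlice F w₁ z).2 - (autSlice F w₂ z).2 with hk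
  have hhd : DifferentiableOn ℂ h (Metric.ball 0 1) := (hdS w₁).sub (hdS w₂)
  have hkd : DifferentiableOn ℂ k (Metric.ball 0 1) := (hdP w₁).sub (hdP w₂)
  have hquad : ∀ (w : unitDisc) (z : ℂ), ‖z‖ < 1 →
      k z ^ 2 - k z * h z * (autSlice F w z).1 + (autSlice F w z).2 * h z ^ 2 = 0 := by
    intro w z hz
    linear_combination hβ w₁ w₂ z hz - h z * hα w₁ w₂ w z hz
  have hroot : ∀ (w : unitDisc) (z : ℂ), ‖z‖ < 1 → h z ≠ 0 →
      (k z / h z) ^ 2 - (k z / h z) * (autSlice F w z).1 + (autSlice F w z).2 = 0 := by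
    intro w z hz h0
    have := hquad w z hz
    field_simp
    linear_combination this
  have hpre : IsPreconnected (Metric.ball (0 : ℂ) 1) := (convex_ball (0 : ℂ) 1).isPreconnected
  have hhan : AnalyticOnNhd ℂ h (Metric.ball 0 1) := hhd.analyticOnNhd Metric.isOpen_ball
  have hpunct : ∀ z : ℂ, ‖z‖ < 1 → ∀ᶠ y in 𝓝[≠] z, h y ≠ 0 := by
    intro z hz
    rcases (hhan z (mem_ball_zero_iff.2 hz)).eventually_eq_zero_or_eventually_ne_zero with h1 | h1
    · exact absurd (hhan.eqOn_zero_of_preconnected_of_eventuallyEq_zero hpre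
        (mem_ball_zero_iff.2 hz) h1 (mem_ball_zero_iff.2 hz₀)) hne
    · exact h1
  have hball : ∀ {z : ℂ}, ‖z‖ < 1 → ∀ᶠ y in 𝓝 z, ‖y‖ < 1 := fun hz =>
    isOpen_norm_lt_one.mem_nhds hz
  have hbdd : ∀ z : ℂ, ‖z‖ < 1 → h z ≠ 0 → ‖k z / h z‖ < 1 := fun z hz h0 =>
    norm_root_lt_one (autSlice_mem F discZero z) (hroot discZero z hz h0)
  have hqd : ∀ z : ℂ, ‖z‖ < 1 → h z ≠ 0 → DifferentiableAt ℂ (fun z => k z / h z) z :=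
    fun z hz h0 => (hkd.differentiableAt (isOpen_norm_lt_one.mem_nhds hz |> fun h => by
      simpa [Metric.ball, dist_zero_right] using h)).div
      (hhd.differentiableAt (isOpen_norm_lt_one.mem_nhds hz |> fun h => by
      simpa [Metric.ball, dist_zero_right] using h)) h0
  -- the slope extends holomorphically over the zeros of `h`
  have hlim : ∀ z : ℂ, ‖z‖ < 1 → Tendsto (fun z => k z / h z) (𝓝[≠] z)
      (𝓝 (limUnder (𝓝[≠] z) fun z => k z / h z)) := by
    intro z hz
    refine Complex.tendsto_limUnder_of_differentiable_on_punctured_nhds_of_bounded_under ?_ ?_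
    · filter_upwards [hpunct z hz, (hball hz).filter_mono nhdsWithin_le_nhds] with y h1 h2
      exact hqd y h2 h1
    · refine isBoundedUnder_of_eventually_le (a := 1 + ‖k z / h z‖) ?_
      filter_upwards [hpunct z hz, (hball hz).filter_mono nhdsWithin_le_nhds] with y h1 h2
      exact (norm_sub_le _ _).trans (add_le_add_left (hbdd y h2 h1).le _)
  set ξ : ℂ → ℂ := fun z => limUnder (𝓝[≠] z) fun z => k z / h z with hξ
  have hξeq : ∀ z : ℂ, ‖z‖ < 1 → h z ≠ 0 → ξ z = k z / h z := fun z hz h0 =>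
    tendsto_nhds_unique (hlim z hz)
      ((hqd z hz h0).continuousAt.tendsto.mono_left nhdsWithin_le_nhds)
  have hξd : DifferentiableOn ℂ ξ (Metric.ball 0 1) := by
    intro z hz
    rw [mem_ball_zero_iff] at hz
    refine DifferentiableAt.differentiableWithinAt ?_
    refine (Complex.analyticAt_of_differentiable_on_punctured_nhds_of_continuousAt ?_ ?_).differentiableAt
    · filter_upwards [hpunct z hz, (hball hz).filter_mono nhdsWithin_le_nhds] with y h1 h2
      refine (hqd y h2 h1).congr_of_eventuallyEq ?_
      have hc : ContinuousAt h y := (hhan y (mem_ball_zero_iff.2 h2)).continuousAt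
      filter_upwards [hball h2, hc.eventually_ne h1] with x h3 h4 using hξeq x h3 h4
    · rw [continuousAt_iff_punctured_nhds]
      refine (hlim z hz).congr' ?_
      filter_upwards [hpunct z hz, (hball hz).filter_mono nhdsWithin_le_nhds] with y h1 h2
      exact (hξeq y h2 h1).symm
  have hξroot : ∀ (w : unitDisc) (z : ℂ), ‖z‖ < 1 →
      ξ z ^ 2 - ξ z * (autSlice F w z).1 + (autSlice F w z).2 = 0 := by
    intro w z hz
    have hzb := Metric.isOpen_ball.mem_nhds (mem_ball_zero_iff.2 hz)
    have h1 : Tendsto (fun z => ξ z ^ 2 - ξ z * (autSlice F w z).1 + (autSlice F w z).2) (𝓝[≠] z)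
        (𝓝 (ξ z ^ 2 - ξ z * (autSlice F w z).1 + (autSlice F w z).2)) := by
      have : ContinuousAt (fun z => ξ z ^ 2 - ξ z * (autSlice F w z).1 + (autSlice F w z).2) z :=
        (((hξd.pow 2).sub (hξd.mul (hdS w))).add (hdP w)).continuousOn.continuousAt hzb
      exact this.tendsto.mono_left nhdsWithin_le_nhds
    refine tendsto_nhds_unique h1 (tendsto_const_nhds.congr' ?_)
    filter_upwards [hpunct z hz, (hball hz).filter_mono nhdsWithin_le_nhds] with y h2 h3
    rw [hξeq y h3 h2, hroot w y h3 h2]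
  have hξ1 : ∀ z : ℂ, ‖z‖ < 1 → ‖ξ z‖ < 1 := fun z hz =>
    norm_root_lt_one (autSlice_mem F discZero z) (hξroot discZero z hz)
  have hξan : AnalyticOnNhd ℂ ξ (Metric.ball 0 1) := hξd.analyticOnNhd Metric.isOpen_ball
  -- `ξ` is not constant, as the image is not contained in a line
  have hnc : ∀ w : unitDisc, ¬ ∀ z ∈ Metric.ball (0 : ℂ) 1, ξ z - ξ w = 0 := by
    intro w hcon
    have hall : ∀ y : symBidisc, ξ w ^ 2 - ξ w * (y : ℂ × ℂ).1 + (y : ℂ × ℂ).2 = 0 := by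
      intro y
      obtain ⟨x, rfl⟩ := F.1.surjective y
      obtain ⟨a, b, rfl⟩ := exists_symPt x
      have h1 := hξroot b a (norm_coe_lt_one a)
      rw [sub_eq_zero.1 (hcon a a.2), autSlice, toOpens_coe] at h1
      exact h1
    have h1 := hall (leafMap discZero)
    have h2 := hall (leafMap ⟨1 / 2, mem_unitDisc.2 (by norm_num)⟩)
    simp only [coe_leafMap, coe_discZero] at h1 h2
    have : (1 / 2 : ℂ) = 0 := by linear_combination h2 - h1
    norm_num at this
  have hsum : ∀ z w : unitDisc, (autSlice F w z).1 = ξ z + ξ w := by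
    intro z w
    have hprod : ∀ z ∈ Metric.ball (0 : ℂ) 1,
        (ξ z - ξ w) * (ξ z + ξ w - (autSlice F w z).1) = 0 := by
      intro z hz
      have h1 := hξroot w z (mem_ball_zero_iff.1 hz)
      have h2 := hξroot ⟨z, hz⟩ w (norm_coe_lt_one w)
      rw [← autSlice_comm F ⟨z, hz⟩ w] at h2
      linear_combination h1 - h2
    rcases AnalyticOnNhd.eq_zero_or_eq_zero_of_mul_eq_zero
      (f := fun z => ξ z - ξ w) (g := fun z => ξ z + ξ w - (autSlice F w z).1)
      ((hξd.sub_const _).analyticOnNhd Metric.isOpen_ball)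
      (((hξd.add_const _).sub (hdS w)).analyticOnNhd Metric.isOpen_ball) hprod hpre with h1 | h1
    · exact absurd h1 (hnc w)
    · exact (sub_eq_zero.1 (h1 z z.2)).symm
  refine ⟨fun z => ⟨ξ z, mem_unitDisc.2 (hξ1 z (norm_coe_lt_one z))⟩, ?_, fun z w => ?_⟩
  · exact mdifferentiable_disc_map _ ξ (fun z => hξd.differentiableAt
      (Metric.isOpen_ball.mem_nhds z.2)) fun _ => rfl
  · have h1 := hsum z w
    have h2 := hξroot w z (norm_coe_lt_one z)
    have h3 : (autSlice F w z).2 = ξ z * ξ w := by rw [h1] at h2; linear_combination h2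
    rw [autSlice, toOpens_coe] at h1 h3
    exact Subtype.ext (Prod.ext h1 h3)

theorem symAutHom_surjective : Function.Surjective symAutHom := by
  intro F
  obtain ⟨ξ, hξd, hξ⟩ := exists_symPt_of_biholAut F
  obtain ⟨η, hηd, hη⟩ := exists_symPt_of_biholAut F⁻¹
  have h1 : ∀ z, η (ξ z) = z := fun z => royalMap_injective (by
    rw [royalMap, ← hη, ← hξ]; exact F.1.symm_apply_apply _)
  have h2 : ∀ z, ξ (η z) = z := fun z => royalMap_injective (by
    rw [royalMap, ← hξ, ← hη]; exact F.1.apply_symm_apply _)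
  refine ⟨⟨⟨ξ, η, h1, h2⟩, hξd, hηd⟩, Subtype.ext (Equiv.ext fun x => ?_)⟩
  obtain ⟨z, w, rfl⟩ := exists_symPt x
  rw [symAutHom_symPt, hξ]
  rfl

/-- The automorphism groups of the disc and of the symmetrized bidisc are isomorphic. -/
def symAut : biholAut ℂ unitDisc ≃* biholAut (ℂ × ℂ) symBidisc :=
  MulEquiv.ofBijective symAutHom ⟨symAutHom_injective, symAutHom_surjective⟩

/-! ### Proper analytic embeddings and concomitant pairs -/

/-- If `ψ` has a nonzero strict derivative at `b z` and `ψ ∘ b` is differentiable, so is `b`. -/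
theorem differentiableAt_of_comp_strict {ψ b : ℂ → ℂ} {z c : ℂ} (hc : c ≠ 0)
    (hψ : HasStrictDerivAt ψ c (b z)) (hb : ContinuousAt b z)
    (h : DifferentiableAt ℂ (fun y => ψ (b y)) z) : DifferentiableAt ℂ b z := by
  have h1 := (hψ.to_localInverse hc).hasDerivAt.differentiableAt
  have h2 : DifferentiableAt ℂ (fun y => (hψ.localInverse ψ c (b z) hc) (ψ (b y))) z :=
    DifferentiableAt.comp z (f := fun y => ψ (b y)) h1 h
  refine h2.congr_of_eventuallyEq ?_
  have h3 := hψ.hasStrictFDerivAt_equiv hc |>.eventually_left_inverse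
  filter_upwards [hb.eventually h3] with y hy using hy.symm

section Royal

variable {E : Type*} [NormedAddCommGroup E] [NormedSpace ℂ E]
  {Ω : Type*} [TopologicalSpace Ω] [ChartedSpace E Ω]

theorem mfderiv_injective_of_leftInverse {𝕜 : Type*} [NontriviallyNormedField 𝕜]
    {V : Type*} [NormedAddCommGroup V] [NormedSpace 𝕜 V] {M : Type*} [TopologicalSpace M]
    [ChartedSpace V M] {W : Type*} [NormedAddCommGroup W] [NormedSpace 𝕜 W] {N : Type*}
    [TopologicalSpace N] [ChartedSpace W N] {f : M → N} {g : N → M} {x : M}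
    (hf : MDifferentiableAt 𝓘(𝕜, V) 𝓘(𝕜, W) f x) (hg : MDifferentiableAt 𝓘(𝕜, W) 𝓘(𝕜, V) g (f x))
    (h : ∀ᶠ y in 𝓝 x, g (f y) = y) : Function.Injective (mfderiv 𝓘(𝕜, V) 𝓘(𝕜, W) f x) := by
  have h1 := mfderiv_comp x hg hf
  have h2 : g ∘ f =ᶠ[𝓝 x] id := h
  rw [h2.mfderiv_eq, mfderiv_id] at h1
  intro v w hvw
  have h3 : ∀ u, mfderiv 𝓘(𝕜, W) 𝓘(𝕜, V) g (f x) (mfderiv 𝓘(𝕜, V) 𝓘(𝕜, W) f x u) = u := fun u =>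
    (DFunLike.congr_fun h1 u).symm
  have h4 := h3 w
  rw [← hvw] at h4
  exact (h3 v).symm.trans h4

/-- A holomorphic map of the disc with a holomorphic left inverse is a proper embedding. -/
theorem isProperEmbedding_of_leftInverse [T2Space Ω] {f : unitDisc → Ω} {g : Ω → unitDisc}
    (hf : MDifferentiable 𝓘(ℂ, ℂ) 𝓘(ℂ, E) f) (hg : MDifferentiable 𝓘(ℂ, E) 𝓘(ℂ, ℂ) g)
    (h : Function.LeftInverse g f) : IsProperEmbedding E f where
  holomorphic := hf
  injective := h.injective
  immersion z := mfderiv_injective_of_leftInverse (hf z) (hg _) (Eventually.of_forall h)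
  proper := (h.isClosedEmbedding hg.continuous hf.continuous).isProperMap

theorem IsProperEmbedding.isClosedEmbedding {f : unitDisc → Ω} (hf : IsProperEmbedding E f) :
    IsClosedEmbedding f :=
  .of_continuous_injective_isClosedMap hf.proper.continuous hf.injective hf.proper.isClosedMap

theorem IsProperEmbedding.comp_discAut {f : unitDisc → Ω} (hf : IsProperEmbedding E f)
    (b : biholAut ℂ unitDisc) : IsProperEmbedding E (f ∘ b.1) where
  holomorphic := hf.holomorphic.comp b.2.1
  injective := hf.injective.comp b.1.injective
  immersion z := by
    rw [mfderiv_comp z (hf.holomorphic _) (b.2.1 z)]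
    exact (hf.immersion _).comp (mfderiv_injective_of_leftInverse (b.2.1 z) (b.2.2 _)
      (Eventually.of_forall b.1.symm_apply_apply))
  proper := hf.proper.comp (Homeomorph.isProperMap
    ⟨b.1, biholAut_continuous b, biholAut_continuous b⁻¹⟩)

theorem IsDiscParam.comp_discAut {f : unitDisc → Ω} {D : Set Ω} (hf : IsDiscParam E f D)
    (b : biholAut ℂ unitDisc) : IsDiscParam E (f ∘ b.1) D :=
  ⟨hf.1.comp_discAut b, by rw [range_comp, b.1.range_eq_univ, image_univ, hf.2]⟩

theorem IsProperEmbedding.biholAut_comp {f : unitDisc → Ω} (hf : IsProperEmbedding E f)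
    (θ : biholAut E Ω) : IsProperEmbedding E (θ.1 ∘ f) where
  holomorphic := MDifferentiable.comp θ.2.1 hf.holomorphic
  injective := θ.1.injective.comp hf.injective
  immersion z := by
    rw [mfderiv_comp z (θ.2.1 _) (hf.holomorphic z)]
    exact (mfderiv_injective_of_leftInverse (θ.2.1 _) (θ.2.2 _)
      (Eventually.of_forall θ.1.symm_apply_apply)).comp (hf.immersion _)
  proper := (Homeomorph.isProperMap
    ⟨θ.1, biholAut_continuous θ, biholAut_continuous θ⁻¹⟩).comp hf.proper

theorem IsConcomitantPair.conj {D : Set Ω} {d : unitDisc → Ω}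
    {Θ : biholAut ℂ unitDisc ≃* biholAut E Ω} (h : IsConcomitantPair E D d Θ)
    (b : biholAut ℂ unitDisc) :
    IsConcomitantPair E D (d ∘ b.1) ((MulAut.conj b).trans Θ) :=
  ⟨h.1.comp_discAut b, fun m z => by
    change (Θ (b * m * b⁻¹)).1 (d (b.1 z)) = _
    rw [h.2]
    change d (b.1 (m.1 (b.1.symm (b.1 z)))) = _
    rw [Equiv.symm_apply_apply]; rfl⟩

variable [IsManifold 𝓘(ℂ, E) ω Ω]

theorem isManifold_one_complex : IsManifold 𝓘(ℂ, E) 1 Ω := IsManifold.of_le (n := ω) le_top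

/-- A map `b` of the disc is holomorphic if its composition with a proper embedding is. -/
theorem IsProperEmbedding.mdifferentiable_of_comp {f g : unitDisc → Ω} (hf : IsProperEmbedding E f)
    (hg : MDifferentiable 𝓘(ℂ, ℂ) 𝓘(ℂ, E) g) {b : unitDisc → unitDisc} (hb : ∀ z, f (b z) = g z) :
    MDifferentiable 𝓘(ℂ, ℂ) 𝓘(ℂ, ℂ) b := by
  have : IsManifold 𝓘(ℂ, E) 1 Ω := isManifold_one_complex
  have hbc : Continuous b := by
    rw [hf.isClosedEmbedding.continuous_iff, show f ∘ b = g from funext hb]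
    exact hg.continuous
  intro z
  set x := f (b z) with hx
  have hfd : ∀ᶠ y in 𝓝 (b z : ℂ), DifferentiableAt ℂ (fun w => chartAt E x (discExt f w)) y := by
    have h1 : ContinuousAt (discExt f) (b z : ℂ) :=
      (MDifferentiableAt.comp_toOpens (b z).2 (hf.holomorphic _)).continuousAt
    have h2 : discExt f (b z : ℂ) ∈ (chartAt E x).source := by
      rw [discExt_coe]; exact mem_chart_source E x
    filter_upwards [h1.preimage_mem_nhds ((chartAt E x).open_source.mem_nhds h2),
      unitDisc.isOpen.mem_nhds (b z).2] with y hy hy2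
    exact (MDifferentiableAt.comp_toOpens hy2 (hf.holomorphic _)).differentiableAt_chart hy
  have hinj := hf.immersion (b z)
  rw [mfderiv_opens_eq_fderiv (x₀ := discZero) (hf.holomorphic _)] at hinj
  set L : ℂ →L[ℂ] E := fderiv ℂ (fun w => chartAt E x (discExt f w)) (b z) with hL
  have hinj' : Function.Injective L := hinj
  have hL1 : L 1 ≠ 0 := fun h0 => one_ne_zero (hinj' (h0.trans (map_zero L).symm))
  obtain ⟨ℓ, hℓ⟩ := SeparatingDual.exists_ne_zero (R := ℂ) hL1
  have hstr : HasStrictDerivAt (fun w => ℓ (chartAt E x (discExt f w))) (ℓ (L 1)) (b z : ℂ) := by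
    have := (ℓ.hasStrictFDerivAt.comp _
      (hasStrictFDerivAt_of_eventually_differentiableAt hfd)).hasStrictDerivAt
    exact this
  refine mdifferentiableAt_of_comp_toOpens (x₀ := discZero) ?_
  rw [← mdifferentiableAt_opens_iff, mdifferentiableAt_iff_differentiableAt]
  have hbz : ((discExt b z : unitDisc) : ℂ) = b z := by rw [discExt_coe]
  refine differentiableAt_of_comp_strict (ψ := fun w => ℓ (chartAt E x (discExt f w))) hℓ ?_ ?_ ?_
  · change HasStrictDerivAt _ _ ((discExt b z : unitDisc) : ℂ)
    rw [hbz]; exact hstr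
  · exact continuous_subtype_val.continuousAt.comp (hbc.continuousAt.comp
      (mdifferentiableAt_toOpens (𝕜 := ℂ) z.2).continuousAt)
  · simp only [discExt, toOpens_coe, hb]
    have h1 := MDifferentiableAt.comp_toOpens (x₀ := discZero) z.2 (hg z)
    exact ℓ.differentiableAt.comp _ (h1.differentiableAt_chart (x := x) (by
      rw [toOpens_coe, ← hb]; exact mem_chart_source E x))

/-- Two parametrizations of a properly embedded disc differ by an automorphism of the disc. -/
theorem IsDiscParam.exists_discAut {f g : unitDisc → Ω} {D : Set Ω} (hf : IsDiscParam E f D)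
    (hg : IsDiscParam E g D) : ∃ b : biholAut ℂ unitDisc, g = f ∘ b.1 := by
  have h1 : ∀ z, ∃ w, f w = g z := fun z => by
    rw [← mem_range, hf.2, ← hg.2]; exact mem_range_self z
  have h2 : ∀ z, ∃ w, g w = f z := fun z => by
    rw [← mem_range, hg.2, ← hf.2]; exact mem_range_self z
  choose b hb using h1
  choose c hc using h2
  refine ⟨⟨⟨b, c, fun z => hg.1.injective (by rw [hc, hb]), fun z => hf.1.injective (by rw [hb, hc])⟩,
    hf.1.mdifferentiable_of_comp hg.1.holomorphic hb,
    hg.1.mdifferentiable_of_comp hf.1.holomorphic hc⟩, ?_⟩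
  exact funext fun z => (hb z).symm

/-- Two concomitant pairs differ by an automorphism of the disc. -/
theorem IsConcomitantPair.exists_discAut {D : Set Ω}
    (hdet : ∀ θ₁ θ₂ : biholAut E Ω, EqOn θ₁.1 θ₂.1 D → θ₁ = θ₂) {d d' : unitDisc → Ω}
    {Θ Θ' : biholAut ℂ unitDisc ≃* biholAut E Ω} (h : IsConcomitantPair E D d Θ)
    (h' : IsConcomitantPair E D d' Θ') :
    ∃ b : biholAut ℂ unitDisc, d' = d ∘ b.1 ∧ ∀ m, Θ' m = Θ (b * m * b⁻¹) := by
  obtain ⟨b, rfl⟩ := h.1.exists_discAut h'.1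
  refine ⟨b, rfl, fun m => hdet _ _ fun x hx => ?_⟩
  rw [← h'.1.2] at hx
  obtain ⟨z, rfl⟩ := hx
  rw [h'.2, Function.comp_apply, Function.comp_apply, h.2]
  congr 1
  change _ = b.1 (m.1 (b.1.symm (b.1 z)))
  rw [Equiv.symm_apply_apply]

end Royal

/-! ### The derivative of the action on the symmetrized bidisc -/

theorem differentiableAt_symFormula {r : ℝ} {α : ℂ} (hα : ‖α‖ < 1) {x : ℂ × ℂ} (hx : x ∈ symBidisc) :
    DifferentiableAt ℝ (fun q : (ℝ × ℂ) × (ℂ × ℂ) => symFormula q.1.1 q.1.2 q.2) ((r, α), x) := by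
  have h := symFormula_denom_ne hα hx
  have hc : ∀ q, DifferentiableAt ℝ (fun q : (ℝ × ℂ) × (ℂ × ℂ) => conj q.1.2) q := fun q =>
    (conjCLE.toContinuousLinearMap.differentiable.comp
      (differentiable_fst.snd : Differentiable ℝ fun q : (ℝ × ℂ) × (ℂ × ℂ) => q.1.2)) q
  have ho : ∀ q, DifferentiableAt ℝ (fun q : (ℝ × ℂ) × (ℂ × ℂ) => (q.1.1 : ℂ)) q := fun q =>
    (ofRealCLM.differentiable.comp
      (differentiable_fst.fst : Differentiable ℝ fun q : (ℝ × ℂ) × (ℂ × ℂ) => q.1.1)) q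
  have he : DifferentiableAt ℝ (fun q : (ℝ × ℂ) × (ℂ × ℂ) => cexp (q.1.1 * I)) ((r, α), x) :=
    ((ho _).mul_const _).cexp
  have hinv : DifferentiableAt ℝ (fun q : (ℝ × ℂ) × (ℂ × ℂ) =>
      (1 - conj q.1.2 * q.2.1 + conj q.1.2 ^ 2 * q.2.2)⁻¹) ((r, α), x) := by
    refine DifferentiableAt.inv ?_ h
    have := hc ((r, α), x)
    fun_prop
  have := hc ((r, α), x)
  simp only [symFormula, div_eq_mul_inv]
  fun_prop

/-- The vector field on `ℂ²` that the tangent vector `(ρ, a)` at the identity of the automorphism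
group of the disc induces. -/
theorem hasDerivAt_symFormula (ρ : ℝ) (a : ℂ) (x : ℂ × ℂ) :
    HasDerivAt (fun t : ℝ => symFormula (t * ρ) (t * a) x)
      (I * ρ * x.1 - 2 * a + conj a * (x.1 ^ 2 - 2 * x.2),
        2 * I * ρ * x.2 - a * x.1 + conj a * x.1 * x.2) 0 := by
  have he : HasDerivAt (fun τ : ℂ => cexp (τ * ρ * I)) (ρ * I) 0 := by
    have := (((hasDerivAt_id (0 : ℂ)).mul_const (ρ : ℂ)).mul_const I).cexp
    simpa using this
  have hM : HasDerivAt (fun τ : ℂ => 1 - τ * conj a * x.1 + (τ * conj a) ^ 2 * x.2)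
      (-(conj a * x.1)) 0 := by
    have := ((((hasDerivAt_id (0 : ℂ)).mul_const (conj a)).mul_const x.1).const_sub 1).add
      ((((hasDerivAt_id (0 : ℂ)).mul_const (conj a)).pow 2).mul_const x.2)
    refine this.congr_deriv ?_
    simp
  have hN1 : HasDerivAt (fun τ : ℂ => (1 + τ * conj a * (τ * a)) * x.1 - 2 * (τ * conj a) * x.2
      - 2 * (τ * a)) (-2 * conj a * x.2 - 2 * a) 0 := by
    have := ((((((hasDerivAt_id (0 : ℂ)).mul_const (conj a)).mul
      ((hasDerivAt_id (0 : ℂ)).mul_const a)).const_add 1).mul_const x.1).sub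
      ((((hasDerivAt_id (0 : ℂ)).mul_const (conj a)).const_mul 2).mul_const x.2)).sub
      (((hasDerivAt_id (0 : ℂ)).mul_const a).const_mul 2)
    refine this.congr_deriv ?_
    simp
  have hN2 : HasDerivAt (fun τ : ℂ => x.2 - τ * a * x.1 + (τ * a) ^ 2) (-(a * x.1)) 0 := by
    have := ((((hasDerivAt_id (0 : ℂ)).mul_const a).mul_const x.1).const_sub x.2).add
      (((hasDerivAt_id (0 : ℂ)).mul_const a).pow 2)
    refine this.congr_deriv ?_
    simp
  have h1 := he.mul (hN1.div hM (by simp))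
  have h2 := (he.pow 2).mul (hN2.div hM (by simp))
  have h3 := HasDerivAt.prodMk
    (HasDerivAt.comp_ofReal (z := 0) (by rw [ofReal_zero]; exact h1))
    (HasDerivAt.comp_ofReal (z := 0) (by rw [ofReal_zero]; exact h2))
  refine (h3.congr_deriv ?_).congr_of_eventuallyEq (Eventually.of_forall fun t => ?_)
  · simp
    constructor <;> ring
  · simp [symFormula]

/-- At a point `(z + w, zw)` with `z ≠ w` the action is infinitesimally free. -/
theorem symField_injective {z w : ℂ} (hz : ‖z‖ < 1) (hw : ‖w‖ < 1) (hzw : z ≠ w) {ρ : ℝ} {a : ℂ}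
    (h1 : I * ρ * (z + w) - 2 * a + conj a * ((z + w) ^ 2 - 2 * (z * w)) = 0)
    (h2 : 2 * I * ρ * (z * w) - a * (z + w) + conj a * (z + w) * (z * w) = 0) : ρ = 0 ∧ a = 0 := by
  have hzw' := sub_ne_zero.2 hzw
  -- the vector field `iρ z - a + ā z²` on the disc vanishes at both `z` and `w`
  have hvz : I * ρ * z - a + conj a * z ^ 2 = 0 := by
    refine mul_left_cancel₀ hzw' ?_
    linear_combination z * h1 - h2
  have hvw : I * ρ * w - a + conj a * w ^ 2 = 0 := by linear_combination h1 - hvz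
  have h3 : conj a * (z + w) + I * ρ = 0 := by
    refine mul_left_cancel₀ hzw' ?_
    linear_combination hvz - hvw
  have h4 : a = -(conj a * (z * w)) := by linear_combination -hvz + z * h3
  have h5 : a = 0 := by
    have : ‖a‖ = ‖a‖ * ‖z * w‖ := by
      conv_lhs => rw [h4]
      rw [norm_neg, norm_mul, RCLike.norm_conj]
    have h6 : ‖z * w‖ < 1 := by rw [norm_mul]; nlinarith [norm_nonneg z, norm_nonneg w]
    rw [← norm_eq_zero]
    nlinarith [norm_nonneg a]
  refine ⟨?_, h5⟩
  rw [h5] at h3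
  simpa using h3

theorem mfderiv_opens_injective {V : Type*} [NormedAddCommGroup V] [NormedSpace ℝ V]
    {W : Type*} [NormedAddCommGroup W] [NormedSpace ℝ W] {U : TopologicalSpace.Opens W}
    {h : V → U} {g : V → W} {v : V} {L : V →L[ℝ] W} (hL : HasFDerivAt g L v)
    (hg : ∀ᶠ y in 𝓝 v, (h y : W) = g y) (hinj : Function.Injective L) :
    MDifferentiableAt 𝓘(ℝ, V) 𝓘(ℝ, W) h v ∧ Function.Injective (mfderiv 𝓘(ℝ, V) 𝓘(ℝ, W) h v) := by
  have hd : HasFDerivAt (fun y => (h y : W)) L v := hL.congr_of_eventuallyEq hg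
  have h1 : MDifferentiableAt 𝓘(ℝ, V) 𝓘(ℝ, W) h v := by
    rw [← mdifferentiableAt_opens_iff]
    exact hd.differentiableAt.mdifferentiableAt
  refine ⟨h1, ?_⟩
  have h2 := mfderiv_comp v (mdifferentiable_opens_val (𝕜 := ℝ) U (h v)) h1
  have h3 : mfderiv 𝓘(ℝ, V) 𝓘(ℝ, W) (Subtype.val ∘ h) v = L := by
    rw [mfderiv_eq_fderiv]; exact hd.fderiv
  rw [h3] at h2
  have h4 : Function.Injective (⇑(mfderiv 𝓘(ℝ, W) 𝓘(ℝ, W) (Subtype.val : U → W) (h v)) ∘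
      ⇑(mfderiv 𝓘(ℝ, V) 𝓘(ℝ, W) h v)) := by
    intro x y hxy
    exact hinj ((DFunLike.congr_fun h2 x).trans (hxy.trans (DFunLike.congr_fun h2 y).symm))
  exact h4.of_comp

theorem exp_two_mul_artanh {p : ℝ} (h0 : 0 ≤ p) (h1 : p < 1) :
    Real.exp (2 * Real.artanh p) = (1 + p) / (1 - p) := by
  rw [two_mul, Real.exp_add, Real.exp_artanh ⟨by linarith, h1⟩, Real.mul_self_sqrt]
  exact div_nonneg (by linarith) (by linarith)

/-- An automorphism of the disc with two fixed points is the identity. -/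
theorem eq_one_of_fixes_two {m : biholAut ℂ unitDisc} {z w : unitDisc} (hzw : z ≠ w)
    (hz : m.1 z = z) (hw : m.1 w = w) : m = 1 := by
  set b := discAut 0 z
  have hb : b.1 z = discZero := discAut_zero_self z
  have hb' : b.1.symm discZero = z := by rw [Equiv.symm_apply_eq, hb]
  obtain ⟨r, hr⟩ := exists_eq_discAut_zero_right (m := b * m * b⁻¹) (by
    change b.1 (m.1 (b.1.symm discZero)) = discZero
    rw [hb', hz, hb])
  have h1 : (b * m * b⁻¹).1 (b.1 w) = b.1 w := by
    change b.1 (m.1 (b.1.symm (b.1 w))) = _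
    rw [Equiv.symm_apply_apply, hw]
  have h2 : (b.1 w : ℂ) ≠ 0 := fun h => hzw (b.1.injective (by
    rw [hb]; exact (eq_discZero_iff.2 h).symm))
  have h3 : cexp (r * I) = 1 := by
    have := congrArg (Subtype.val : unitDisc → ℂ) h1
    rw [hr, coe_discAut_zero_right] at this
    exact mul_right_cancel₀ h2 (this.trans (one_mul _).symm)
  have h4 : b * m * b⁻¹ = 1 := by
    rw [hr]
    exact discAut_ext fun y => by rw [coe_discAut_zero_right, h3, one_mul]; rfl
  rw [mul_inv_eq_one] at h4
  exact mul_eq_left.1 h4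

/-! ### The symmetrized bidisc has the required structure -/

/-- The leaf coordinate squares under rotations. -/
theorem symAutHom_leafMap_of_fixes {m : biholAut ℂ unitDisc} (hm : m.1 discZero = discZero)
    (z : unitDisc) : (symAutHom m).1 (leafMap z) = leafMap (m.1 (m.1 z)) := by
  obtain ⟨r, rfl⟩ := exists_eq_discAut_zero_right hm
  exact symAutHom_rotation_leafMap r z

theorem leafMap_discZero : leafMap discZero = royalMap discZero :=
  Subtype.ext (by rw [coe_leafMap, royalMap, coe_symPt]; simp)

theorem leafMap_eq_royalMap {z u : unitDisc} (h : leafMap z = royalMap u) :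
    u = discZero ∧ z = discZero := by
  rw [Subtype.ext_iff, coe_leafMap, royalMap, coe_symPt, Prod.mk.injEq] at h
  have h1 : (u : ℂ) = 0 := by linear_combination (-1 / 2) * h.1
  exact ⟨eq_discZero_iff.2 h1, eq_discZero_iff.2 (by rw [h.2, h1, mul_zero])⟩

theorem mdifferentiable_royalMap : MDifferentiable 𝓘(ℂ, ℂ) 𝓘(ℂ, ℂ × ℂ) royalMap := by
  intro z
  rw [← mdifferentiableAt_opens_iff]
  have h : DifferentiableAt ℂ (fun z : ℂ => ((z + z : ℂ), z * z)) z := by fun_prop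
  exact MDifferentiableAt.comp (f := (Subtype.val : unitDisc → _)) z h.mdifferentiableAt
    (mdifferentiable_opens_val unitDisc z)

theorem mdifferentiable_leafMap : MDifferentiable 𝓘(ℂ, ℂ) 𝓘(ℂ, ℂ × ℂ) leafMap := by
  intro z
  rw [← mdifferentiableAt_opens_iff]
  have h : DifferentiableAt ℂ (fun z : ℂ => ((0 : ℂ), z)) z := by fun_prop
  exact MDifferentiableAt.comp (f := (Subtype.val : unitDisc → _)) z h.mdifferentiableAt
    (mdifferentiable_opens_val unitDisc z)

/-- The holomorphic retraction `(s, p) ↦ s / 2` of the symmetrized bidisc onto its royal disc. -/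
def royalRetract (x : symBidisc) : unitDisc :=
  ⟨(x : ℂ × ℂ).1 / 2, mem_unitDisc.2 (by
    rw [norm_div, Complex.norm_ofNat, div_lt_one two_pos]; exact norm_fst_lt_two x.2)⟩

/-- The holomorphic retraction `(s, p) ↦ p` of the symmetrized bidisc onto the leaf `{(0, z)}`. -/
def leafRetract (x : symBidisc) : unitDisc :=
  ⟨(x : ℂ × ℂ).2, mem_unitDisc.2 (norm_snd_lt_one x.2)⟩

theorem mdifferentiable_royalRetract : MDifferentiable 𝓘(ℂ, ℂ × ℂ) 𝓘(ℂ, ℂ) royalRetract := by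
  intro z
  rw [← mdifferentiableAt_opens_iff]
  have h : DifferentiableAt ℂ (fun x : ℂ × ℂ => x.1 / 2) z := by fun_prop
  exact MDifferentiableAt.comp (f := (Subtype.val : symBidisc → _)) z h.mdifferentiableAt
    (mdifferentiable_opens_val symBidisc z)

theorem mdifferentiable_leafRetract : MDifferentiable 𝓘(ℂ, ℂ × ℂ) 𝓘(ℂ, ℂ) leafRetract := by
  intro z
  rw [← mdifferentiableAt_opens_iff]
  have h : DifferentiableAt ℂ (fun x : ℂ × ℂ => x.2) z := by fun_prop
  exact MDifferentiableAt.comp (f := (Subtype.val : symBidisc → _)) z h.mdifferentiableAt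
    (mdifferentiable_opens_val symBidisc z)

section Forward

variable {E : Type*} [NormedAddCommGroup E] [NormedSpace ℂ E]
  {Ω : Type*} [TopologicalSpace Ω] [ChartedSpace E Ω]

/-- Conjugation by a biholomorphic map is an isomorphism of the automorphism groups. -/
def biholConj (Λ : symBidisc ≃ Ω) (h : MDifferentiable 𝓘(ℂ, ℂ × ℂ) 𝓘(ℂ, E) Λ)
    (h' : MDifferentiable 𝓘(ℂ, E) 𝓘(ℂ, ℂ × ℂ) Λ.symm) :
    biholAut (ℂ × ℂ) symBidisc ≃* biholAut E Ω where
  toFun θ := ⟨(Λ.symm.trans θ.1).trans Λ,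
    MDifferentiable.comp (g := Λ) h (MDifferentiable.comp (g := θ.1) θ.2.1 h'),
    MDifferentiable.comp (g := Λ) h (MDifferentiable.comp (g := θ.1.symm) θ.2.2 h')⟩
  invFun θ := ⟨(Λ.trans θ.1).trans Λ.symm,
    MDifferentiable.comp (g := Λ.symm) h' (MDifferentiable.comp (g := θ.1) θ.2.1 h),
    MDifferentiable.comp (g := Λ.symm) h' (MDifferentiable.comp (g := θ.1.symm) θ.2.2 h)⟩
  left_inv θ := Subtype.ext (Equiv.ext fun x => by simp)
  right_inv θ := Subtype.ext (Equiv.ext fun x => by simp)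
  map_mul' θ₁ θ₂ := Subtype.ext (Equiv.ext fun x => by
    simp only [Equiv.trans_apply, Subgroup.coe_mul, Equiv.Perm.coe_mul, Function.comp_apply,
      Equiv.symm_apply_apply])

/-- The family of the images of the leaf `f` under the group, indexed by the points of `D`. -/
def leafFamily {D : Set Ω} (Θ : biholAut ℂ unitDisc ≃* biholAut E Ω) (d f : unitDisc → Ω) (x : D) :
    Set Ω :=
  {y | ∃ (m : biholAut ℂ unitDisc) (z : unitDisc), (Θ m).1 (d discZero) = x ∧ (Θ m).1 (f z) = y}

theorem IsConcomitantPair.isRoyalDisc [IsManifold 𝓘(ℂ, E) ω Ω] {D : Set Ω} {d : unitDisc → Ω}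
    {Θ : biholAut ℂ unitDisc ≃* biholAut E Ω} (hd : IsConcomitantPair E D d Θ) : IsRoyalDisc E D where
  isDisc := ⟨d, hd.1⟩
  invariant θ := by
    obtain ⟨m, rfl⟩ := Θ.surjective θ
    rw [← hd.1.2, ← range_comp]
    have : (Θ m).1 ∘ d = d ∘ m.1 := funext fun z => hd.2 m z
    rw [this, range_comp, m.1.range_eq_univ, image_univ]
  determined θ₁ θ₂ heq := by
    obtain ⟨m, rfl⟩ := Θ.surjective θ₁
    obtain ⟨n, rfl⟩ := Θ.surjective θ₂
    congr 1
    refine Subtype.ext (Equiv.ext fun z => hd.1.1.injective ?_)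
    rw [← hd.2, ← hd.2]
    exact heq (by rw [← hd.1.2]; exact mem_range_self z)
  extends_aut σ := by
    rintro ⟨d', hd', m, hσ⟩
    obtain ⟨b, rfl⟩ := hd.1.exists_discAut hd'
    refine ⟨Θ (b * m * b⁻¹), fun x => ?_⟩
    obtain ⟨z, hz⟩ : (x : Ω) ∈ range (d ∘ b.1) := by rw [hd'.2]; exact x.2
    rw [hσ z x hz.symm, ← hz]
    exact (hd.conj b).2 m z

variable {Λ : symBidisc ≃ Ω}
  (h : MDifferentiable 𝓘(ℂ, ℂ × ℂ) 𝓘(ℂ, E) Λ) (h' : MDifferentiable 𝓘(ℂ, E) 𝓘(ℂ, ℂ × ℂ) Λ.symm)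

theorem symAut_conj_apply (m : biholAut ℂ unitDisc) (x : symBidisc) :
    ((symAut.trans (biholConj Λ h h')) m).1 (Λ x) = Λ ((symAutHom m).1 x) := by
  change Λ ((symAutHom m).1 (Λ.symm (Λ x))) = _
  rw [Equiv.symm_apply_apply]

/-- The family of leaves over `d m(0)` is the image of the leaf `f` under `m`. -/
theorem leafFamily_eq {m : biholAut ℂ unitDisc} {x : range (Λ ∘ royalMap)}
    (hx : ((symAut.trans (biholConj Λ h h')) m).1 ((Λ ∘ royalMap) discZero) = x) :
    leafFamily (symAut.trans (biholConj Λ h h')) (Λ ∘ royalMap) (Λ ∘ leafMap) x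
      = range (((symAut.trans (biholConj Λ h h')) m).1 ∘ Λ ∘ leafMap) := by
  ext y
  constructor
  · rintro ⟨n, z, hn, rfl⟩
    have hfix : (m⁻¹ * n).1 discZero = discZero := by
      rw [← hx] at hn
      simp only [Function.comp_apply, symAut_conj_apply, symAutHom_royalMap] at hn
      have := royalMap_injective (Λ.injective hn)
      change m.1.symm (n.1 discZero) = _
      rw [Equiv.symm_apply_eq, this]
    refine ⟨(m⁻¹ * n).1 ((m⁻¹ * n).1 z), ?_⟩
    simp only [Function.comp_apply, symAut_conj_apply]
    rw [← symAutHom_leafMap_of_fixes hfix]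
    congr 1
    change ((symAutHom m) * (symAutHom (m⁻¹ * n))).1 _ = _
    rw [← map_mul, mul_inv_cancel_left]
  · rintro ⟨z, rfl⟩
    exact ⟨m, z, hx, rfl⟩

theorem exists_over (x : range (Λ ∘ royalMap)) : ∃ m : biholAut ℂ unitDisc,
    ((symAut.trans (biholConj Λ h h')) m).1 ((Λ ∘ royalMap) discZero) = x := by
  obtain ⟨_, z, rfl⟩ := x
  refine ⟨discAut 0 (-z), ?_⟩
  simp only [Function.comp_apply]
  rw [symAut_conj_apply, symAutHom_royalMap, discAut_neg_apply_discZero]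

variable [T2Space Ω]

theorem isConcomitantPair_of_biholomorphic :
    IsConcomitantPair E (range (Λ ∘ royalMap)) (Λ ∘ royalMap) (symAut.trans (biholConj Λ h h')) := by
  refine ⟨⟨isProperEmbedding_of_leftInverse (g := royalRetract ∘ Λ.symm)
    (h.comp mdifferentiable_royalMap) (mdifferentiable_royalRetract.comp h') fun z => ?_, rfl⟩,
    fun m z => ?_⟩
  · refine Subtype.ext ?_
    simp only [Function.comp_apply, Equiv.symm_apply_apply, royalRetract, royalMap, coe_symPt]
    ring
  · simp only [Function.comp_apply]
    rw [symAut_conj_apply, symAutHom_royalMap]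

theorem isProperEmbedding_leaf (h : MDifferentiable 𝓘(ℂ, ℂ × ℂ) 𝓘(ℂ, E) Λ)
    (h' : MDifferentiable 𝓘(ℂ, E) 𝓘(ℂ, ℂ × ℂ) Λ.symm) : IsProperEmbedding E (Λ ∘ leafMap) := by
  refine isProperEmbedding_of_leftInverse (g := leafRetract ∘ Λ.symm)
    (h.comp mdifferentiable_leafMap) (mdifferentiable_leafRetract.comp h') fun z => ?_
  refine Subtype.ext ?_
  simp only [Function.comp_apply, Equiv.symm_apply_apply, leafRetract, coe_leafMap]

theorem isFlatFibration_of_biholomorphic : IsFlatFibration E (range (Λ ∘ royalMap))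
    (leafFamily (symAut.trans (biholConj Λ h h')) (Λ ∘ royalMap) (Λ ∘ leafMap)) where
  isDisc x := by
    obtain ⟨m, hm⟩ := exists_over h h' x
    exact ⟨_, (isProperEmbedding_leaf h h').biholAut_comp _, (leafFamily_eq h h' hm).symm⟩
  inter_eq x := by
    obtain ⟨m, hm⟩ := exists_over h h' x
    rw [leafFamily_eq h h' hm]
    refine Subset.antisymm ?_ ?_
    · rintro _ ⟨⟨z, rfl⟩, u, hu⟩
      simp only [Function.comp_apply] at hu
      rw [symAut_conj_apply] at hu
      have h1 := Λ.injective hu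
      have h2 : leafMap z = royalMap (m.1.symm u) := by
        have h3 := symAutHom_royalMap m (m.1.symm u)
        rw [Equiv.apply_symm_apply, h1] at h3
        exact ((symAutHom m).1.injective h3).symm
      rw [mem_singleton_iff, ← hm]
      simp only [Function.comp_apply]
      rw [(leafMap_eq_royalMap h2).2, leafMap_discZero]
    · rintro _ rfl
      refine ⟨⟨discZero, ?_⟩, x.2⟩
      rw [← hm]
      simp only [Function.comp_apply]
      rw [leafMap_discZero]
  disjoint x y hxy := by
    rw [Set.disjoint_left]
    rintro _ ⟨m, z, hm, rfl⟩ ⟨n, w, hn, heq⟩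
    refine hxy (Subtype.ext ?_)
    simp only [Function.comp_apply] at hm hn heq
    rw [symAut_conj_apply] at hm hn heq
    rw [symAut_conj_apply] at heq
    have h1 : (symAutHom (m⁻¹ * n)).1 (leafMap w) = leafMap z := by
      rw [map_mul, map_inv]
      change (symAutHom m).1.symm ((symAutHom n).1 (leafMap w)) = _
      rw [Equiv.symm_apply_eq, Λ.injective heq]
    have h2 : m.1.symm (n.1 discZero) = discZero := fixes_discZero_of_leafMap h1
    rw [Equiv.symm_apply_eq] at h2
    rw [← hm, ← hn, symAutHom_royalMap, symAutHom_royalMap, h2]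
  cover := by
    refine eq_univ_of_forall fun y => mem_iUnion.2 ?_
    have hy := eq_symAutHom_leafMap (Λ.symm y)
    set m := discAut 0 (-midpt (Λ.symm y))
    refine ⟨⟨Λ ((symAutHom m).1 (royalMap discZero)), m.1 discZero, by
      rw [symAutHom_royalMap]; rfl⟩, m,
      ⟨leafCoord (Λ.symm y), mem_unitDisc.2 (norm_leafCoord_lt_one (Λ.symm y).2)⟩,
      symAut_conj_apply h h' m _, ?_⟩
    simp only [Function.comp_apply]
    rw [symAut_conj_apply, ← hy, Equiv.apply_symm_apply]
  equivariant θ x y hθ := by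
    obtain ⟨n, rfl⟩ := (symAut.trans (biholConj Λ h h')).surjective θ
    obtain ⟨m, hm⟩ := exists_over h h' x
    rw [leafFamily_eq h h' hm, leafFamily_eq h h' (m := n * m), ← range_comp, map_mul]
    · rfl
    · rw [map_mul, ← hθ, ← hm]; rfl

theorem isSynchronous_of_biholomorphic : IsSynchronous E (range (Λ ∘ royalMap))
    (leafFamily (symAut.trans (biholConj Λ h h')) (Λ ∘ royalMap) (Λ ∘ leafMap)) := by
  refine ⟨_, _, isConcomitantPair_of_biholomorphic h h', fun x z₀ hx => ?_⟩
  set b := discAut 0 (-z₀) with hb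
  have hb0 : b.1 discZero = z₀ := discAut_neg_apply_discZero z₀
  have hb0' : b.1.symm z₀ = discZero := by rw [Equiv.symm_apply_eq, hb0]
  have hbx : ((symAut.trans (biholConj Λ h h')) b).1 ((Λ ∘ royalMap) discZero) = x := by
    rw [hx, (isConcomitantPair_of_biholomorphic h h').2, hb0]
  refine ⟨((symAut.trans (biholConj Λ h h')) b).1 ∘ (Λ ∘ leafMap) ∘ b⁻¹.1, ⟨?_, ?_⟩, ?_, ?_⟩
  · exact ((isProperEmbedding_leaf h h').comp_discAut b⁻¹).biholAut_comp _
  · rw [leafFamily_eq h h' hbx, range_comp, range_comp (Λ ∘ leafMap), b⁻¹.1.range_eq_univ,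
      image_univ, ← range_comp]
  · rw [← hbx]
    change ((symAut.trans (biholConj Λ h h')) b).1 (Λ (leafMap (b.1.symm z₀))) = _
    rw [hb0', leafMap_discZero]
    rfl
  · intro m hm z
    have hfix : (b⁻¹ * m * b).1 discZero = discZero := by
      change b.1.symm (m.1 (b.1 discZero)) = _
      rw [hb0, hm, hb0']
    change ((symAut.trans (biholConj Λ h h')) m).1 (((symAut.trans (biholConj Λ h h')) b).1
      (Λ (leafMap (b.1.symm z)))) = ((symAut.trans (biholConj Λ h h')) b).1
        (Λ (leafMap (b.1.symm (m.1 (m.1 z)))))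
    rw [symAut_conj_apply, symAut_conj_apply, symAut_conj_apply]
    have h1 := symAutHom_leafMap_of_fixes hfix (b.1.symm z)
    have h2 : (b⁻¹ * m * b).1 ((b⁻¹ * m * b).1 (b.1.symm z)) = b.1.symm (m.1 (m.1 z)) := by
      change b.1.symm (m.1 (b.1 (b.1.symm (m.1 (b.1 (b.1.symm z)))))) = _
      rw [Equiv.apply_symm_apply, Equiv.apply_symm_apply]
    rw [h2] at h1
    rw [← h1]
    congr 1
    change (symAutHom m * symAutHom b).1 _ = (symAutHom b * symAutHom (b⁻¹ * m * b)).1 _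
    rw [← map_mul, ← map_mul, mul_assoc b⁻¹, mul_inv_cancel_left]

theorem isRegularRoyal_of_biholomorphic (h : MDifferentiable 𝓘(ℂ, ℂ × ℂ) 𝓘(ℂ, E) Λ)
    (h' : MDifferentiable 𝓘(ℂ, E) 𝓘(ℂ, ℂ × ℂ) Λ.symm) : IsRegularRoyal E (range (Λ ∘ royalMap)) := by
  refine ⟨_, _, isConcomitantPair_of_biholomorphic h h', ?_, ?_, ?_⟩
  · rintro ⟨⟨r, α⟩, x⟩ hα
    replace hα : ‖α‖ < 1 := hα
    refine MDifferentiableAt.mdifferentiableWithinAt ?_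
    refine MDifferentiableAt.comp (I' := 𝓘(ℝ, ℂ × ℂ)) (g := Λ)
      (f := fun q : (ℝ × ℂ) × Ω => (symAutHom (discAut q.1.1 q.1.2)).1 (Λ.symm q.2))
      ((r, α), x) (h _).real_of_complex ?_
    rw [← mdifferentiableAt_opens_iff]
    have h1 := (differentiableAt_symFormula (r := r) hα (Λ.symm x).2).mdifferentiableAt
    have h2 : MDifferentiableAt (𝓘(ℝ, ℝ × ℂ).prod 𝓘(ℝ, E)) 𝓘(ℝ, (ℝ × ℂ) × (ℂ × ℂ))
        (fun q : (ℝ × ℂ) × Ω => (q.1, (Λ.symm q.2 : ℂ × ℂ))) ((r, α), x) := by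
      refine MDifferentiableAt.prodMk_space mdifferentiableAt_fst ?_
      refine (mdifferentiableAt_opens_iff symBidisc _ _).2 ?_
      exact MDifferentiableAt.comp (g := Λ.symm) ((r, α), x) (h' x).real_of_complex
        mdifferentiableAt_snd
    have h3 := MDifferentiableAt.comp ((r, α), x) h1 h2
    refine h3.congr_of_eventuallyEq ?_
    have h4 : ∀ᶠ q : (ℝ × ℂ) × Ω in 𝓝 ((r, α), x), ‖q.1.2‖ < 1 :=
      (isOpen_lt (by fun_prop) continuous_const).mem_nhds hα
    filter_upwards [h4] with q hq
    exact coe_symAutHom_discAut _ hq _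
  · intro x hx
    obtain ⟨y, rfl⟩ := Λ.surjective x
    obtain ⟨z, w, rfl⟩ := exists_symPt y
    have hzw : z ≠ w := by rintro rfl; exact hx ⟨z, rfl⟩
    have hsub : ∀ a b : unitDisc, a ≠ b →
        {m : biholAut ℂ unitDisc | m.1 z = a ∧ m.1 w = b}.Subsingleton := by
      intro a b _ m hm n hn
      have := eq_one_of_fixes_two (m := m⁻¹ * n) hzw
        (by change m.1.symm (n.1 z) = z; rw [hn.1, ← hm.1, Equiv.symm_apply_apply])
        (by change m.1.symm (n.1 w) = w; rw [hn.2, ← hm.2, Equiv.symm_apply_apply])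
      exact inv_mul_eq_one.1 this
    refine (((hsub z w hzw).finite.union (hsub w z hzw.symm).finite).image
      (symAut.trans (biholConj Λ h h'))).subset fun θ hθ => ?_
    obtain ⟨m, rfl⟩ := (symAut.trans (biholConj Λ h h')).surjective θ
    refine ⟨m, ?_, rfl⟩
    rw [mem_ofPred_eq, symAut_conj_apply, symAutHom_symPt] at hθ
    exact symPt_eq_symPt.1 (Λ.injective hθ)
  · intro x hx
    obtain ⟨y, rfl⟩ := Λ.surjective x
    have h0 : (fun q : ℝ × ℂ => ((symAut.trans (biholConj Λ h h')) (discAut q.1 q.2)).1 (Λ y))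
        = Λ ∘ fun q => (symAutHom (discAut q.1 q.2)).1 y := funext fun q => symAut_conj_apply h h' _ _
    rw [h0]
    have hd : DifferentiableAt ℝ (fun q : ℝ × ℂ => symFormula q.1 q.2 y) (0, 0) := by
      have h1 := differentiableAt_symFormula (r := 0) (α := 0) (by simp) y.2
      exact DifferentiableAt.comp (0, 0) (f := fun q : ℝ × ℂ => (q, (y : ℂ × ℂ))) h1 (by fun_prop)
    have hinj : Function.Injective (fderiv ℝ (fun q : ℝ × ℂ => symFormula q.1 q.2 y) (0, 0)) := by
      rw [injective_iff_map_eq_zero]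
      rintro ⟨ρ, a⟩ h0
      have h1 : HasDerivAt (fun t : ℝ => t • ((ρ, a) : ℝ × ℂ)) (ρ, a) 0 := by
        simpa using (hasDerivAt_id (0 : ℝ)).smul_const ((ρ, a) : ℝ × ℂ)
      have h2 := HasFDerivAt.comp_hasDerivAt_of_eq (0 : ℝ) hd.hasFDerivAt h1 (by simp)
      rw [h0] at h2
      have h3 := hasDerivAt_symFormula ρ a y
      have h4 := h2.unique (h3.congr_of_eventuallyEq (Eventually.of_forall fun t => by simp))
      obtain ⟨z, w, rfl⟩ := exists_symPt y
      have hzw : z ≠ w := by rintro rfl; exact hx ⟨z, rfl⟩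
      rw [coe_symPt, Prod.ext_iff] at h4
      have := symField_injective (norm_coe_lt_one z) (norm_coe_lt_one w)
        (fun h => hzw (Subtype.ext h)) h4.1.symm h4.2.symm
      exact Prod.ext this.1 this.2
    have h1 := mfderiv_opens_injective (h := fun q : ℝ × ℂ => (symAutHom (discAut q.1 q.2)).1 y)
      hd.hasFDerivAt (by
        have h4 : ∀ᶠ q : ℝ × ℂ in 𝓝 (0, 0), ‖q.2‖ < 1 :=
          (isOpen_lt (by fun_prop) continuous_const).mem_nhds (by simp)
        filter_upwards [h4] with q hq using coe_symAutHom_discAut _ hq _) hinj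
    have h2 := mfderiv_comp (0, 0) (I' := 𝓘(ℝ, ℂ × ℂ)) (g := Λ) (h _).real_of_complex h1.1
    rw [h2]
    exact (mfderiv_injective_of_leftInverse (h _).real_of_complex (h' _).real_of_complex
      (Eventually.of_forall Λ.symm_apply_apply)).comp h1.2

variable [IsManifold 𝓘(ℂ, E) ω Ω]

theorem actsSharply_of_biholomorphic : ActsSharply E (range (Λ ∘ royalMap))
    (leafFamily (symAut.trans (biholConj Λ h h')) (Λ ∘ royalMap) (Λ ∘ leafMap)) := by
  intro x hx
  -- move `x` to a point `(0, p)` with `0 < p < 1`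
  obtain ⟨n, p, hp0, hp1, hxn⟩ : ∃ (n : biholAut ℂ unitDisc) (p : ℝ) (hp0 : 0 < p) (hp1 : ‖(p : ℂ)‖ < 1),
      x = Λ ((symAutHom n).1 (leafMap ⟨p, mem_unitDisc.2 hp1⟩)) := by
    have hy := eq_symAutHom_leafMap (Λ.symm x)
    set m := discAut 0 (-midpt (Λ.symm x))
    set ζ : unitDisc := ⟨leafCoord (Λ.symm x), mem_unitDisc.2 (norm_leafCoord_lt_one (Λ.symm x).2)⟩
    have hζ : (ζ : ℂ) ≠ 0 := fun h0 => hx ⟨m.1 discZero, by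
      rw [Function.comp_apply, ← symAutHom_royalMap, ← leafMap_discZero, ← eq_discZero_iff.2 h0, ← hy,
        Equiv.apply_symm_apply]⟩
    have hn : ‖((‖(ζ : ℂ)‖ : ℝ) : ℂ)‖ < 1 := by
      rw [norm_real, norm_norm]; exact norm_coe_lt_one ζ
    refine ⟨m * discAut (arg ζ / 2) 0, ‖(ζ : ℂ)‖, norm_pos_iff.2 hζ, hn, ?_⟩
    rw [map_mul]
    change x = Λ ((symAutHom m).1 ((symAutHom (discAut (arg ζ / 2) 0)).1 _))
    rw [symAutHom_rotation_leafMap]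
    have : (discAut (arg ζ / 2) 0).1 ((discAut (arg ζ / 2) 0).1
        ⟨((‖(ζ : ℂ)‖ : ℝ) : ℂ), mem_unitDisc.2 hn⟩) = ζ := by
      refine Subtype.ext ?_
      rw [coe_discAut_zero_right, coe_discAut_zero_right, ← mul_assoc, ← Complex.exp_add]
      have h1 := Complex.norm_mul_exp_arg_mul_I (ζ : ℂ)
      rw [mul_comm] at h1
      conv_rhs => rw [← h1]
      congr 2
      push_cast
      ring
    rw [this, ← hy, Equiv.apply_symm_apply]
  set z : unitDisc := ⟨p, mem_unitDisc.2 hp1⟩ with hz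
  have hp1' : p < 1 := by rwa [norm_real, Real.norm_of_nonneg hp0.le] at hp1
  have hconc := isConcomitantPair_of_biholomorphic h h'
  set Θ := symAut.trans (biholConj Λ h h') with hΘ
  refine ⟨_, _, hconc.conj n, Real.artanh p, ?_, ?_⟩
  · have hover : (Θ n).1 ((Λ ∘ royalMap) discZero) = Λ (royalMap (n.1 discZero)) := hconc.2 n discZero
    refine ⟨⟨Λ (royalMap (n.1 discZero)), _, rfl⟩, (Θ n).1 ∘ Λ ∘ leafMap, discZero, z,
      ⟨(isProperEmbedding_leaf h h').biholAut_comp _, (leafFamily_eq h h' hover).symm⟩, ?_, ?_, ?_⟩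
    · refine Eq.trans ?_ hover
      simp only [Function.comp_apply, leafMap_discZero]
    · rw [hxn]; exact symAut_conj_apply h h' n _
    · simp [hz, abs_of_pos hp0]
  · have hM : IsManifold 𝓘(ℂ, E) 1 Ω := isManifold_one_complex
    -- the action near `x` in coordinates
    set H : symBidisc → Ω := fun y => Λ ((symAutHom n).1 y) with hH
    have hHd : MDifferentiable 𝓘(ℂ, ℂ × ℂ) 𝓘(ℂ, E) H := h.comp (symAutHom n).2.1
    have hHx : H (leafMap z) = x := hxn.symm
    set G : ℂ × ℂ → E := fun v => chartAt E x (H (toOpens symBidisc (leafMap z) v)) with hG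
    have hGd : DifferentiableAt ℂ G (leafMap z : ℂ × ℂ) :=
      ((hHd _).comp_toOpens (leafMap z).2).differentiableAt_chart (by
        rw [toOpens_coe, hHx]; exact mem_chart_source E x)
    set T := fderiv ℂ G (leafMap z : ℂ × ℂ)
    have hcurve : ∀ a : ℂ, HasDerivAt (fun t : ℝ => chartAt E x
        (((MulAut.conj n).trans Θ (discAut 0 (a * t))).1 x)) (T (-2 * a - 2 * conj a * p, 0)) 0 := by
      intro a
      have h1 := hasDerivAt_symFormula 0 a (leafMap z)
      have h2 := HasFDerivAt.comp_hasDerivAt_of_eq (0 : ℝ) (hGd.hasFDerivAt.restrictScalars ℝ) h1 (by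
        simp [symFormula, coe_leafMap])
      refine (h2.congr_deriv ?_).congr_of_eventuallyEq ?_
      · simp only [coe_leafMap, hz]
        change T _ = T _
        congr 1
        refine Prod.ext ?_ ?_ <;> simp
        ring
      · have h3 : ∀ᶠ t : ℝ in 𝓝 0, ‖(a * t : ℂ)‖ < 1 :=
          (isOpen_lt (by fun_prop) continuous_const).mem_nhds (by simp)
        filter_upwards [h3] with t ht
        have h4 : ((MulAut.conj n).trans Θ (discAut 0 (a * t))).1 x
            = H ((symAutHom (discAut 0 (a * t))).1 (leafMap z)) := by
          rw [← hHx]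
          change (Θ (n * discAut 0 (a * t) * n⁻¹)).1 (Λ _) = _
          rw [symAut_conj_apply]
          simp only [hH]
          congr 1
          change (symAutHom (n * discAut 0 (a * t) * n⁻¹) * symAutHom n).1 _
            = (symAutHom n * symAutHom (discAut 0 (a * t))).1 _
          rw [← map_mul, ← map_mul, inv_mul_cancel_right]
        have h5 : symFormula (t * 0) (t * a) (leafMap z : ℂ × ℂ)
            = ((symAutHom (discAut 0 (a * t))).1 (leafMap z) : ℂ × ℂ) := by
          rw [coe_symAutHom_discAut 0 ht, mul_zero, mul_comm]
        rw [Function.comp_apply, h4, h5, hG]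
        simp only [toOpens_coe]
    have hd1 := hcurve 1
    have hdI := hcurve I
    simp only [one_mul] at hd1
    have h6 := ((hdI.sub_const (chartAt E x x)).const_smul
        ((Real.exp (2 * Real.artanh p) : ℝ) : ℂ)).sub
      ((hd1.sub_const (chartAt E x x)).const_smul I)
    have h7 : ((Real.exp (2 * Real.artanh p) : ℝ) : ℂ) • T (-2 * I - 2 * conj I * p, 0)
        - I • T (-2 * 1 - 2 * conj 1 * p, 0) = 0 := by
      rw [← map_smul, ← map_smul, ← map_sub, exp_two_mul_artanh hp0.le hp1']
      have h8 : (1 - p : ℂ) ≠ 0 := by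
        have : 1 - p ≠ 0 := by linarith
        exact_mod_cast this
      convert map_zero T using 2
      refine Prod.ext ?_ ?_
      · simp only [Prod.smul_mk, smul_eq_mul, conj_I, map_one, Prod.fst_sub, Prod.fst_zero]
        push_cast
        field_simp
        ring
      · simp
    rw [h7] at h6
    have h8 := hasDerivAt_iff_isLittleO.1 h6
    simpa using h8

end Forward

/-! ### The action along a leaf -/

section Leaf

variable {E : Type*} [NormedAddCommGroup E] [NormedSpace ℂ E]
  {Ω : Type*} [TopologicalSpace Ω] [ChartedSpace E Ω]

/-- The structure of a synchronous regular fibered royal manifold, reduced to one leaf: `(d, Θ)` is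
a concomitant pair for which the action is differentiable and infinitesimally free off `D`, and `f`
is a synchronous parametrization of the leaf through `d 0`, whose translates partition `Ω`. -/
structure IsLeafModel (D : Set Ω) (d f : unitDisc → Ω)
    (Θ : biholAut ℂ unitDisc ≃* biholAut E Ω) : Prop where
  pair : IsConcomitantPair E D d Θ
  smooth : MDifferentiableOn (𝓘(ℝ, ℝ × ℂ).prod 𝓘(ℝ, E)) 𝓘(ℝ, E)
    (fun q : (ℝ × ℂ) × Ω => (Θ (discAut q.1.1 q.1.2)).1 q.2) {q | ‖q.1.2‖ < 1}
  free : ∀ x ∉ D, Function.Injective (mfderiv 𝓘(ℝ, ℝ × ℂ) 𝓘(ℝ, E)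
      (fun q : ℝ × ℂ => (Θ (discAut q.1 q.2)).1 x) (0, 0))
  leaf : IsProperEmbedding E f
  base : f discZero = d discZero
  inter : ∀ z, f z ∈ D → z = discZero
  sync : ∀ m : biholAut ℂ unitDisc, m.1 discZero = discZero → ∀ z, (Θ m).1 (f z) = f (m.1 (m.1 z))
  disjoint : ∀ (m : biholAut ℂ unitDisc) (z w : unitDisc), (Θ m).1 (f z) = f w →
    m.1 discZero = discZero
  cover : ∀ x, ∃ (m : biholAut ℂ unitDisc) (z : unitDisc), (Θ m).1 (f z) = x

theorem pow_discAut_same_direction {a : ℂ} (ha : ‖a‖ = 1) {t : ℝ} (ht : 0 ≤ t) (k : ℕ) (hk : k * t < 1) :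
    ∃ s : ℝ, 0 ≤ s ∧ s ≤ k * t ∧ discAut 0 (t * a) ^ k = discAut 0 (s * a) := by
  induction k with
  | zero => exact ⟨0, le_rfl, by simp, by simp⟩
  | succ k ih =>
    push_cast at hk
    have hk0 : (0 : ℝ) ≤ k * t := by positivity
    obtain ⟨s, hs0, hs1, hs⟩ := ih (by nlinarith)
    have hst : 0 ≤ s * t := mul_nonneg hs0 ht
    refine ⟨(s + t) / (1 + s * t), by positivity, ?_, ?_⟩
    · rw [div_le_iff₀ (by positivity)]
      push_cast
      nlinarith
    · rw [pow_succ, hs, discAut_mul_discAut_same_direction ha]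
      · rw [abs_of_nonneg hs0]; nlinarith
      · rw [abs_of_nonneg ht]; nlinarith

/-- If all the iterates of a map up to the `n`-th are close to the identity in the Lipschitz sense,
then the displacement of the map is at most about `1 / n` of that of the `n`-th iterate. -/
theorem displacement_le_of_iterates {n : ℕ} {φ : ℕ → E → E} {y : E} (h0 : φ 0 y = y)
    (hs : ∀ k < n, φ (k + 1) y = φ k (φ 1 y))
    (hl : ∀ k < n, ‖(φ k (φ 1 y) - φ 1 y) - (φ k y - y)‖ ≤ 1 / 4 * ‖φ 1 y - y‖) :
    n * ‖φ 1 y - y‖ ≤ 2 * ‖φ n y - y‖ := by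
  have key : ∀ k ≤ n, ‖φ k y - y - (k : ℝ) • (φ 1 y - y)‖ ≤ k * (1 / 4 * ‖φ 1 y - y‖) := by
    intro k hk
    induction k with
    | zero => simp [h0]
    | succ k ih =>
      have e : φ (k + 1) y - y - ((k + 1 : ℕ) : ℝ) • (φ 1 y - y)
          = ((φ k (φ 1 y) - φ 1 y) - (φ k y - y)) + (φ k y - y - (k : ℝ) • (φ 1 y - y)) := by
        rw [hs k hk]
        push_cast
        module
      rw [e]
      refine (norm_add_le _ _).trans ?_
      push_cast
      linarith [hl k hk, ih (by omega)]
  have h1 := key n le_rfl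
  have h2 : ‖(n : ℝ) • (φ 1 y - y)‖ = n * ‖φ 1 y - y‖ := by
    rw [norm_smul, Real.norm_natCast]
  have h3 := norm_sub_norm_le ((n : ℝ) • (φ 1 y - y)) (φ n y - y)
  rw [h2, norm_sub_rev ((n : ℝ) • (φ 1 y - y))] at h3
  have h4 : 0 ≤ (n : ℝ) * ‖φ 1 y - y‖ := by positivity
  linarith

variable {D : Set Ω} {d f : unitDisc → Ω} {Θ : biholAut ℂ unitDisc ≃* biholAut E Ω}

theorem IsLeafModel.mdifferentiableAt_action (H : IsLeafModel D d f Θ) {r : ℝ} {α : ℂ} (hα : ‖α‖ < 1)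
    (x : Ω) : MDifferentiableAt (𝓘(ℝ, ℝ × ℂ).prod 𝓘(ℝ, E)) 𝓘(ℝ, E)
    (fun q : (ℝ × ℂ) × Ω => (Θ (discAut q.1.1 q.1.2)).1 q.2) ((r, α), x) :=
  (H.smooth ((r, α), x) hα).mdifferentiableAt
    ((isOpen_lt (by fun_prop) continuous_const).mem_nhds hα)

theorem IsLeafModel.mdifferentiableAt_orbit (H : IsLeafModel D d f Θ) (x : Ω) :
    MDifferentiableAt 𝓘(ℝ, ℝ × ℂ) 𝓘(ℝ, E) (fun q : ℝ × ℂ => (Θ (discAut q.1 q.2)).1 x) (0, 0) :=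
  MDifferentiableAt.comp (g := fun q : (ℝ × ℂ) × Ω => (Θ (discAut q.1.1 q.1.2)).1 q.2)
    (f := fun q : ℝ × ℂ => (q, x)) (0, 0) (H.mdifferentiableAt_action (by simp) x)
    (mdifferentiableAt_id.prodMk mdifferentiableAt_const)

/-- The derivative at the identity of the orbit map of `x`, in the chart at `x₀`. -/
def orbitDeriv (Θ : biholAut ℂ unitDisc ≃* biholAut E Ω) (x₀ x : Ω) : ℝ × ℂ →L[ℝ] E :=
  fderiv ℝ (fun q : ℝ × ℂ => chartAt E x₀ ((Θ (discAut q.1 q.2)).1 x)) (0, 0)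

theorem map_discAut_zero (Θ : biholAut ℂ unitDisc ≃* biholAut E Ω) (x : Ω) :
    (Θ (discAut 0 0)).1 x = x := by
  rw [discAut_zero_zero, map_one]; rfl

theorem IsLeafModel.injective_orbitDeriv (H : IsLeafModel D d f Θ) {x : Ω} (hx : x ∉ D) :
    Function.Injective (orbitDeriv Θ x x) := by
  have h := H.free x hx
  rw [mfderiv_eq_fderiv_chart (H.mdifferentiableAt_orbit x)] at h
  have e : (chartAt E ((Θ (discAut ((0 : ℝ), (0 : ℂ)).1 ((0 : ℝ), (0 : ℂ)).2)).1 x)) = chartAt E x := by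
    rw [map_discAut_zero]
  rw [e] at h
  exact h

theorem IsLeafModel.tendsto_action (H : IsLeafModel D d f Θ) {g : ℂ × E → Ω} {y : E} {x : Ω}
    (hg : Tendsto g (𝓝 (0, y)) (𝓝 x)) :
    Tendsto (fun q : ℂ × E => (Θ (discAut 0 q.1)).1 (g q)) (𝓝 (0, y)) (𝓝 x) := by
  have ha : Tendsto (fun q : (ℝ × ℂ) × Ω => (Θ (discAut q.1.1 q.1.2)).1 q.2)
      (𝓝 (((0 : ℝ), (0 : ℂ)), x)) (𝓝 x) := by
    have := (H.mdifferentiableAt_action (r := 0) (α := 0) (by simp) x).continuousAt.tendsto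
    simpa only [map_discAut_zero] using this
  have hq : Tendsto (fun q : ℂ × E => (((0 : ℝ), q.1), g q)) (𝓝 ((0 : ℂ), y))
      (𝓝 (((0 : ℝ), (0 : ℂ)), x)) :=
    (Tendsto.prodMk_nhds (Tendsto.prodMk_nhds tendsto_const_nhds
      continuousAt_fst.tendsto) hg)
  have h := ha.comp hq
  simp only [Function.comp_def] at h
  exact h

/-- Automorphisms near the identity move the points near a given one by little. -/
theorem IsLeafModel.eventually_displacement_le (H : IsLeafModel D d f Θ)
    (e : OpenPartialHomeomorph Ω E) {y : E} (hy : y ∈ e.target) {ε : ℝ} (hε : 0 < ε) :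
    ∀ᶠ q : ℂ × E in 𝓝 (0, y), (Θ (discAut 0 q.1)).1 (e.symm q.2) ∈ e.source ∧
      ‖e ((Θ (discAut 0 q.1)).1 (e.symm q.2)) - q.2‖ ≤ ε := by
  have hmem : e.symm y ∈ e.source := e.map_target hy
  have hs : Tendsto (fun q : ℂ × E => e.symm q.2) (𝓝 ((0 : ℂ), y)) (𝓝 (e.symm y)) :=
    (e.continuousAt_symm hy).tendsto.comp continuousAt_snd.tendsto
  have hc := H.tendsto_action hs
  have hc1 := (e.continuousAt hmem).tendsto.comp hc
  rw [e.right_inv hy] at hc1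
  have hc2 := (hc1.sub continuousAt_snd.tendsto).norm
  rw [sub_self, norm_zero] at hc2
  exact (hc.eventually (e.open_source.mem_nhds hmem)).and
    ((hc2.eventually (gt_mem_nhds hε)).mono fun q hq => hq.le)

variable [IsManifold 𝓘(ℂ, E) ω Ω]

theorem IsLeafModel.hasFDerivAt_orbit (H : IsLeafModel D d f Θ) {x₀ x : Ω}
    (hx : x ∈ (chartAt E x₀).source) :
    HasFDerivAt (fun q : ℝ × ℂ => chartAt E x₀ ((Θ (discAut q.1 q.2)).1 x)) (orbitDeriv Θ x₀ x)
      (0, 0) := by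
  have : IsManifold 𝓘(ℝ, E) 1 Ω := isManifold_real_of_complex
  refine ((H.mdifferentiableAt_orbit x).differentiableAt_chart (x := x₀) ?_).hasFDerivAt
  rwa [map_discAut_zero]

theorem differentiableAt_chart_biholAut (θ : biholAut E Ω) {x₀ x₁ : Ω} {y : E}
    (hy : y ∈ (chartAt E x₀).target) (hθ : θ.1 ((chartAt E x₀).symm y) ∈ (chartAt E x₁).source) :
    DifferentiableAt ℂ (fun y => chartAt E x₁ (θ.1 ((chartAt E x₀).symm y))) y := by
  have : IsManifold 𝓘(ℂ, E) 1 Ω := isManifold_one_complex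
  exact (MDifferentiableAt.comp (g := θ.1) y (θ.2.1 _)
    (mdifferentiableAt_atlas_symm (chart_mem_atlas E x₀) hy)).differentiableAt_chart hθ

/-- Orbit derivatives in two charts differ by a complex-linear map. -/
theorem IsLeafModel.orbitDeriv_chart (H : IsLeafModel D d f Θ) {x₀ x : Ω}
    (hx : x ∈ (chartAt E x₀).source) :
    ∃ T : E →L[ℂ] E, ∀ v, orbitDeriv Θ x₀ x v = T (orbitDeriv Θ x x v) := by
  have hx' : (chartAt E x).symm (chartAt E x x) = x := (chartAt E x).left_inv (mem_chart_source E x)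
  have hd : DifferentiableAt ℂ (fun y => chartAt E x₀ ((chartAt E x).symm y)) (chartAt E x x) :=
    differentiableAt_chart_biholAut (1 : biholAut E Ω) (mem_chart_target E x) (by
      change (chartAt E x).symm (chartAt E x x) ∈ _
      rwa [hx'])
  refine ⟨fderiv ℂ (fun y => chartAt E x₀ ((chartAt E x).symm y)) (chartAt E x x), fun v => ?_⟩
  have h1 := H.hasFDerivAt_orbit (mem_chart_source E x)
  have hd' : HasFDerivAt (fun y => chartAt E x₀ ((chartAt E x).symm y))
      ((fderiv ℂ (fun y => chartAt E x₀ ((chartAt E x).symm y)) (chartAt E x x)).restrictScalars ℝ)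
      (chartAt E x ((Θ (discAut ((0 : ℝ), (0 : ℂ)).1 ((0 : ℝ), (0 : ℂ)).2)).1 x)) := by
    rw [map_discAut_zero]
    exact hd.hasFDerivAt.restrictScalars ℝ
  have h2 := HasFDerivAt.comp ((0 : ℝ), (0 : ℂ)) hd' h1
  have h3 := H.hasFDerivAt_orbit hx
  have hev : ∀ᶠ q : ℝ × ℂ in 𝓝 (0, 0), (Θ (discAut q.1 q.2)).1 x ∈ (chartAt E x).source :=
    (H.mdifferentiableAt_orbit x).continuousAt.preimage_mem_nhds
      ((chartAt E x).open_source.mem_nhds (by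
        simp only [map_discAut_zero]; exact mem_chart_source E x))
  have h4 := h3.unique (h2.congr_of_eventuallyEq (by
    filter_upwards [hev] with q hq
    simp only [Function.comp_apply, (chartAt E x).left_inv hq]))
  exact DFunLike.congr_fun h4 v

variable [FiniteDimensional ℂ E]

/-- The displacement of points near `x₁` under the hyperbolic automorphism with parameter `t a` is
at most a constant times `t`. -/
theorem IsLeafModel.displacement_le (H : IsLeafModel D d f Θ) (x₁ : Ω) {a : ℂ} (ha : ‖a‖ = 1) :
    ∃ K : ℝ, ∃ U ∈ 𝓝 x₁, U ⊆ (chartAt E x₁).source ∧ ∀ᶠ t : ℝ in 𝓝[>] 0, ∀ x ∈ U,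
      (Θ (discAut 0 (t * a))).1 x ∈ (chartAt E x₁).source ∧
      ‖chartAt E x₁ ((Θ (discAut 0 (t * a))).1 x) - chartAt E x₁ x‖ ≤ K * t := by
  have : ProperSpace E := FiniteDimensional.proper ℂ E
  set e := chartAt E x₁ with he
  set y₁ := e x₁ with hy₁
  obtain ⟨R₀, hR₀, hR₀t⟩ := Metric.isOpen_iff.1 e.open_target y₁ (mem_chart_target E x₁)
  set R := R₀ / 2 with hRdef
  have hR : 0 < R := by positivity
  have hRt : Metric.closedBall y₁ R ⊆ e.target :=
    (Metric.closedBall_subset_ball (by linarith)).trans hR₀t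
  set φ : ℂ → E → E := fun α y => e ((Θ (discAut 0 α)).1 (e.symm y)) with hφ
  have hclose : ∀ᶠ α : ℂ in 𝓝 0, ∀ y ∈ Metric.closedBall y₁ R,
      (Θ (discAut 0 α)).1 (e.symm y) ∈ e.source ∧ ‖φ α y - y‖ ≤ R / 32 :=
    (isCompact_closedBall y₁ R).eventually_forall_of_forall_eventually
      fun y hy => H.eventually_displacement_le e (hRt hy) (show 0 < R / 32 by positivity)
  obtain ⟨δ₀, hδ₀, hδ₀'⟩ := Metric.eventually_nhds_iff.1 hclose
  set δ := min δ₀ 1 with hδdef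
  have hδ : 0 < δ := lt_min hδ₀ one_pos
  have hsmall : ∀ α : ℂ, ‖α‖ < δ → ∀ y ∈ Metric.closedBall y₁ R,
      (Θ (discAut 0 α)).1 (e.symm y) ∈ e.source ∧ ‖φ α y - y‖ ≤ R / 32 := fun α hα =>
    hδ₀' (by rw [dist_zero_right]; exact hα.trans_le (min_le_left _ _))
  have hlip : ∀ α : ℂ, ‖α‖ < δ → ∀ y ∈ Metric.ball y₁ (R / 2), ∀ y' ∈ Metric.ball y₁ (R / 2),
      ‖(φ α y' - y') - (φ α y - y)‖ ≤ 1 / 4 * ‖y' - y‖ := by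
    intro α hα y hy y' hy'
    have h1 : DifferentiableOn ℂ (fun y => φ α y - y) (Metric.ball y₁ R) := by
      intro w hw
      have hw' := Metric.ball_subset_closedBall hw
      exact ((differentiableAt_chart_biholAut (Θ (discAut 0 α)) (hRt hw')
        (hsmall α hα w hw').1).sub differentiableAt_id).differentiableWithinAt
    have h2 := lipschitzOnWith_half_ball hR h1
      (fun w hw => (hsmall α hα w (Metric.ball_subset_closedBall hw)).2) hy hy'
    have e1 : 8 * (R / 32) / R = 1 / 4 := by field_simp; norm_num
    rwa [e1] at h2
  refine ⟨R / δ, e.source ∩ e ⁻¹' Metric.ball y₁ (R / 4), ?_, inter_subset_left, ?_⟩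
  · exact Filter.inter_mem (chart_source_mem_nhds E x₁)
      ((e.continuousAt (mem_chart_source E x₁)).preimage_mem_nhds
        (Metric.ball_mem_nhds _ (by positivity)))
  have hev : ∀ᶠ t : ℝ in 𝓝[>] 0, 0 < t ∧ t < δ / 4 := by
    refine Filter.Eventually.and self_mem_nhdsWithin ?_
    exact nhdsWithin_le_nhds (Iio_mem_nhds (by positivity))
  filter_upwards [hev] with t ht x hx
  obtain ⟨ht0, ht1⟩ := ht
  obtain ⟨hxs, hxb⟩ := hx
  set y := e x with hy
  have hyb : y ∈ Metric.ball y₁ (R / 4) := hxb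
  have hyR : y ∈ Metric.closedBall y₁ R :=
    Metric.ball_subset_closedBall (Metric.ball_subset_ball (by linarith) hyb)
  have hey : e.symm y = x := e.left_inv hxs
  set n := ⌊δ / (2 * t)⌋₊ with hn
  have hn1 : n * t ≤ δ / 2 := by
    have := Nat.floor_le (show 0 ≤ δ / (2 * t) by positivity)
    calc (n : ℝ) * t ≤ δ / (2 * t) * t := by gcongr
      _ = δ / 2 := by field_simp
  have hn2 : δ / (4 * t) ≤ n := by
    have h1 := Nat.lt_floor_add_one (δ / (2 * t))
    have h2 : 1 ≤ δ / (4 * t) := by rw [le_div_iff₀ (by positivity)]; linarith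
    have h3 : δ / (2 * t) = 2 * (δ / (4 * t)) := by field_simp; norm_num
    rw [← hn, h3] at h1
    linarith
  have hδ1 : δ ≤ 1 := min_le_right _ _
  -- the powers of the automorphism stay near the identity
  have hpow : ∀ k ≤ n, ∃ α : ℂ, ‖α‖ < δ ∧ discAut 0 (t * a) ^ k = discAut 0 α := by
    intro k hk
    have hkt : k * t ≤ δ / 2 := (by gcongr : (k : ℝ) * t ≤ n * t).trans hn1
    obtain ⟨s, hs0, hs1, hs⟩ := pow_discAut_same_direction ha ht0.le k (by linarith)
    refine ⟨s * a, ?_, hs⟩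
    rw [norm_mul, ha, mul_one, norm_real, Real.norm_of_nonneg hs0]
    linarith
  have hone : 1 ≤ n := by
    have h2 : (1 : ℝ) ≤ δ / (4 * t) := by rw [le_div_iff₀ (by positivity)]; linarith
    exact_mod_cast h2.trans hn2
  set ψ : ℕ → E → E := fun k y => e ((Θ (discAut 0 (t * a) ^ k)).1 (e.symm y)) with hψ
  have hψφ : ∀ k ≤ n, ∃ α : ℂ, ‖α‖ < δ ∧ ψ k = φ α := fun k hk => by
    obtain ⟨α, hα, h⟩ := hpow k hk
    exact ⟨α, hα, by simp only [hψ, h]; rfl⟩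
  have hψ1 : (Θ (discAut 0 (t * a) ^ 1)).1 (e.symm y) ∈ e.source ∧ ‖ψ 1 y - y‖ ≤ R / 32 := by
    obtain ⟨α, hα, h⟩ := hpow 1 hone
    have := hsmall α hα y hyR
    simp only [hψ, h]
    exact this
  have hψ1b : ψ 1 y ∈ Metric.ball y₁ (R / 2) := by
    rw [Metric.mem_ball] at hyb ⊢
    have := dist_triangle (ψ 1 y) y y₁
    rw [dist_eq_norm (ψ 1 y) y] at this
    linarith [hψ1.2]
  have hmain := displacement_le_of_iterates (n := n) (φ := ψ) (y := y) (by
      simp only [hψ, pow_zero, map_one]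
      change e (e.symm y) = y
      exact e.right_inv (hRt hyR)) (fun k _ => by
      simp only [hψ]
      rw [e.left_inv hψ1.1, pow_succ, map_mul, pow_one]
      rfl) (fun k hk => by
      obtain ⟨α, hα, h⟩ := hψφ k hk.le
      rw [h]
      exact hlip α hα y (Metric.ball_subset_ball (by linarith) hyb) _ hψ1b)
  have hlast : ‖ψ n y - y‖ ≤ R / 32 := by
    obtain ⟨α, hα, h⟩ := hψφ n le_rfl
    rw [h]
    exact (hsmall α hα y hyR).2
  have hx1 : (Θ (discAut 0 (t * a) ^ 1)).1 (e.symm y) = (Θ (discAut 0 (t * a))).1 x := by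
    rw [pow_one, hey]
  rw [hx1] at hψ1
  refine ⟨hψ1.1, ?_⟩
  have hfin : ‖ψ 1 y - y‖ ≤ R / δ * t := by
    have h1 : δ / (4 * t) * ‖ψ 1 y - y‖ ≤ R / 16 :=
      (mul_le_mul_of_nonneg_right hn2 (norm_nonneg _)).trans (by linarith)
    rw [div_mul_eq_mul_div, div_le_iff₀ (by positivity)] at h1
    rw [div_mul_eq_mul_div, le_div_iff₀ hδ]
    nlinarith
  have : ψ 1 y = e ((Θ (discAut 0 (t * a))).1 x) := by simp only [hψ]; rw [hx1]
  rwa [this] at hfin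

/-- The orbit derivative in a unit direction `a` is holomorphic along the leaf. -/
theorem IsLeafModel.differentiableAt_orbitDeriv (H : IsLeafModel D d f Θ) (z₁ : unitDisc) {a : ℂ}
    (ha : ‖a‖ = 1) :
    ∀ᶠ z : ℂ in 𝓝 (z₁ : ℂ), DifferentiableAt ℂ
      (fun z => orbitDeriv Θ (f z₁) (discExt f z) (0, a)) z := by
  have : IsManifold 𝓘(ℂ, E) 1 Ω := isManifold_one_complex
  have : CompleteSpace E := FiniteDimensional.complete ℂ E
  set e := chartAt E (f z₁)
  obtain ⟨K, U, hU, hUs, hK⟩ := H.displacement_le (f z₁) ha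
  have hfc : ContinuousAt (discExt f) (z₁ : ℂ) :=
    (MDifferentiableAt.comp_toOpens z₁.2 (H.leaf.holomorphic _)).continuousAt
  have hpre : discExt f ⁻¹' U ∩ {z | ‖z‖ < 1} ∈ 𝓝 (z₁ : ℂ) :=
    Filter.inter_mem (hfc.preimage_mem_nhds (by rwa [discExt_coe]))
      (isOpen_norm_lt_one.mem_nhds (norm_coe_lt_one z₁))
  obtain ⟨V, hVsub, hVo, hzV⟩ := mem_nhds_iff.1 hpre
  have hfd : ∀ z ∈ V, MDifferentiableAt 𝓘(ℂ, ℂ) 𝓘(ℂ, E) (discExt f) z := fun z hz =>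
    MDifferentiableAt.comp_toOpens (mem_unitDisc.2 (hVsub hz).2) (H.leaf.holomorphic _)
  have hmain : DifferentiableOn ℂ (fun z => orbitDeriv Θ (f z₁) (discExt f z) (0, a)) V := by
    refine differentiableOn_of_tendsto_of_norm_le (l := 𝓝[>] (0 : ℝ)) (C := K)
      (u := fun t z => t⁻¹ • (e ((Θ (discAut 0 (t * a))).1 (discExt f z)) - e (discExt f z))) hVo
      ?_ ?_ fun z hz => ?_
    · filter_upwards [hK] with t ht z hz
      have hz' := ht _ (hVsub hz).1
      have h1 : DifferentiableAt ℂ (fun z => e ((Θ (discAut 0 (t * a))).1 (discExt f z))) z :=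
        (MDifferentiableAt.comp (g := (Θ (discAut 0 (t * a))).1) z ((Θ _).2.1 _)
          (hfd z hz)).differentiableAt_chart hz'.1
      have h2 : DifferentiableAt ℂ (fun z => e (discExt f z)) z :=
        (hfd z hz).differentiableAt_chart (hUs (hVsub hz).1)
      exact ((h1.sub h2).const_smul (t⁻¹ : ℝ)).differentiableWithinAt
    · filter_upwards [hK, self_mem_nhdsWithin] with t ht ht0 z hz
      have ht0 : 0 < t := ht0
      rw [norm_smul, norm_inv, Real.norm_of_nonneg ht0.le, inv_mul_le_iff₀ ht0, mul_comm t K]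
      exact (ht _ (hVsub hz).1).2
    · have h1 : HasDerivAt (fun t : ℝ => ((0 : ℝ), (t * a : ℂ))) (0, a) 0 := by
        refine (hasDerivAt_const _ _).prodMk ?_
        simpa using (hasDerivAt_id (0 : ℝ)).ofReal_comp.mul_const a
      have h2 := HasFDerivAt.comp_hasDerivAt_of_eq (0 : ℝ)
        (H.hasFDerivAt_orbit (hUs (hVsub hz).1)) h1 (by simp)
      have h3 := h2.tendsto_slope_zero_right
      simpa only [Function.comp_apply, zero_add, ofReal_zero, zero_mul, map_discAut_zero] using h3
  filter_upwards [hVo.mem_nhds hzV] with z hz using hmain.differentiableAt (hVo.mem_nhds hz)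

end Leaf

/-! ### Sharpness in terms of the orbit derivative -/

theorem exp_two_mul_arg {p : ℂ} (hp : p ≠ 0) : cexp ((2 * arg p : ℝ) * I) = p / conj p := by
  have h1 : p = ‖p‖ * cexp (arg p * I) := (norm_mul_exp_arg_mul_I p).symm
  have hn : (‖p‖ : ℂ) ≠ 0 := by exact_mod_cast norm_ne_zero_iff.2 hp
  have h2 : conj p = ‖p‖ * cexp (-(arg p * I)) := by
    conv_lhs => rw [h1]
    rw [map_mul, conj_ofReal, ← Complex.exp_conj, map_mul, conj_ofReal, conj_I, mul_neg]
  have h3 : p / conj p = (‖p‖ * cexp (arg p * I)) / (‖p‖ * cexp (-(arg p * I))) :=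
    congrArg₂ (· / ·) h1 h2
  rw [h3, mul_div_mul_left _ _ hn, ← Complex.exp_sub]
  congr 1
  push_cast
  ring

theorem one_sub_mul_div {b v q : ℂ} (hq : q ≠ 0) : 1 - b * (v / q) = (q - b * v) / q := by
  field_simp

/-- The composition rule for two Möbius maps, with the conjugates of the parameters replaced by
independent variables (`b`, `a'`, `e'` stand for the conjugates of `β`, `a`, `e`), so that it is an
identity between rational functions. -/
theorem conj_moebius_aux {e e' a a' β b u p p' q q' : ℂ} (hp : p = 1 - b * β - a * b + a' * β)
    (hp' : p' = 1 - b * β - a' * β + a * b) (he : e' * e = 1) (hp0 : p ≠ 0) (hp0' : p' ≠ 0)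
    (hq : 1 - b * u = q) (hq' : 1 - a' * u = q') (hq0 : q ≠ 0) (hq0' : q' ≠ 0)
    (hN : 1 - b * β ≠ 0) (hL : q' - b * (u - a) ≠ 0) :
    e * (((u - a) / q' - β) / (1 - b * ((u - a) / q')))
      = p / p' * ((e * ((u - β) / q) - e * ((a - a' * β ^ 2) / p))
        / (1 - e' * ((a' - a * b ^ 2) / p') * (e * ((u - β) / q)))) := by
  have r1 : e * ((u - β) / q) - e * ((a - a' * β ^ 2) / p)
      = e * (1 - b * β) * ((u - a) - β * q') / (p * q) := by
    rw [eq_div_iff (mul_ne_zero hp0 hq0)]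
    field_simp
    rw [← hq, ← hq', hp]
    ring
  have r2 : 1 - e' * ((a' - a * b ^ 2) / p') * (e * ((u - β) / q))
      = (1 - b * β) * (q' - b * (u - a)) / (p' * q) := by
    have : e' * ((a' - a * b ^ 2) / p') * (e * ((u - β) / q))
        = (a' - a * b ^ 2) * (u - β) / (p' * q) := by
      field_simp
      linear_combination (a' - a * b ^ 2) * (u - β) * he
    rw [this, eq_div_iff (mul_ne_zero hp0' hq0), sub_mul, div_mul_cancel₀ _ (mul_ne_zero hp0' hq0),
      ← hq, ← hq', hp']
    ring
  have l1 : (u - a) / q' - β = ((u - a) - β * q') / q' := by field_simp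
  rw [one_sub_mul_div hq0', l1, r1, r2]
  generalize q' - b * (u - a) = x at *
  generalize 1 - b * β = y at *
  field_simp

/-- The conjugate of `B_a` by the automorphism `e^{ir} B_β`, in coordinates. -/
theorem discAut_conj_discAut {r : ℝ} {β a p α : ℂ} (hβ : ‖β‖ < 1) (ha : ‖a‖ < 1)
    (hp : p = 1 - conj β * β - a * conj β + conj a * β) (hp0 : p ≠ 0)
    (hα : α = cexp (r * I) * ((a - conj a * β ^ 2) / p)) (hα1 : ‖α‖ < 1) :
    discAut r β * discAut 0 a * (discAut r β)⁻¹ = discAut (2 * arg p) α := by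
  rw [mul_inv_eq_iff_eq_mul]
  refine discAut_ext fun z => ?_
  change (((discAut r β).1 ((discAut 0 a).1 z) : unitDisc) : ℂ)
    = ((discAut (2 * arg p) α).1 ((discAut r β).1 z) : unitDisc)
  have hz := norm_coe_lt_one z
  have hd1 := moebius_denom_ne hβ hz
  have hd2 := moebius_denom_ne ha hz
  have hw1 := moebius_denom_ne hβ (norm_coe_lt_one ((discAut 0 a).1 z))
  have hw2 := moebius_denom_ne hα1 (norm_coe_lt_one ((discAut r β).1 z))
  have hN := moebius_denom_ne hβ hβ
  rw [coe_discAut hβ, coe_discAut hα1, exp_two_mul_arg hp0]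
  rw [coe_discAut ha] at hw1 ⊢
  rw [coe_discAut hβ] at hw2 ⊢
  simp only [ofReal_zero, zero_mul, Complex.exp_zero, one_mul] at hw1 ⊢
  set e := cexp (r * I) with he
  have hee : conj e * e = 1 := by
    rw [he, ← Complex.exp_conj, ← Complex.exp_add, map_mul, conj_ofReal, conj_I]
    simp
  have hpc : conj p ≠ 0 := (map_ne_zero _).2 hp0
  have hcp : conj p = 1 - conj β * β - conj a * β + a * conj β := by
    rw [hp]; simp only [map_add, map_sub, map_mul, map_one, conj_conj]; ring
  have hcα : conj α = conj e * ((conj a - a * conj β ^ 2) / conj p) := by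
    rw [hα]; simp only [map_mul, map_div₀, map_sub, map_pow, conj_conj]
  rw [hcα, hα]
  refine conj_moebius_aux hp hcp hee hp0 hpc rfl rfl hd1 hd2 hN ?_
  rw [one_sub_mul_div hd2] at hw1
  exact (div_ne_zero_iff.1 hw1).1

/-- The derivative at the identity of conjugation by `e^{ir} B_β` in the direction `a`. -/
theorem hasDerivAt_conj_coordinates (r : ℝ) {β : ℂ} (hβ : ‖β‖ < 1) (a : ℂ) :
    HasDerivAt (fun t : ℝ => ((2 * arg (1 - conj β * β - t * a * conj β + conj (t * a) * β) : ℝ),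
      cexp (r * I) * ((t * a - conj (t * a) * β ^ 2)
        / (1 - conj β * β - t * a * conj β + conj (t * a) * β))))
      ((-4 * (a * conj β).im / (1 - ‖β‖ ^ 2) : ℝ),
        cexp (r * I) * ((a - conj a * β ^ 2) / (1 - ‖β‖ ^ 2 : ℝ))) 0 := by
  have hN : 0 < 1 - ‖β‖ ^ 2 := by nlinarith [norm_nonneg β]
  have hNc : (1 : ℂ) - conj β * β = ((1 - ‖β‖ ^ 2 : ℝ) : ℂ) := by
    rw [Complex.conj_mul']; push_cast; rfl
  rw [hNc]
  set N := 1 - ‖β‖ ^ 2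
  have ht : HasDerivAt (fun t : ℝ => (t : ℂ)) 1 0 := (hasDerivAt_id (0 : ℝ)).ofReal_comp
  have hp : HasDerivAt (fun t : ℝ => (N : ℂ) - t * a * conj β + conj (t * a) * β)
      (-(a * conj β) + conj a * β) 0 := by
    simp only [map_mul, conj_ofReal]
    have := (((ht.mul_const a).mul_const (conj β)).const_sub (N : ℂ)).add
      ((ht.mul_const (conj a)).mul_const β)
    simpa [Pi.add_def] using this
  have hk : HasDerivAt (fun t : ℝ => t * a - conj (t * a) * β ^ 2) (a - conj a * β ^ 2) 0 := by
    simp only [map_mul, conj_ofReal]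
    have := (ht.mul_const a).sub ((ht.mul_const (conj a)).mul_const (β ^ 2))
    simpa [Pi.sub_def] using this
  have hN0 : (N : ℂ) ≠ 0 := by exact_mod_cast hN.ne'
  have hp0 : (N : ℂ) - ((0 : ℝ) : ℂ) * a * conj β + conj (((0 : ℝ) : ℂ) * a) * β = N := by simp
  refine HasDerivAt.prodMk ?_ ?_
  · have h1 := hp.clog_real (by rw [hp0]; exact ofReal_mem_slitPlane.2 hN)
    have h2 := (imCLM.hasFDerivAt.comp_hasDerivAt (0 : ℝ) h1).const_mul (2 : ℝ)
    simp only [Function.comp_def, imCLM_apply, log_im] at h2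
    refine h2.congr_deriv ?_
    rw [hp0, div_ofReal_im, add_im, neg_im]
    have : (conj a * β).im = -(a * conj β).im := by
      rw [← conj_im, map_mul, conj_conj]
    rw [this]
    ring
  · have h1 := (hk.div hp (by rw [hp0]; exact hN0)).const_mul (cexp (r * I))
    refine h1.congr_deriv ?_
    rw [hp0]
    simp
    field_simp

section Sharp

variable {E : Type*} [NormedAddCommGroup E] [NormedSpace ℂ E]
  {Ω : Type*} [TopologicalSpace Ω] [ChartedSpace E Ω] [IsManifold 𝓘(ℂ, E) ω Ω]
  {D : Set Ω} {d f : unitDisc → Ω} {Θ : biholAut ℂ unitDisc ≃* biholAut E Ω}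

theorem IsLeafModel.hasDerivAt_orbit (H : IsLeafModel D d f Θ) {x₀ x : Ω}
    (hx : x ∈ (chartAt E x₀).source) {γ : ℝ → ℝ × ℂ} {v : ℝ × ℂ} (hγ : HasDerivAt γ v 0)
    (h0 : γ 0 = (0, 0)) :
    HasDerivAt (fun t => chartAt E x₀ ((Θ (discAut (γ t).1 (γ t).2)).1 x)) (orbitDeriv Θ x₀ x v) 0 :=
  HasFDerivAt.comp_hasDerivAt_of_eq (0 : ℝ) (H.hasFDerivAt_orbit hx) hγ h0.symm

/-- The velocity of a point under a conjugate of the one-parameter family `B_{ta}`. -/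
theorem IsLeafModel.hasDerivAt_conj_orbit (H : IsLeafModel D d f Θ) (x : Ω) (r : ℝ) {β : ℂ}
    (hβ : ‖β‖ < 1) (a : ℂ) :
    HasDerivAt (fun t : ℝ => chartAt E x
        ((Θ (discAut r β * discAut 0 (t * a) * (discAut r β)⁻¹)).1 x))
      (orbitDeriv Θ x x ((-4 * (a * conj β).im / (1 - ‖β‖ ^ 2) : ℝ),
        cexp (r * I) * ((a - conj a * β ^ 2) / (1 - ‖β‖ ^ 2 : ℝ)))) 0 := by
  have hγ := hasDerivAt_conj_coordinates r hβ a
  have hN : 0 < 1 - ‖β‖ ^ 2 := by nlinarith [norm_nonneg β]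
  have hNc : (1 : ℂ) - conj β * β = ((1 - ‖β‖ ^ 2 : ℝ) : ℂ) := by
    rw [Complex.conj_mul']; push_cast; rfl
  have h0 : (fun t : ℝ => ((2 * arg (1 - conj β * β - t * a * conj β + conj (t * a) * β) : ℝ),
      cexp (r * I) * ((t * a - conj (t * a) * β ^ 2)
        / (1 - conj β * β - t * a * conj β + conj (t * a) * β)))) 0 = (0, 0) := by
    simp [hNc, -ofReal_sub, arg_ofReal_of_nonneg hN.le]
  refine (H.hasDerivAt_orbit (mem_chart_source E x) hγ h0).congr_of_eventuallyEq ?_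
  have hα1 : ∀ᶠ t : ℝ in 𝓝 0, ‖cexp (r * I) * ((t * a - conj (t * a) * β ^ 2)
      / (1 - conj β * β - t * a * conj β + conj (t * a) * β))‖ < 1 := by
    have hc := hγ.continuousAt.snd.norm
    refine hc.eventually_lt continuousAt_const ?_
    have := congrArg (fun q : ℝ × ℂ => ‖q.2‖) h0
    simp only [norm_zero] at this
    rw [this]
    exact one_pos
  have ht1 : ∀ᶠ t : ℝ in 𝓝 0, ‖(t * a : ℂ)‖ < 1 := by
    have hc : ContinuousAt (fun t : ℝ => ‖(t * a : ℂ)‖) 0 := by fun_prop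
    exact hc.eventually_lt continuousAt_const (by simp)
  have hp1 : ∀ᶠ t : ℝ in 𝓝 0, 1 - conj β * β - t * a * conj β + conj (t * a) * β ≠ 0 := by
    have hc : ContinuousAt (fun t : ℝ => 1 - conj β * β - t * a * conj β + conj (t * a) * β) 0 := by
      fun_prop
    refine hc.eventually_ne ?_
    simp only [ofReal_zero, zero_mul, map_zero, sub_zero, add_zero, hNc]
    exact_mod_cast hN.ne'
  filter_upwards [hα1, ht1, hp1] with t h1 h2 h3
  rw [discAut_conj_discAut hβ h2 rfl h3 rfl h1]

/-- The derivative of the involution `Θ(z ↦ -z)` at a point of the leaf: it fixes the leaf and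
reverses the directions of the hyperbolic automorphisms. -/
theorem IsLeafModel.exists_flip (H : IsLeafModel D d f Θ) (z : unitDisc) :
    ∃ T : E →L[ℂ] E, (∀ v : ℝ × ℂ, T (orbitDeriv Θ (f z) (f z) v)
        = orbitDeriv Θ (f z) (f z) (v.1, -v.2)) ∧
      T (deriv (fun w : ℂ => chartAt E (f z) (discExt f w)) z)
        = deriv (fun w : ℂ => chartAt E (f z) (discExt f w)) z := by
  have : IsManifold 𝓘(ℂ, E) 1 Ω := isManifold_one_complex
  set x := f z with hx
  set m := discAut Real.pi 0 with hm
  set e := chartAt E x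
  have hmc : ∀ w : unitDisc, (m.1 w : ℂ) = -w := fun w => by
    rw [hm, coe_discAut_zero_right, exp_pi_mul_I, neg_one_mul]
  have hmf : ∀ w, (Θ m).1 (f w) = f w := fun w => by
    rw [H.sync m (eq_discZero_iff.2 (by rw [hmc]; simp))]
    congr 1
    refine Subtype.ext ?_
    rw [hmc, hmc, neg_neg]
  have hmm : ∀ (r : ℝ) {α : ℂ}, ‖α‖ < 1 → m * discAut r α = discAut r (-α) * m := fun r α hα => by
    refine discAut_ext fun w => ?_
    change (m.1 ((discAut r α).1 w) : ℂ) = (discAut r (-α)).1 (m.1 w)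
    rw [hmc, coe_discAut hα, coe_discAut (by rwa [norm_neg]), hmc, ← mul_neg, ← neg_div, map_neg,
      neg_mul_neg]
    congr 3
    ring
  have hex : e.symm (e x) = x := e.left_inv (mem_chart_source E x)
  have hd : DifferentiableAt ℂ (fun y => e ((Θ m).1 (e.symm y))) (e x) :=
    differentiableAt_chart_biholAut (Θ m) (mem_chart_target E x) (by
      rw [hex, hx, hmf]; exact mem_chart_source E x)
  refine ⟨fderiv ℂ (fun y => e ((Θ m).1 (e.symm y))) (e x), fun v => ?_, ?_⟩
  · have h1 := H.hasFDerivAt_orbit (mem_chart_source E x)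
    have hd' : HasFDerivAt (fun y => e ((Θ m).1 (e.symm y)))
        ((fderiv ℂ (fun y => e ((Θ m).1 (e.symm y))) (e x)).restrictScalars ℝ)
        (e ((Θ (discAut ((0 : ℝ), (0 : ℂ)).1 ((0 : ℝ), (0 : ℂ)).2)).1 x)) := by
      rw [map_discAut_zero]
      exact hd.hasFDerivAt.restrictScalars ℝ
    have h2 := HasFDerivAt.comp ((0 : ℝ), (0 : ℂ)) hd' h1
    have h3 : HasFDerivAt (fun q : ℝ × ℂ => (q.1, -q.2))
        ((ContinuousLinearMap.fst ℝ ℝ ℂ).prod (-ContinuousLinearMap.snd ℝ ℝ ℂ)) (0, 0) :=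
      hasFDerivAt_fst.prodMk hasFDerivAt_snd.neg
    have h1' : HasFDerivAt (fun q : ℝ × ℂ => e ((Θ (discAut q.1 q.2)).1 x)) (orbitDeriv Θ x x)
        ((fun q : ℝ × ℂ => (q.1, -q.2)) (0, 0)) := by
      simpa using h1
    have h4 := HasFDerivAt.comp ((0 : ℝ), (0 : ℂ)) h1' h3
    have hev : ∀ᶠ q : ℝ × ℂ in 𝓝 (0, 0), (Θ (discAut q.1 q.2)).1 x ∈ e.source :=
      (H.mdifferentiableAt_orbit x).continuousAt.preimage_mem_nhds
        (e.open_source.mem_nhds (by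
          simp only [map_discAut_zero]; exact mem_chart_source E x))
    have hev1 : ∀ᶠ q : ℝ × ℂ in 𝓝 (0, 0), ‖q.2‖ < 1 :=
      (isOpen_lt (by fun_prop) continuous_const).mem_nhds (by simp)
    have h5 := h4.unique (h2.congr_of_eventuallyEq (by
      filter_upwards [hev, hev1] with q hq hq1
      simp only [Function.comp_apply]
      have hl : e.symm (chartAt E x ((Θ (discAut q.1 q.2)).1 x)) = (Θ (discAut q.1 q.2)).1 x :=
        e.left_inv hq
      have h6 := congrArg (fun n => (Θ n).1 x) (hmm q.1 hq1)
      simp only [map_mul] at h6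
      change (Θ m).1 ((Θ (discAut q.1 q.2)).1 x)
        = (Θ (discAut q.1 (-q.2))).1 ((Θ m).1 (f z)) at h6
      rw [hl, h6, hmf]))
    exact (DFunLike.congr_fun h5 v).symm
  · have hfd : MDifferentiableAt 𝓘(ℂ, ℂ) 𝓘(ℂ, E) (discExt f) (z : ℂ) :=
      MDifferentiableAt.comp_toOpens z.2 (H.leaf.holomorphic _)
    have hxs : discExt f (z : ℂ) ∈ e.source := by rw [discExt_coe]; exact mem_chart_source E x
    have h1 : HasDerivAt (fun w : ℂ => e (discExt f w)) _ (z : ℂ) :=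
      (hfd.differentiableAt_chart hxs).hasDerivAt
    have h2 := HasFDerivAt.comp_hasDerivAt_of_eq (z : ℂ) hd.hasFDerivAt h1
      (by rw [discExt_coe])
    refine h2.unique (h1.congr_of_eventuallyEq ?_)
    filter_upwards [hfd.continuousAt.preimage_mem_nhds (e.open_source.mem_nhds hxs)] with w hw
    simp only [Function.comp_apply]
    rw [e.left_inv hw, hmf]

/-- The Poincaré parameter of a point of the leaf. -/
theorem IsLeafModel.poincareParam_eq (H : IsLeafModel D d f Θ) {ℰ : D → Set Ω}
    (hℰ : ∀ y : D, (y : Ω) = d discZero → ℰ y = range f)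
    (hdis : ∀ x y : D, x ≠ y → Disjoint (ℰ x) (ℰ y)) {z : unitDisc} {p : ℝ}
    (hp : IsPoincareParam E D ℰ (f z) p) : p = Real.artanh ‖(z : ℂ)‖ := by
  obtain ⟨y, g, z₀, w, hg, hg0, hgw, rfl⟩ := hp
  have hdD : d discZero ∈ D := by rw [← H.pair.1.2]; exact mem_range_self _
  have hy : y = ⟨d discZero, hdD⟩ := by
    by_contra hne
    refine Set.disjoint_left.1 (hdis _ _ hne) (?_ : f z ∈ _) ?_
    · rw [← hgw, ← hg.2]; exact mem_range_self _
    · rw [hℰ ⟨_, hdD⟩ rfl]; exact mem_range_self _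
  rw [hℰ y (by rw [hy])] at hg
  obtain ⟨b, rfl⟩ := IsDiscParam.exists_discAut ⟨H.leaf, rfl⟩ hg
  obtain ⟨r, α, hα, rfl⟩ := exists_eq_discAut b
  have h0 : (discAut r α).1 z₀ = discZero := H.leaf.injective (by
    rw [H.base]; rw [hy] at hg0; exact hg0)
  have h1 : (discAut r α).1 w = z := H.leaf.injective hgw
  have h2 : (z₀ : ℂ) = α := by
    rw [eq_discZero_iff, coe_discAut hα] at h0
    have h3 := (mul_eq_zero.1 h0).resolve_left (Complex.exp_ne_zero _)
    exact sub_eq_zero.1 ((div_eq_zero_iff.1 h3).resolve_right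
      (moebius_denom_ne hα (norm_coe_lt_one z₀)))
  rw [← h1, coe_discAut hα, h2, norm_mul, Complex.norm_exp_ofReal_mul_I, one_mul]

/-- The splitting of a real-linear map on `ℂ` into its `ℂ`-linear and conjugate-linear parts. -/
theorem real_smul_add_imag_smul (V : ℂ →ₗ[ℝ] E) (a : ℂ) :
    V a = a • ((2⁻¹ : ℂ) • (V 1 - I • V I)) + conj a • ((2⁻¹ : ℂ) • (V 1 + I • V I)) := by
  have h1 : V a = (a.re : ℂ) • V 1 + (a.im : ℂ) • V I := by
    conv_lhs => rw [show a = a.re • (1 : ℂ) + a.im • I by simp]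
    rw [map_add, map_smul, map_smul]
    rfl
  rw [h1]
  conv_rhs => rw [← re_add_im a]
  simp only [map_add, map_mul, conj_ofReal, conj_I, smul_add, smul_sub, smul_smul]
  have hI : I * I = -1 := I_mul_I
  match_scalars
  · ring
  · linear_combination (a.im : ℂ) * hI

/-- Sharpness at a point `f z` off `D` makes the velocity of `f z` in the direction `a` a
multiple, with factor `a + c z ā` where `|c| = 1`, of a single vector. -/
theorem IsLeafModel.exists_velocity_of_actsSharply (H : IsLeafModel D d f Θ) {ℰ : D → Set Ω}
    (hℰ : ∀ y : D, (y : Ω) = d discZero → ℰ y = range f)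
    (hdis : ∀ x y : D, x ≠ y → Disjoint (ℰ x) (ℰ y))
    (hdet : ∀ θ₁ θ₂ : biholAut E Ω, EqOn θ₁.1 θ₂.1 D → θ₁ = θ₂) (hs : ActsSharply E D ℰ)
    {z : unitDisc} (hz : z ≠ discZero) :
    ∃ (c : ℂ) (A : E), ‖c‖ = 1 ∧ A ≠ 0 ∧
      ∀ a : ℂ, orbitDeriv Θ (f z) (f z) (0, a) = (a + c * z * conj a) • A := by
  have hzD : f z ∉ D := fun h => hz (H.inter z h)
  obtain ⟨d', Θ', hpair, p, hp, ho⟩ := hs (f z) hzD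
  obtain ⟨b, -, hb⟩ := H.pair.exists_discAut hdet hpair
  obtain ⟨r, β, hβ, rfl⟩ := exists_eq_discAut b
  set x := f z with hx
  set L := orbitDeriv Θ x x with hLdef
  have hzn : 0 < ‖(z : ℂ)‖ := norm_pos_iff.2 fun h => hz (eq_discZero_iff.2 h)
  have hz1 := norm_coe_lt_one z
  have hpe : Real.exp (2 * p) = (1 + ‖(z : ℂ)‖) / (1 - ‖(z : ℂ)‖) := by
    rw [H.poincareParam_eq hℰ hdis hp, exp_two_mul_artanh hzn.le hz1]
  set s := Real.exp (2 * p) with hs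
  have hs0 : 0 < s := Real.exp_pos _
  set e := cexp (r * I) with he
  -- the sharpness relation in terms of the derivative of the orbit
  have hLI := H.hasDerivAt_conj_orbit x r hβ I
  have hL1 := H.hasDerivAt_conj_orbit x r hβ 1
  have h0 : (Θ (discAut r β * discAut 0 0 * (discAut r β)⁻¹)).1 x = x := by
    rw [discAut_zero_zero, mul_one, mul_inv_cancel, map_one]; rfl
  have hrel : (s : ℂ) • L ((-4 * (I * conj β).im / (1 - ‖β‖ ^ 2) : ℝ),
        e * ((I - conj I * β ^ 2) / (1 - ‖β‖ ^ 2 : ℝ)))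
      = I • L ((-4 * (1 * conj β).im / (1 - ‖β‖ ^ 2) : ℝ),
        e * ((1 - conj 1 * β ^ 2) / (1 - ‖β‖ ^ 2 : ℝ))) := by
    have h1 := ((hLI.sub_const (chartAt E x x)).const_smul (s : ℂ)).sub
      ((hL1.sub_const (chartAt E x x)).const_smul I)
    have h2 : HasDerivAt (fun t : ℝ => (s : ℂ) •
          (chartAt E x ((Θ' (discAut 0 (I * t))).1 x) - chartAt E x x)
        - I • (chartAt E x ((Θ' (discAut 0 t)).1 x) - chartAt E x x)) (0 : E) 0 := by
      rw [hasDerivAt_iff_isLittleO]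
      simpa [hb, h0] using ho
    refine sub_eq_zero.1 (h1.unique (h2.congr_of_eventuallyEq (Eventually.of_forall fun t => ?_)))
    simp only [Pi.sub_apply, Pi.smul_apply, hb, mul_one, mul_comm I]
  have hadd : ∀ (ρ : ℝ) (a : ℂ), L (ρ, a) = (ρ : ℂ) • L (1, 0) + L (0, a) := fun ρ a => by
    have : ((ρ, a) : ℝ × ℂ) = ρ • ((1 : ℝ), (0 : ℂ)) + (0, a) := by ext <;> simp
    conv_lhs => rw [this]
    rw [map_add, map_smul]
    rfl
  -- comparison with the image under the involution separates the rotational parts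
  obtain ⟨T, hT, -⟩ := H.exists_flip z
  have hinj := H.injective_orbitDeriv hzD
  have hv0 : L (1, 0) ≠ 0 := fun h => by
    have := hinj (h.trans (map_zero L).symm)
    simp at this
  have hneg : ∀ a : ℂ, L (0, -a) = -L (0, a) := fun a => by
    rw [← map_neg]; congr 1; simp
  have hrot : ∀ (ρ ρ' : ℝ) (a a' : ℂ), (s : ℂ) • L (ρ, a) = I • L (ρ', a') → ρ = 0 ∧ ρ' = 0 := by
    intro ρ ρ' a a' h
    have h' := congrArg T h
    rw [map_smul, map_smul, hT, hT] at h'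
    change (s : ℂ) • L (ρ, -a) = I • L (ρ', -a') at h'
    rw [hadd, hadd ρ'] at h
    rw [hadd, hadd ρ', hneg, hneg] at h'
    have h2 : (2 * (s * ρ - I * ρ') : ℂ) • L (1, 0) = 0 := by
      linear_combination (norm := module) h + h'
    have h3 := (smul_eq_zero.1 h2).resolve_right hv0
    have h4 := (mul_eq_zero.1 h3).resolve_left two_ne_zero
    have hre := congrArg re h4
    have him := congrArg im h4
    simp only [sub_re, sub_im, mul_re, mul_im, ofReal_re, ofReal_im, I_re, I_im, zero_re,
      zero_im] at hre him
    constructor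
    · have : s * ρ = 0 := by linarith
      exact (mul_eq_zero.1 this).resolve_left hs0.ne'
    · linarith
  have hN : 0 < 1 - ‖β‖ ^ 2 := by nlinarith [norm_nonneg β]
  obtain ⟨h1, h2⟩ := hrot _ _ _ _ hrel
  have hβ0 : β = 0 := by
    rw [div_eq_zero_iff, or_iff_left hN.ne'] at h1 h2
    refine Complex.ext ?_ ?_
    · simpa using h1
    · simpa using h2
  subst hβ0
  have hrel' : (s : ℂ) • L (0, e * I) = I • L (0, e) := by simpa using hrel
  set A : E := (2⁻¹ : ℂ) • (L (0, 1) - I • L (0, I)) with hA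
  set B : E := (2⁻¹ : ℂ) • (L (0, 1) + I • L (0, I)) with hB
  have hV : ∀ a : ℂ, L (0, a) = a • A + conj a • B := fun a =>
    real_smul_add_imag_smul (L.toLinearMap ∘ₗ LinearMap.inr ℝ ℝ ℂ) a
  clear_value A B
  have hee : conj e * e = 1 := by
    rw [he, ← Complex.exp_conj, ← Complex.exp_add, map_mul, conj_ofReal, conj_I]
    simp
  have hz0 : (z : ℂ) ≠ 0 := norm_pos_iff.1 hzn
  have hs1 : s * (1 - ‖(z : ℂ)‖) = 1 + ‖(z : ℂ)‖ := by
    rw [hpe, div_mul_cancel₀ _ (by linarith)]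
  have hs2 : (s : ℂ) * (1 - ‖(z : ℂ)‖) = 1 + ‖(z : ℂ)‖ := by exact_mod_cast hs1
  have hBA : B = (e ^ 2 * ‖(z : ℂ)‖) • A := by
    rw [hV, hV, map_mul, conj_I] at hrel'
    have h3 : ((s : ℂ) + 1) • B = (((s : ℂ) - 1) * e ^ 2) • A := by
      have h4 := congrArg (fun v => (I * e) • v) hrel'
      simp only [smul_add, smul_smul] at h4
      have e1 : I * e * (s * (e * I)) = -(s * e ^ 2) := by linear_combination s * e ^ 2 * I_mul_I
      have e2 : I * e * (s * (conj e * -I)) = s := by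
        linear_combination (-s * I * I) * hee - s * I_mul_I
      have e3 : I * e * (I * e) = -e ^ 2 := by linear_combination e ^ 2 * I_mul_I
      have e4 : I * e * (I * conj e) = -1 := by linear_combination I * I * hee + I_mul_I
      rw [e1, e2, e3, e4] at h4
      linear_combination (norm := module) h4
    have h5 : (s : ℂ) + 1 ≠ 0 := by exact_mod_cast (by linarith : s + 1 ≠ 0)
    refine smul_right_injective E h5 ?_
    simp only
    rw [h3, smul_smul]
    congr 1
    linear_combination e ^ 2 * hs2
  refine ⟨e ^ 2 * ‖(z : ℂ)‖ / z, A, ?_, fun h => ?_, fun a => ?_⟩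
  · rw [norm_div, norm_mul, norm_pow, he, Complex.norm_exp_ofReal_mul_I, norm_real, norm_norm, one_pow,
      one_mul, div_self hzn.ne']
  · have h3 : L (0, 1) = 0 := by rw [hV, hBA, h]; simp
    have := hinj (h3.trans (map_zero L).symm)
    simp at this
  · rw [hV, hBA, div_mul_cancel₀ _ hz0]
    module

end Sharp

/-! ### Normalization of the leaf parametrization -/

/-- The punctured disc is the image of the left half-plane under the exponential. -/
theorem isPreconnected_punctured_disc : IsPreconnected {z : ℂ | z ≠ 0 ∧ ‖z‖ < 1} := by
  have h : {z : ℂ | z ≠ 0 ∧ ‖z‖ < 1} = cexp '' {w | w.re < 0} := by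
    ext z
    constructor
    · rintro ⟨h0, h1⟩
      refine ⟨log z, ?_, exp_log h0⟩
      change (log z).re < 0
      rw [log_re]
      exact Real.log_neg (norm_pos_iff.2 h0) h1
    · rintro ⟨w, hw, rfl⟩
      have hw : w.re < 0 := hw
      exact ⟨exp_ne_zero w, by rwa [norm_exp, Real.exp_lt_one_iff]⟩
  rw [h]
  exact (convex_halfSpace_re_lt 0).isPreconnected.image _ continuous_exp.continuousOn

theorem discAut_rotation_comm {m : biholAut ℂ unitDisc} (hm : m.1 discZero = discZero) (φ : ℝ)
    (z : unitDisc) : (discAut φ 0).1 (m.1 z) = m.1 ((discAut φ 0).1 z) := by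
  obtain ⟨r, rfl⟩ := exists_eq_discAut_zero_right hm
  refine Subtype.ext ?_
  simp only [coe_discAut_zero_right]
  ring

section Normal

variable {E : Type*} [NormedAddCommGroup E] [NormedSpace ℂ E]
  {Ω : Type*} [TopologicalSpace Ω] [ChartedSpace E Ω]

theorem IsProperEmbedding.deriv_chart_ne_zero {f : unitDisc → Ω} (hf : IsProperEmbedding E f)
    (z : unitDisc) : deriv (fun w : ℂ => chartAt E (f z) (discExt f w)) z ≠ 0 := by
  intro h
  have h1 := hf.immersion z
  rw [mfderiv_opens_eq_fderiv (x₀ := discZero) (hf.holomorphic z)] at h1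
  have h2 : fderiv ℂ (fun w : ℂ => chartAt E (f z) (discExt f w)) z 1
      = fderiv ℂ (fun w : ℂ => chartAt E (f z) (discExt f w)) z 0 := by
    rw [map_zero, fderiv_apply_one_eq_deriv]
    exact h
  have h3 : (1 : ℂ) = 0 := h1 h2
  exact one_ne_zero h3

variable {D : Set Ω} {d f : unitDisc → Ω} {Θ : biholAut ℂ unitDisc ≃* biholAut E Ω}

/-- A leaf parametrization may be precomposed with a rotation: rotations commute with each other, so
the synchronization law is unaffected. -/
theorem IsLeafModel.comp_rotation (H : IsLeafModel D d f Θ) (φ : ℝ) :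
    IsLeafModel D d (f ∘ (discAut φ 0).1) Θ := by
  have h0 : (discAut φ 0).1 discZero = discZero :=
    eq_discZero_iff.2 (by rw [coe_discAut_zero_right]; simp)
  refine { H with
    leaf := H.leaf.comp_discAut _
    base := ?_
    inter := fun z hz => ?_
    sync := fun m hm z => ?_
    disjoint := fun m z w h => H.disjoint m _ _ h
    cover := fun x => ?_ }
  · rw [Function.comp_apply, h0, H.base]
  · exact (discAut φ 0).1.injective ((H.inter _ hz).trans h0.symm)
  · simp only [Function.comp_apply]
    rw [H.sync m hm, discAut_rotation_comm hm, discAut_rotation_comm hm]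
  · obtain ⟨m, z, h⟩ := H.cover x
    exact ⟨m, (discAut φ 0).1.symm z, by rwa [Function.comp_apply, Equiv.apply_symm_apply]⟩

variable [IsManifold 𝓘(ℂ, E) ω Ω]

/-- At the centre of the leaf, the velocity in the direction `a` is a complex multiple of the
tangent vector of the royal disc. -/
theorem IsLeafModel.exists_velocity_zero (H : IsLeafModel D d f Θ) :
    ∃ A : E, A ≠ 0 ∧ ∀ a : ℂ, orbitDeriv Θ (f discZero) (f discZero) (0, a) = a • A := by
  have : IsManifold 𝓘(ℂ, E) 1 Ω := isManifold_one_complex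
  rw [H.base]
  set x := d discZero with hx
  refine ⟨-deriv (fun w : ℂ => chartAt E x (discExt d w)) 0,
    neg_ne_zero.2 (H.pair.1.1.deriv_chart_ne_zero discZero), fun a => ?_⟩
  have hdd : HasDerivAt (fun w : ℂ => chartAt E x (discExt d w))
      (deriv (fun w : ℂ => chartAt E x (discExt d w)) 0) 0 := by
    refine DifferentiableAt.hasDerivAt ?_
    refine MDifferentiableAt.differentiableAt_chart
      (MDifferentiableAt.comp_toOpens discZero.2 (H.pair.1.1.holomorphic _)) ?_
    exact (discExt_coe d discZero).symm ▸ mem_chart_source E x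
  have hγ : HasDerivAt (fun t : ℝ => ((0 : ℝ), (t * a : ℂ))) (0, a) 0 := by
    refine (hasDerivAt_const _ _).prodMk ?_
    simpa using (hasDerivAt_id (0 : ℝ)).ofReal_comp.mul_const a
  have h1 := H.hasDerivAt_orbit (mem_chart_source E x) hγ (by simp)
  have hγ' : HasDerivAt (fun t : ℝ => (-(t * a) : ℂ)) (-a) 0 := by
    simpa using ((hasDerivAt_id (0 : ℝ)).ofReal_comp.mul_const a).fun_neg
  have h2 : HasDerivAt (fun t : ℝ => chartAt E x (discExt d (-(t * a))))
      (-a • deriv (fun w : ℂ => chartAt E x (discExt d w)) 0) 0 :=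
    HasDerivAt.scomp_of_eq (0 : ℝ) hdd hγ' (by simp)
  rw [smul_neg, ← neg_smul]
  refine h1.unique (h2.congr_of_eventuallyEq ?_)
  have ht1 : ∀ᶠ t : ℝ in 𝓝 0, ‖(t * a : ℂ)‖ < 1 := by
    have hc : ContinuousAt (fun t : ℝ => ‖(t * a : ℂ)‖) 0 := by fun_prop
    exact hc.eventually_lt continuousAt_const (by simp)
  filter_upwards [ht1] with t ht
  have h3 : (Θ (discAut 0 (t * a))).1 x = d ((discAut 0 (t * a)).1 discZero) := H.pair.2 _ _
  rw [h3, discExt]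
  congr 2
  refine Subtype.ext ?_
  rw [coe_toOpens (mem_unitDisc.2 (by rwa [norm_neg])), coe_discAut ht]
  simp

variable [FiniteDimensional ℂ E]

/-- The unimodular factor in the velocities along the leaf does not depend on the point: it is a
holomorphic function of constant modulus. -/
theorem IsLeafModel.exists_factor (H : IsLeafModel D d f Θ)
    (hV : ∀ z ≠ discZero, ∃ (c : ℂ) (A : E), ‖c‖ = 1 ∧ A ≠ 0 ∧
      ∀ a : ℂ, orbitDeriv Θ (f z) (f z) (0, a) = (a + c * z * conj a) • A) :
    ∃ c : ℂ, ‖c‖ = 1 ∧ ∀ z ≠ discZero, ∃ A : E, A ≠ 0 ∧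
      ∀ a : ℂ, orbitDeriv Θ (f z) (f z) (0, a) = (a + c * z * conj a) • A := by
  have : IsManifold 𝓘(ℂ, E) 1 Ω := isManifold_one_complex
  choose! c A hc hA hV using hV
  set U : Set ℂ := {z : ℂ | z ≠ 0 ∧ ‖z‖ < 1} with hU
  have hUo : IsOpen U := isOpen_ne.inter isOpen_norm_lt_one
  have hne : ∀ z ∈ U, toOpens unitDisc discZero z ≠ discZero := fun z hz h => by
    refine hz.1 ?_
    rw [← coe_toOpens (x₀ := discZero) (mem_unitDisc.2 hz.2), h, coe_discZero]
  have hd : DifferentiableOn ℂ (discExt c) U := by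
    intro z₁ hz₁
    refine DifferentiableAt.differentiableWithinAt ?_
    set w₁ := toOpens unitDisc discZero z₁ with hw₁
    have hw₁c : (w₁ : ℂ) = z₁ := coe_toOpens (mem_unitDisc.2 hz₁.2)
    set e := chartAt E (f w₁)
    have h1 := (H.differentiableAt_orbitDeriv w₁ (a := 1) (by simp)).self_of_nhds
    have h2 := (H.differentiableAt_orbitDeriv w₁ (a := I) (by simp)).self_of_nhds
    rw [hw₁c] at h1 h2
    set X : ℂ → ℂ → E := fun a z => orbitDeriv Θ (f w₁) (discExt f z) (0, a) with hX
    have h1 : DifferentiableAt ℂ (X 1) z₁ := h1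
    have h2 : DifferentiableAt ℂ (X I) z₁ := h2
    have hsrc : ∀ᶠ z in 𝓝 z₁, discExt f z ∈ e.source :=
      (MDifferentiableAt.comp_toOpens (x₀ := discZero) (mem_unitDisc.2 hz₁.2)
        (H.leaf.holomorphic _)).continuousAt.preimage_mem_nhds
        (e.open_source.mem_nhds (mem_chart_source E (f w₁)))
    have hXA : ∀ᶠ z in 𝓝 z₁, ∃ A' : E, X 1 z - I • X I z = A' ∧
        X 1 z + I • X I z = (discExt c z * z) • A' := by
      filter_upwards [hsrc, hUo.mem_nhds hz₁] with z hz hzU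
      obtain ⟨T, hT⟩ := H.orbitDeriv_chart hz
      have hv := hV _ (hne z hzU)
      rw [coe_toOpens (mem_unitDisc.2 hzU.2)] at hv
      refine ⟨_, rfl, ?_⟩
      simp only [hX, hT]
      rw [hv, hv]
      simp only [map_smul, map_one, conj_I]
      match_scalars
      linear_combination (1 + discExt c z * z) * (1 - discExt c z * z) * I_mul_I
    have hP0 : X 1 z₁ - I • X I z₁ ≠ 0 := by
      have hv := hV _ (hne z₁ hz₁)
      simp only [hX]
      rw [← hw₁] at hv
      change orbitDeriv Θ (f w₁) (f w₁) (0, 1) - I • orbitDeriv Θ (f w₁) (f w₁) (0, I) ≠ 0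
      rw [hv, hv, map_one, conj_I]
      have : (1 + c w₁ * w₁ * 1) • A w₁ - I • (I + c w₁ * w₁ * -I) • A w₁ = (2 : ℂ) • A w₁ := by
        match_scalars
        linear_combination (-1 + c w₁ * w₁) * I_mul_I
      rw [this]
      exact smul_ne_zero two_ne_zero (hA _ (hne z₁ hz₁))
    obtain ⟨ℓ, hℓ⟩ := SeparatingDual.exists_ne_zero (R := ℂ) hP0
    have hPd : DifferentiableAt ℂ (fun z => ℓ (X 1 z - I • X I z)) z₁ :=
      ℓ.differentiableAt.comp z₁ (h1.sub (h2.const_smul I))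
    have hQd : DifferentiableAt ℂ (fun z => ℓ (X 1 z + I • X I z)) z₁ :=
      ℓ.differentiableAt.comp z₁ (h1.add (h2.const_smul I))
    refine (hQd.div (differentiableAt_id.mul hPd) (mul_ne_zero hz₁.1 hℓ)).congr_of_eventuallyEq ?_
    filter_upwards [hXA, hPd.continuousAt.eventually_ne hℓ, hUo.mem_nhds hz₁] with z hz hz0 hzU
    obtain ⟨A', hA', hA''⟩ := hz
    simp only [Pi.div_apply, Pi.mul_apply, id_eq]
    rw [eq_div_iff (mul_ne_zero hzU.1 hz0), hA'', map_smul, hA', smul_eq_mul]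
    ring
  have hn : ∀ z ∈ U, ‖discExt c z‖ = 1 := fun z hz => hc _ (hne z hz)
  have hhalf : (2⁻¹ : ℂ) ∈ U := ⟨by norm_num, by norm_num⟩
  have hconst := Complex.eqOn_of_isPreconnected_of_isMaxOn_norm isPreconnected_punctured_disc hUo hd
    hhalf (fun z hz => by
      change ‖discExt c z‖ ≤ ‖discExt c 2⁻¹‖
      rw [hn z hz, hn _ hhalf])
  refine ⟨discExt c 2⁻¹, hn _ hhalf, fun z hz => ⟨A z, hA z hz, fun a => ?_⟩⟩
  rw [hV z hz]
  have hzU : (z : ℂ) ∈ U := ⟨fun h => hz (eq_discZero_iff.2 h), norm_coe_lt_one z⟩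
  have := hconst hzU
  rw [discExt_coe, Function.const_apply] at this
  rw [this]

/-- After a rotation of the leaf parametrization, the velocity in the direction `a` at the point
`f z` is `a + ā z` times a nonzero vector. -/
theorem IsLeafModel.exists_normalized (H : IsLeafModel D d f Θ)
    (hV : ∀ z ≠ discZero, ∃ (c : ℂ) (A : E), ‖c‖ = 1 ∧ A ≠ 0 ∧
      ∀ a : ℂ, orbitDeriv Θ (f z) (f z) (0, a) = (a + c * z * conj a) • A) :
    ∃ g, IsLeafModel D d g Θ ∧ ∀ z, ∃ A : E, A ≠ 0 ∧
      ∀ a : ℂ, orbitDeriv Θ (g z) (g z) (0, a) = (a + conj a * z) • A := by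
  obtain ⟨c, hc, hV⟩ := H.exists_factor hV
  have hc1 : c * cexp ((-arg c : ℝ) * I) = 1 := by
    calc c * cexp ((-arg c : ℝ) * I) = (‖c‖ * cexp (arg c * I)) * cexp ((-arg c : ℝ) * I) := by
          rw [norm_mul_exp_arg_mul_I]
      _ = 1 := by rw [hc, ofReal_one, one_mul, ← Complex.exp_add]; simp
  have H' := H.comp_rotation (-arg c)
  refine ⟨_, H', fun z => ?_⟩
  by_cases hz : z = discZero
  · subst hz
    obtain ⟨A, hA, h⟩ := H'.exists_velocity_zero
    exact ⟨A, hA, fun a => by rw [h]; simp⟩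
  · have hne : (discAut (-arg c) 0).1 z ≠ discZero := fun h => by
      rw [eq_discZero_iff, coe_discAut_zero_right] at h
      exact hz (eq_discZero_iff.2 ((mul_eq_zero.1 h).resolve_left (Complex.exp_ne_zero _)))
    obtain ⟨A, hA, h⟩ := hV _ hne
    refine ⟨A, hA, fun a => ?_⟩
    simp only [Function.comp_apply]
    rw [h, coe_discAut_zero_right, ← mul_assoc, hc1, one_mul, mul_comm (z : ℂ)]

end Normal

/-! ### The equivariant map from the symmetrized bidisc -/

theorem leafMap_injective : Function.Injective leafMap := fun z w h => by
  rw [Subtype.ext_iff, coe_leafMap, coe_leafMap, Prod.mk.injEq] at h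
  exact Subtype.ext h.2

theorem differentiableAt_leafParam {x : ℂ × ℂ} (hx : x ∈ symBidisc) :
    DifferentiableAt ℝ leafParam x := by
  have h1 := norm_snd_lt_one hx
  have h2 : ((1 - ‖x.2‖ ^ 2 : ℝ) : ℂ) ≠ 0 := by
    have : 0 < 1 - ‖x.2‖ ^ 2 := by nlinarith [norm_nonneg x.2]
    exact_mod_cast this.ne'
  have h3 : DifferentiableAt ℝ (fun x : ℂ × ℂ => conj x.1) x :=
    (conjCLE.toContinuousLinearMap.differentiable.comp
      (differentiable_fst : Differentiable ℝ fun q : ℂ × ℂ => q.1)) x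
  have h4 : DifferentiableAt ℝ (fun x : ℂ × ℂ => ((1 - ‖x.2‖ ^ 2 : ℝ) : ℂ)) x :=
    (ofRealCLM.differentiable _).comp x
      ((differentiableAt_const _).sub (differentiableAt_snd.norm_sq ℝ))
  have h5 : DifferentiableAt ℝ (fun x : ℂ × ℂ => x.1 - conj x.1 * x.2) x :=
    differentiableAt_fst.sub (h3.mul differentiableAt_snd)
  exact (h5.mul (h4.inv h2)).congr_of_eventuallyEq (Eventually.of_forall fun x => div_eq_mul_inv _ _)

theorem differentiableAt_midpt {x : ℂ × ℂ} (hx : x ∈ symBidisc) : DifferentiableAt ℝ midpt x := by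
  have h1 := norm_leafParam_lt_one hx
  have h2 : 0 < 1 - ‖leafParam x‖ ^ 2 := by nlinarith [norm_nonneg (leafParam x)]
  have h3 : ((1 + √(1 - ‖leafParam x‖ ^ 2) : ℝ) : ℂ) ≠ 0 := by
    have : 0 < 1 + √(1 - ‖leafParam x‖ ^ 2) := by positivity
    exact_mod_cast this.ne'
  have h4 : DifferentiableAt ℝ (fun x : ℂ × ℂ => ((1 + √(1 - ‖leafParam x‖ ^ 2) : ℝ) : ℂ)) x :=
    (ofRealCLM.differentiable _).comp x ((differentiableAt_const _).add
      (((differentiableAt_const _).sub ((differentiableAt_leafParam hx).norm_sq ℝ)).sqrt h2.ne'))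
  exact ((differentiableAt_leafParam hx).mul (h4.inv h3)).congr_of_eventuallyEq
    (Eventually.of_forall fun x => div_eq_mul_inv _ _)

theorem differentiableAt_leafCoord {x : ℂ × ℂ} (hx : x ∈ symBidisc) :
    DifferentiableAt ℝ leafCoord x := by
  have h1 : DifferentiableAt ℝ (fun x : ℂ × ℂ => (((0 : ℝ), midpt x), x)) x :=
    ((differentiableAt_const _).prodMk (differentiableAt_midpt hx)).prodMk differentiableAt_id
  exact (DifferentiableAt.comp x (f := fun x : ℂ × ℂ => (((0 : ℝ), midpt x), x))
    (g := fun q : (ℝ × ℂ) × (ℂ × ℂ) => symFormula q.1.1 q.1.2 q.2)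
    (differentiableAt_symFormula (norm_midpt_lt_one hx) hx) h1).snd

theorem midpt_leaf (z : ℂ) : midpt (0, z) = 0 := by simp [midpt, leafParam]

theorem leafCoord_leaf (z : ℂ) : leafCoord (0, z) = z := by simp [leafCoord, midpt_leaf, symFormula]

/-- Every vector along the leaf direction is an orbit direction: `a ↦ a + conj a * z` is a real-linear
isomorphism of `ℂ` because its determinant `1 - |z|²` does not vanish. -/
theorem exists_add_conj_mul_eq {z : ℂ} (hz : ‖z‖ < 1) (σ : ℂ) : ∃ a : ℂ, a + conj a * z = σ := by
  have h : (1 : ℂ) - conj z * z ≠ 0 := moebius_denom_ne hz hz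
  have h' : (1 : ℂ) - z * conj z ≠ 0 := by rwa [mul_comm]
  refine ⟨(σ - conj σ * z) / (1 - conj z * z), ?_⟩
  simp only [map_div₀, map_sub, map_mul, map_one, conj_conj]
  rw [mul_comm z (conj z), div_mul_eq_mul_div, ← add_div, div_eq_iff h]
  ring

section Equivariant

variable {E : Type*} [NormedAddCommGroup E] [NormedSpace ℂ E]
  {Ω : Type*} [TopologicalSpace Ω] [ChartedSpace E Ω]
  {D : Set Ω} {d f : unitDisc → Ω} {Θ : biholAut ℂ unitDisc ≃* biholAut E Ω}

theorem map_inv_mul_apply_eq_iff {X Y : Type*} [Group X] (φ : X →* Equiv.Perm Y) (m n : X) (x y : Y) :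
    φ (n⁻¹ * m) x = y ↔ φ m x = φ n y := by
  rw [map_mul, map_inv, Equiv.Perm.mul_apply, Equiv.Perm.inv_eq_iff_eq]

/-- Coincidences between the translates of the leaf are the same in `Ω` as in the symmetrized
bidisc. -/
theorem IsLeafModel.translate_eq_iff (H : IsLeafModel D d f Θ) (m n : biholAut ℂ unitDisc)
    (z w : unitDisc) :
    (Θ m).1 (f z) = (Θ n).1 (f w) ↔
      (symAutHom m).1 (leafMap z) = (symAutHom n).1 (leafMap w) := by
  have h1 := map_inv_mul_apply_eq_iff ((biholAut E Ω).subtype.comp Θ.toMonoidHom) m n (f z) (f w)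
  have h2 := map_inv_mul_apply_eq_iff ((biholAut (ℂ × ℂ) symBidisc).subtype.comp symAutHom) m n
    (leafMap z) (leafMap w)
  refine h1.symm.trans (Iff.trans ?_ h2)
  change (Θ (n⁻¹ * m)).1 (f z) = f w ↔ (symAutHom (n⁻¹ * m)).1 (leafMap z) = leafMap w
  constructor
  · intro h
    have h0 := H.disjoint _ _ _ h
    rw [H.sync _ h0] at h
    rw [symAutHom_leafMap_of_fixes h0, H.leaf.injective h]
  · intro h
    have h0 := fixes_discZero_of_leafMap h
    rw [symAutHom_leafMap_of_fixes h0] at h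
    rw [H.sync _ h0, leafMap_injective h]

/-- The map from the symmetrized bidisc that takes the translates of the leaf `{(0, z)}` to the
corresponding translates of the leaf `f`. -/
def equivariantMap (Θ : biholAut ℂ unitDisc ≃* biholAut E Ω) (f : unitDisc → Ω) (x : symBidisc) : Ω :=
  (Θ (discAut 0 (-midpt x))).1 (f ⟨leafCoord x, mem_unitDisc.2 (norm_leafCoord_lt_one x.2)⟩)

theorem IsLeafModel.equivariantMap_apply (H : IsLeafModel D d f Θ) (m : biholAut ℂ unitDisc)
    (z : unitDisc) : equivariantMap Θ f ((symAutHom m).1 (leafMap z)) = (Θ m).1 (f z) := by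
  rw [equivariantMap, H.translate_eq_iff]
  exact (eq_symAutHom_leafMap _).symm

theorem IsLeafModel.equivariantMap_leafMap (H : IsLeafModel D d f Θ) (z : unitDisc) :
    equivariantMap Θ f (leafMap z) = f z := by
  have := H.equivariantMap_apply 1 z
  rw [map_one, map_one] at this
  exact this

theorem IsLeafModel.equivariantMap_symAutHom (H : IsLeafModel D d f Θ) (m : biholAut ℂ unitDisc)
    (x : symBidisc) :
    equivariantMap Θ f ((symAutHom m).1 x) = (Θ m).1 (equivariantMap Θ f x) := by
  rw [eq_symAutHom_leafMap x, H.equivariantMap_apply]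
  have h1 : ∀ n y, (symAutHom m).1 ((symAutHom n).1 y) = (symAutHom (m * n)).1 y := fun n y => by
    rw [map_mul]; rfl
  rw [h1, H.equivariantMap_apply, map_mul]
  rfl

theorem IsLeafModel.equivariantMap_bijective (H : IsLeafModel D d f Θ) :
    Function.Bijective (equivariantMap Θ f) := by
  constructor
  · intro x y h
    rw [eq_symAutHom_leafMap x, eq_symAutHom_leafMap y] at h ⊢
    rwa [H.equivariantMap_apply, H.equivariantMap_apply, H.translate_eq_iff] at h
  · intro y
    obtain ⟨m, z, rfl⟩ := H.cover y
    exact ⟨_, H.equivariantMap_apply m z⟩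

/-- The equivariant map in the chart at the point `f z`, extended to `ℂ²`. -/
def equivariantChart (Θ : biholAut ℂ unitDisc ≃* biholAut E Ω) (f : unitDisc → Ω) (z : unitDisc)
    (x : ℂ × ℂ) : E :=
  chartAt E (f z) (equivariantMap Θ f (toOpens symBidisc (leafMap z) x))

theorem IsLeafModel.mdifferentiableAt_equivariantMap_real (H : IsLeafModel D d f Θ) (z : unitDisc) :
    MDifferentiableAt 𝓘(ℝ, ℂ × ℂ) 𝓘(ℝ, E)
      (fun x => equivariantMap Θ f (toOpens symBidisc (leafMap z) x)) ((0 : ℂ), (z : ℂ)) := by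
  have hx : ((0 : ℂ), (z : ℂ)) ∈ symBidisc := (leafMap z).2
  have h1 : MDifferentiableAt 𝓘(ℝ, ℂ) 𝓘(ℝ, E) (discExt f) (leafCoord (0, (z : ℂ))) := by
    rw [leafCoord_leaf]
    exact (MDifferentiableAt.comp_toOpens z.2 (H.leaf.holomorphic _)).real_of_complex
  have h2 : MDifferentiableAt 𝓘(ℝ, ℂ × ℂ) 𝓘(ℝ, E) (fun x : ℂ × ℂ => discExt f (leafCoord x))
      ((0 : ℂ), (z : ℂ)) :=
    MDifferentiableAt.comp (g := discExt f) (f := leafCoord) _ h1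
      (differentiableAt_leafCoord hx).mdifferentiableAt
  have h3 : MDifferentiableAt 𝓘(ℝ, ℂ × ℂ) 𝓘(ℝ, ℝ × ℂ) (fun x : ℂ × ℂ => ((0 : ℝ), -midpt x))
      ((0 : ℂ), (z : ℂ)) :=
    ((differentiableAt_const _).prodMk (differentiableAt_midpt hx).neg).mdifferentiableAt
  have h4 : MDifferentiableAt 𝓘(ℝ, ℂ × ℂ) 𝓘(ℝ, E)
      (fun x : ℂ × ℂ => (Θ (discAut 0 (-midpt x))).1 (discExt f (leafCoord x)))
      ((0 : ℂ), (z : ℂ)) :=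
    MDifferentiableAt.comp (g := fun q : (ℝ × ℂ) × Ω => (Θ (discAut q.1.1 q.1.2)).1 q.2)
      (f := fun x : ℂ × ℂ => (((0 : ℝ), -midpt x), discExt f (leafCoord x))) _
      (H.mdifferentiableAt_action (by rw [midpt_leaf, neg_zero, norm_zero]; exact one_pos) _)
      (h3.prodMk h2)
  refine h4.congr_of_eventuallyEq ?_
  filter_upwards [symBidisc.isOpen.mem_nhds hx] with x hx
  rw [toOpens_of_mem hx, discExt, toOpens_of_mem (mem_unitDisc.2 (norm_leafCoord_lt_one hx))]
  rfl

variable [IsManifold 𝓘(ℂ, E) ω Ω]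

/-- The derivative of the equivariant map at a point of the leaf is complex-linear and injective.
It takes `∂/∂p` to the tangent vector of the leaf and `∂/∂s` to a multiple of the direction in which
the hyperbolic automorphisms move the point, and the involution `Θ(z ↦ -z)` separates the two. -/
theorem IsLeafModel.exists_hasFDerivAt (H : IsLeafModel D d f Θ) {z : unitDisc} {A : E} (hA : A ≠ 0)
    (hV : ∀ a : ℂ, orbitDeriv Θ (f z) (f z) (0, a) = (a + conj a * z) • A) :
    ∃ T : ℂ × ℂ →L[ℂ] E, Function.Injective T ∧
      HasFDerivAt (equivariantChart Θ f z) T ((0 : ℂ), (z : ℂ)) := by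
  have : IsManifold 𝓘(ℝ, E) 1 Ω := isManifold_real_of_complex
  have : IsManifold 𝓘(ℂ, E) 1 Ω := isManifold_one_complex
  have hx : ((0 : ℂ), (z : ℂ)) ∈ symBidisc := (leafMap z).2
  have hxl : toOpens symBidisc (leafMap z) ((0 : ℂ), (z : ℂ)) = leafMap z := toOpens_coe (leafMap z)
  set e := chartAt E (f z)
  set B := deriv (fun w : ℂ => e (discExt f w)) z with hB
  have hB0 : B ≠ 0 := H.leaf.deriv_chart_ne_zero z
  have hF : HasFDerivAt (equivariantChart Θ f z) (fderiv ℝ (equivariantChart Θ f z) (0, (z : ℂ)))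
      ((0 : ℂ), (z : ℂ)) :=
    ((H.mdifferentiableAt_equivariantMap_real z).differentiableAt_chart (x := f z) (by
      rw [hxl, H.equivariantMap_leafMap]; exact mem_chart_source E _)).hasFDerivAt
  set F' := fderiv ℝ (equivariantChart Θ f z) (0, (z : ℂ))
  -- along the leaf
  have h1 : ∀ τ : ℂ, F' (0, τ) = τ • B := by
    intro τ
    have hc : HasDerivAt (fun t : ℝ => (z + t * τ : ℂ)) τ 0 := by
      simpa using ((hasDerivAt_id (0 : ℝ)).ofReal_comp.mul_const τ).const_add (z : ℂ)
    have hc2 : HasDerivAt (fun t : ℝ => ((0 : ℂ), (z + t * τ : ℂ))) (0, τ) 0 :=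
      (hasDerivAt_const _ _).prodMk hc
    have hl := HasFDerivAt.comp_hasDerivAt_of_eq (0 : ℝ) hF hc2 (by simp)
    have hfd : HasDerivAt (fun w : ℂ => e (discExt f w)) B (z : ℂ) :=
      ((MDifferentiableAt.comp_toOpens z.2 (H.leaf.holomorphic _)).differentiableAt_chart (x := f z)
        (by rw [toOpens_coe]; exact mem_chart_source E _)).hasDerivAt
    have hr : HasDerivAt (fun t : ℝ => e (discExt f (z + t * τ))) (τ • B) 0 :=
      HasDerivAt.scomp_of_eq (0 : ℝ) hfd hc (by simp)
    have ht : ∀ᶠ t : ℝ in 𝓝 0, ‖(z + t * τ : ℂ)‖ < 1 :=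
      hc.continuousAt.norm.eventually_lt continuousAt_const (by simpa using norm_coe_lt_one z)
    refine hl.unique (hr.congr_of_eventuallyEq ?_)
    filter_upwards [ht] with t ht
    have ht' : ((0 : ℂ), (z + t * τ : ℂ)) = leafMap ⟨z + t * τ, mem_unitDisc.2 ht⟩ := rfl
    simp only [Function.comp_apply, equivariantChart]
    rw [ht', toOpens_coe, H.equivariantMap_leafMap, discExt, toOpens_of_mem (mem_unitDisc.2 ht)]
  -- transversally to the leaf
  have h2 : ∀ σ : ℂ, F' (σ, 0) = (-σ / 2) • A := by
    intro σ
    obtain ⟨a, ha⟩ := exists_add_conj_mul_eq (norm_coe_lt_one z) (-σ / 2)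
    have hc := hasDerivAt_symFormula 0 a (0, (z : ℂ))
    have hl := HasFDerivAt.comp_hasDerivAt_of_eq (0 : ℝ) hF hc (by simp [symFormula])
    have hγ : HasDerivAt (fun t : ℝ => ((0 : ℝ), (t * a : ℂ))) (0, a) 0 := by
      refine (hasDerivAt_const _ _).prodMk ?_
      simpa using (hasDerivAt_id (0 : ℝ)).ofReal_comp.mul_const a
    have hr := H.hasDerivAt_orbit (mem_chart_source E (f z)) hγ (by simp)
    rw [hV, ha] at hr
    have ht : ∀ᶠ t : ℝ in 𝓝 0, ‖(t * a : ℂ)‖ < 1 := by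
      have hc : ContinuousAt (fun t : ℝ => ‖(t * a : ℂ)‖) 0 := by fun_prop
      exact hc.eventually_lt continuousAt_const (by simp)
    have h3 := hl.unique (hr.congr_of_eventuallyEq (by
      filter_upwards [ht] with t ht
      simp only [Function.comp_apply, equivariantChart, mul_zero]
      have h4 := coe_symAutHom_discAut 0 ht (leafMap z)
      rw [coe_leafMap] at h4
      rw [← h4, toOpens_coe, H.equivariantMap_apply]))
    rw [← h3]
    congr 1
    simp only [Prod.mk.injEq, mul_zero, zero_mul, ofReal_zero, zero_sub, ne_eq, OfNat.ofNat_ne_zero,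
      not_false_eq_true, zero_pow, add_zero, sub_self, and_true]
    linear_combination 2 * ha
  set T : ℂ × ℂ →L[ℂ] E := (ContinuousLinearMap.toSpanSingleton ℂ ((-2⁻¹ : ℂ) • A)).coprod
    (ContinuousLinearMap.toSpanSingleton ℂ B) with hTdef
  have hT : ∀ v : ℂ × ℂ, T v = (-v.1 / 2) • A + v.2 • B := fun v => by
    simp only [hTdef, ContinuousLinearMap.coprod_apply, ContinuousLinearMap.toSpanSingleton_apply]
    module
  refine ⟨T, ?_, hasFDerivAt_of_restrictScalars ℝ hF ?_⟩
  · obtain ⟨S, hS, hSB⟩ := H.exists_flip z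
    have hSA : S A = -A := by
      obtain ⟨a, ha⟩ := exists_add_conj_mul_eq (norm_coe_lt_one z) 1
      have h3 := hS (0, a)
      have h4 : orbitDeriv Θ (f z) (f z) (0, -a) = -orbitDeriv Θ (f z) (f z) (0, a) := by
        rw [← map_neg]; congr 1; simp
      rw [h4, hV, ha, one_smul] at h3
      exact h3
    refine (injective_iff_map_eq_zero T).2 fun v hv => ?_
    rw [hT] at hv
    have hv' := congrArg S hv
    rw [map_add, map_smul, map_smul, map_zero, hSA, hSB] at hv'
    have h5 : (2 * v.2) • B = 0 := by linear_combination (norm := module) hv + hv'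
    have h6 : v.1 • A = 0 := by linear_combination (norm := module) hv' - hv
    have h7 := (smul_eq_zero.1 h5).resolve_right hB0
    exact Prod.ext ((smul_eq_zero.1 h6).resolve_right hA)
      ((mul_eq_zero.1 h7).resolve_left two_ne_zero)
  · ext v
    · have : F' (v, 0) = T (v, 0) := by rw [h2, hT]; simp
      exact this.symm
    · have : F' (0, v) = T (0, v) := by rw [h1, hT]; simp
      exact this.symm

end Equivariant

/-! ### The equivariant map is biholomorphic -/

/-- An injective linear map `T : V → E` is onto if `E` contains a nonempty open set covered by a
complex-differentiable map from a subset of `V`. Otherwise `T V` is a null set, and the open set is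
its image under a differentiable self-map of `E`. -/
theorem surjective_of_isOpen_subset_image {E : Type*} [NormedAddCommGroup E] [NormedSpace ℂ E]
    [FiniteDimensional ℂ E] {V : Type*} [NormedAddCommGroup V] [NormedSpace ℂ V]
    [FiniteDimensional ℂ V] {T : V →L[ℂ] E} (hT : Function.Injective T)
    {F : V → E} {W : Set V} (hF : ∀ x ∈ W, DifferentiableAt ℂ F x) {U : Set E} (hU : IsOpen U)
    (hUn : U.Nonempty) (hUW : U ⊆ F '' W) : Function.Surjective T := by
  by_contra hs
  let _ : MeasurableSpace E := borel E
  have : BorelSpace E := ⟨rfl⟩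
  have : FiniteDimensional ℝ E := FiniteDimensional.complexToReal E
  set μ : MeasureTheory.Measure E := MeasureTheory.Measure.addHaar
  obtain ⟨π, hπ⟩ := T.toLinearMap.exists_leftInverse_of_injective (LinearMap.ker_eq_bot.2 hT)
  have hπT : ∀ v, π (T v) = v := fun v => LinearMap.congr_fun hπ v
  set S : Submodule ℝ E := (LinearMap.range T.toLinearMap).restrictScalars ℝ
  have hS : S ≠ ⊤ := fun h => hs fun y => by
    have : y ∈ S := h ▸ Submodule.mem_top
    exact this
  have h0 : μ (T '' W) = 0 := MeasureTheory.measure_mono_null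
    (fun y hy => by obtain ⟨x, -, rfl⟩ := hy; exact ⟨x, rfl⟩)
    (MeasureTheory.Measure.addHaar_submodule μ S hS)
  have hd : DifferentiableOn ℝ (fun y => F (π y)) (T '' W) := by
    rintro _ ⟨x, hx, rfl⟩
    have h1 : DifferentiableAt ℂ (fun y => F (π y)) (T x) := by
      refine DifferentiableAt.comp (T x) (g := F) ?_ π.toContinuousLinearMap.differentiableAt
      change DifferentiableAt ℂ F (π (T x))
      rw [hπT]
      exact hF x hx
    exact (h1.restrictScalars ℝ).differentiableWithinAt
  have h1 := MeasureTheory.addHaar_image_eq_zero_of_differentiableOn_of_addHaar_eq_zero μ hd h0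
  refine (hU.measure_pos μ hUn).ne' (MeasureTheory.measure_mono_null (fun y hy => ?_) h1)
  obtain ⟨x, hx, rfl⟩ := hUW hy
  exact ⟨T x, ⟨x, hx, rfl⟩, by simp only [hπT]⟩

section Biholomorphic

variable {E : Type*} [NormedAddCommGroup E] [NormedSpace ℂ E]
  {Ω : Type*} [TopologicalSpace Ω] [ChartedSpace E Ω] [IsManifold 𝓘(ℂ, E) ω Ω]
  {D : Set Ω} {d f : unitDisc → Ω} {Θ : biholAut ℂ unitDisc ≃* biholAut E Ω}

/-- Complex differentiability holds at the points of the central leaf, and equivariance carries it to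
all others. -/
theorem IsLeafModel.mdifferentiable_equivariantMap (H : IsLeafModel D d f Θ)
    (hV : ∀ z, ∃ A : E, A ≠ 0 ∧
      ∀ a : ℂ, orbitDeriv Θ (f z) (f z) (0, a) = (a + conj a * z) • A) :
    MDifferentiable 𝓘(ℂ, ℂ × ℂ) 𝓘(ℂ, E) (equivariantMap Θ f) := by
  have : IsManifold 𝓘(ℂ, E) 1 Ω := isManifold_one_complex
  have hleaf : ∀ z, MDifferentiableAt 𝓘(ℂ, ℂ × ℂ) 𝓘(ℂ, E) (equivariantMap Θ f) (leafMap z) := by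
    intro z
    obtain ⟨A, hA, hVz⟩ := hV z
    obtain ⟨T, -, hT⟩ := H.exists_hasFDerivAt hA hVz
    refine mdifferentiableAt_of_comp_toOpens (x₀ := leafMap z) ?_
    refine mdifferentiableAt_of_chart (x := f z) ?_ ?_ hT.differentiableAt
    · exact (H.mdifferentiableAt_equivariantMap_real z).continuousAt
    · rw [toOpens_coe, H.equivariantMap_leafMap]
      exact mem_chart_source E _
  intro x
  set m := discAut 0 (-midpt x) with hm
  set w : unitDisc := ⟨leafCoord x, mem_unitDisc.2 (norm_leafCoord_lt_one x.2)⟩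
  have hx : x = (symAutHom m).1 (leafMap w) := eq_symAutHom_leafMap x
  have hy : (symAutHom m).1.symm x = leafMap w := by rw [Equiv.symm_apply_eq, ← hx]
  have h1 : equivariantMap Θ f
      = (Θ m).1 ∘ equivariantMap Θ f ∘ (symAutHom m).1.symm := funext fun y => by
    simp only [Function.comp_apply]
    rw [← H.equivariantMap_symAutHom, Equiv.apply_symm_apply]
  rw [h1]
  refine MDifferentiableAt.comp (g := (Θ m).1) x ((Θ m).2.1 _)
    (MDifferentiableAt.comp (g := equivariantMap Θ f) x ?_ ((symAutHom m).2.2 x))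
  rw [hy]
  exact hleaf w

/-- The equivariant map, as a bijection. -/
def IsLeafModel.equiv (H : IsLeafModel D d f Θ) : symBidisc ≃ Ω :=
  Equiv.ofBijective _ H.equivariantMap_bijective

variable [FiniteDimensional ℂ E]

theorem IsLeafModel.mdifferentiableAt_equiv_symm (H : IsLeafModel D d f Θ)
    (hV : ∀ z, ∃ A : E, A ≠ 0 ∧
      ∀ a : ℂ, orbitDeriv Θ (f z) (f z) (0, a) = (a + conj a * z) • A) (z : unitDisc) :
    MDifferentiableAt 𝓘(ℂ, E) 𝓘(ℂ, ℂ × ℂ) H.equiv.symm (f z) := by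
  have : IsManifold 𝓘(ℂ, E) 1 Ω := isManifold_one_complex
  have : CompleteSpace E := FiniteDimensional.complete ℂ E
  obtain ⟨A, hA, hVz⟩ := hV z
  obtain ⟨T, hTinj, hT⟩ := H.exists_hasFDerivAt hA hVz
  set e := chartAt E (f z)
  set F := equivariantChart Θ f z with hF
  set G : ℂ × ℂ → Ω := fun x => equivariantMap Θ f (toOpens symBidisc (leafMap z) x) with hG
  set x₀ : ℂ × ℂ := ((0 : ℂ), (z : ℂ)) with hx₀
  have hx₀m : x₀ ∈ symBidisc := (leafMap z).2
  have hGx₀ : G x₀ = f z := by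
    rw [hG]
    change equivariantMap Θ f (toOpens symBidisc (leafMap z) (leafMap z : ℂ × ℂ)) = _
    rw [toOpens_coe, H.equivariantMap_leafMap]
  have hGd : ∀ x ∈ symBidisc, MDifferentiableAt 𝓘(ℂ, ℂ × ℂ) 𝓘(ℂ, E) G x := fun x hx =>
    MDifferentiableAt.comp_toOpens hx (H.mdifferentiable_equivariantMap hV _)
  have hFd : ∀ x ∈ symBidisc, G x ∈ e.source → DifferentiableAt ℂ F x := fun x hx hs =>
    (hGd x hx).differentiableAt_chart hs
  -- the derivative is an isomorphism
  have hTsurj : Function.Surjective T := by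
    refine surjective_of_isOpen_subset_image (F := F) hTinj
      (W := {x | x ∈ symBidisc ∧ G x ∈ e.source}) (fun x hx => hFd x hx.1 hx.2) e.open_target
      ⟨_, mem_chart_target E (f z)⟩ fun y hy => ?_
    obtain ⟨x, hx⟩ := H.equivariantMap_bijective.2 (e.symm y)
    have hGx : G x = e.symm y := by rw [hG]; simp only [toOpens_coe]; exact hx
    refine ⟨x, ⟨x.2, by rw [hGx]; exact e.map_target hy⟩, ?_⟩
    change e (G x) = y
    rw [hGx, e.right_inv hy]
  set T' : (ℂ × ℂ) ≃L[ℂ] E :=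
    (LinearEquiv.ofBijective T.toLinearMap ⟨hTinj, hTsurj⟩).toContinuousLinearEquiv
  have hTT' : (T' : ℂ × ℂ →L[ℂ] E) = T := by ext <;> rfl
  have hev : ∀ᶠ x in 𝓝 x₀, x ∈ symBidisc ∧ G x ∈ e.source :=
    Filter.Eventually.and (p := fun x => x ∈ symBidisc) (symBidisc.isOpen.mem_nhds hx₀m)
      ((hGd x₀ hx₀m).continuousAt.preimage_mem_nhds (e.open_source.mem_nhds (by
        rw [hGx₀]; exact mem_chart_source E _)))
  have hstrict : HasStrictFDerivAt F (T' : ℂ × ℂ →L[ℂ] E) x₀ := by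
    rw [hTT', ← hT.fderiv]
    exact hasStrictFDerivAt_of_eventually_differentiableAt (hev.mono fun x hx => hFd x hx.1 hx.2)
  -- the inverse is given near `f z` by a local inverse of the chart representation
  set g := hstrict.localInverse F T' x₀
  have hFx₀ : F x₀ = e (f z) := congrArg e hGx₀
  have hgd : DifferentiableAt ℂ g (e (f z)) := by
    rw [← hFx₀]
    exact hstrict.to_localInverse.hasFDerivAt.differentiableAt
  have hgx₀ : g (e (f z)) = x₀ := by rw [← hFx₀]; exact hstrict.localInverse_apply_image
  have hec : MDifferentiableAt 𝓘(ℂ, E) 𝓘(ℂ, E) e (f z) :=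
    mdifferentiableAt_atlas (chart_mem_atlas E (f z)) (mem_chart_source E _)
  have hcomp : MDifferentiableAt 𝓘(ℂ, E) 𝓘(ℂ, ℂ × ℂ) (fun x => g (e x)) (f z) :=
    MDifferentiableAt.comp (g := g) (f z) hgd.mdifferentiableAt hec
  have hev2 : ∀ᶠ x in 𝓝 (f z), g (e x) ∈ symBidisc ∧ G (g (e x)) ∈ e.source := by
    have := hcomp.continuousAt.tendsto
    rw [hgx₀] at this
    exact this.eventually hev
  have hev3 : ∀ᶠ x in 𝓝 (f z), F (g (e x)) = e x := by
    have h1 := hstrict.eventually_right_inverse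
    rw [hFx₀] at h1
    exact hec.continuousAt.tendsto.eventually h1
  have hfinal : MDifferentiableAt 𝓘(ℂ, E) 𝓘(ℂ, ℂ × ℂ)
      (fun x => toOpens symBidisc (leafMap z) (g (e x))) (f z) :=
    MDifferentiableAt.comp (g := toOpens symBidisc (leafMap z)) (f := fun x => g (e x)) (f z)
      (mdifferentiableAt_toOpens (by rw [hgx₀]; exact hx₀m)) hcomp
  refine hfinal.congr_of_eventuallyEq ?_
  filter_upwards [hev2, hev3, chart_source_mem_nhds E (f z)] with x h1 h2 h3
  rw [Equiv.symm_apply_eq]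
  exact (e.injOn h1.2 h3 h2).symm

theorem IsLeafModel.exists_biholomorphic (H : IsLeafModel D d f Θ)
    (hV : ∀ z, ∃ A : E, A ≠ 0 ∧
      ∀ a : ℂ, orbitDeriv Θ (f z) (f z) (0, a) = (a + conj a * z) • A) :
    ∃ Λ : symBidisc ≃ Ω, MDifferentiable 𝓘(ℂ, ℂ × ℂ) 𝓘(ℂ, E) Λ ∧
      MDifferentiable 𝓘(ℂ, E) 𝓘(ℂ, ℂ × ℂ) Λ.symm := by
  refine ⟨H.equiv, H.mdifferentiable_equivariantMap hV, fun y => ?_⟩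
  obtain ⟨m, z, rfl⟩ := H.cover y
  have h1 : H.equiv.symm = (symAutHom m).1 ∘ H.equiv.symm ∘ (Θ m).1.symm := funext fun y => by
    simp only [Function.comp_apply]
    rw [Equiv.symm_apply_eq]
    change y = equivariantMap Θ f _
    rw [H.equivariantMap_symAutHom]
    change y = (Θ m).1 (H.equiv (H.equiv.symm _))
    rw [Equiv.apply_symm_apply, Equiv.apply_symm_apply]
  rw [h1]
  refine MDifferentiableAt.comp (g := (symAutHom m).1) _ ((symAutHom m).2.1 _)
    (MDifferentiableAt.comp (g := H.equiv.symm) _ ?_ ((Θ m).2.2 _))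
  rw [Equiv.symm_apply_apply]
  exact H.mdifferentiableAt_equiv_symm hV z

end Biholomorphic

/-! ### Extraction of a leaf -/

section Extraction

variable {E : Type*} [NormedAddCommGroup E] [NormedSpace ℂ E] [FiniteDimensional ℂ E]
  {Ω : Type*} [TopologicalSpace Ω] [ChartedSpace E Ω] [IsManifold 𝓘(ℂ, E) ω Ω]

theorem exists_biholomorphic_of_isRoyalDisc {D : Set Ω} {ℰ : D → Set Ω} (hR : IsRoyalDisc E D)
    (hF : IsFlatFibration E D ℰ) (hS : IsSynchronous E D ℰ) (hreg : IsRegularRoyal E D)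
    (hsharp : ActsSharply E D ℰ) :
    ∃ Λ : symBidisc ≃ Ω, MDifferentiable 𝓘(ℂ, ℂ × ℂ) 𝓘(ℂ, E) Λ ∧
      MDifferentiable 𝓘(ℂ, E) 𝓘(ℂ, ℂ × ℂ) Λ.symm := by
  obtain ⟨d, Θ, hpair, hsmooth, -, hfree⟩ := hreg
  obtain ⟨d', Θ', hpair', hsync⟩ := hS
  have hdD : ∀ z, d z ∈ D := fun z => by rw [← hpair.1.2]; exact mem_range_self z
  set x₀ : D := ⟨d discZero, hdD discZero⟩ with hx₀
  -- the synchronization of the leaf through `d 0`, transferred to the pair `(d, Θ)`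
  obtain ⟨b, rfl, hb⟩ := hpair.exists_discAut hR.determined hpair'
  obtain ⟨g, hg, hg0, hgs⟩ := hsync x₀ (b.1.symm discZero) (by
    rw [Function.comp_apply, Equiv.apply_symm_apply])
  have hgb := hg.comp_discAut b⁻¹
  have hdisj : ∀ (m : biholAut ℂ unitDisc) (x : Ω), x ∈ ℰ x₀ → (Θ m).1 x ∈ ℰ x₀ →
      m.1 discZero = discZero := by
    intro m x hx hmx
    have h1 := hF.equivariant (Θ m) x₀ ⟨d (m.1 discZero), hdD _⟩ (hpair.2 m discZero)
    have h2 : (Θ m).1 x ∈ ℰ ⟨d (m.1 discZero), hdD _⟩ := by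
      rw [← h1]; exact mem_image_of_mem _ hx
    by_contra hne
    have h3 : x₀ ≠ ⟨d (m.1 discZero), hdD _⟩ := fun h =>
      hne (hpair.1.1.injective (congrArg Subtype.val h)).symm
    exact Set.disjoint_left.1 (hF.disjoint _ _ h3) hmx h2
  have hmem : ∀ z, (g ∘ (b⁻¹).1) z ∈ ℰ x₀ := fun z => by rw [← hgb.2]; exact mem_range_self z
  have hmodel : IsLeafModel D d (g ∘ (b⁻¹).1) Θ :=
    { pair := hpair
      smooth := hsmooth
      free := hfree
      leaf := hgb.1
      base := hg0
      inter := fun z hz => by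
        have h1 : (g ∘ (b⁻¹).1) z ∈ ℰ x₀ ∩ D := ⟨hmem z, hz⟩
        rw [hF.inter_eq] at h1
        exact hgb.1.injective (h1.trans hg0.symm)
      sync := fun m hm z => by
        have h1 := hgs (b⁻¹ * m * b) (by
          change b.1.symm (m.1 (b.1 (b.1.symm discZero))) = _
          rw [Equiv.apply_symm_apply, hm]) (b.1.symm z)
        rw [hb, show b * (b⁻¹ * m * b) * b⁻¹ = m by group] at h1
        refine h1.trans ?_
        change g (b.1.symm (m.1 (b.1 (b.1.symm (m.1 (b.1 (b.1.symm z))))))) = _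
        rw [Equiv.apply_symm_apply, Equiv.apply_symm_apply]
        rfl
      disjoint := fun m z w h => hdisj m _ (hmem z) (by rw [h]; exact hmem w)
      cover := fun x => by
        have hx : x ∈ ⋃ y : D, ℰ y := by rw [hF.cover]; exact mem_univ x
        obtain ⟨y, hy⟩ := mem_iUnion.1 hx
        obtain ⟨w, hw⟩ : (y : Ω) ∈ range d := by rw [hpair.1.2]; exact y.2
        have h1 := hF.equivariant (Θ (discAut 0 (-w))) x₀ y (by
          rw [← hw]
          refine (hpair.2 _ discZero).trans ?_
          rw [discAut_neg_apply_discZero])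
        rw [← h1, ← hgb.2] at hy
        obtain ⟨_, ⟨z, rfl⟩, h2⟩ := hy
        exact ⟨_, z, h2⟩ }
  obtain ⟨k, hk, hkV⟩ := hmodel.exists_normalized fun z hz =>
    hmodel.exists_velocity_of_actsSharply (fun y hy => by
      rw [show y = x₀ from Subtype.ext hy, ← hgb.2]) hF.disjoint hR.determined hsharp hz
  exact hk.exists_biholomorphic hkV

end Extraction

end

theorem mainTheorem1 {E : Type*} [NormedAddCommGroup E] [NormedSpace ℂ E] [FiniteDimensional ℂ E]
    {Ω : Type*} [TopologicalSpace Ω] [T2Space Ω] [ChartedSpace E Ω] [IsManifold 𝓘(ℂ, E) ω Ω] :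
    (∃ Λ : symBidisc ≃ Ω, MDifferentiable 𝓘(ℂ, ℂ × ℂ) 𝓘(ℂ, E) Λ ∧
        MDifferentiable 𝓘(ℂ, E) 𝓘(ℂ, ℂ × ℂ) Λ.symm) ↔
      ∃ (D : Set Ω) (ℰ : D → Set Ω), IsRoyalDisc E D ∧ IsFlatFibration E D ℰ ∧
        IsSynchronous E D ℰ ∧ IsRegularRoyal E D ∧ ActsSharply E D ℰ := by
  constructor
  · rintro ⟨Λ, h, h'⟩
    exact ⟨_, _, (isConcomitantPair_of_biholomorphic h h').isRoyalDisc,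
      isFlatFibration_of_biholomorphic h h', isSynchronous_of_biholomorphic h h',
      isRegularRoyal_of_biholomorphic h h', actsSharply_of_biholomorphic h h'⟩
  · rintro ⟨D, ℰ, hR, hF, hS, hreg, hsharp⟩
    exact exists_biholomorphic_of_isRoyalDisc hR hF hS hreg hsharp
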